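/- Setting. Let $M$ be a smooth manifold of dimension $m$, $\pi:E\to M$ a smooth real vector bundle of rank $r$, and let $((E,\pi,M),[\,,]_{E,h},(\rho,\eta))$ be a generalized Lie algebroid: $h,\eta$ are diffeomorphisms of $M$, $\rho:E\to TM$ is a vector bundle morphism covering $\eta$, and $[\,,]_{E,h}$ is a Lie bracket on the smooth sections of $E$ with $[u,fv]_{E,h}=f[u,v]_{E,h}+\big(\Gamma(Th\circ\rho,h\circ\eta)(u)f\big)v$. (This rule forces $\rho=0$ on $E_p$ unless $h(\eta(p))=p$, so $\rho$ induces a linear map $\rho_h:E_{h(x)}\to T_xM$ for each $x$, zero if $\eta(h(x))\neq x$.) The generalized tangent bundle $(\rho,\eta)TE\to E$ has at $u\in E_x$ the fibre $\{(z,v)\in E_{h(x)}\times T_uE: T\pi(v)=\rho_h(z)\}$; its anchor is $\tilde\rho(z,v)=v$. Charts. A chart pair consists of a local trivialization of $E$ near $x$, with fibre coordinates $y^a$ and frame $s_a$, and one near $h(x)$, with frame $s'_a$ (they may coincide if $h=\mathrm{id}$). It gives the local base sections $\tilde\partial_a=(s'_a\circ h\circ\pi,\ (\rho^i_a\circ h\circ\pi)\partial_i)$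 and $\dot{\tilde\partial}_a=(0,\dot\partial_a)$, $\dot\partial_a=\partial/\partial y^a$, of $(\rho,\eta)TE$. The Lie bracket of $(\rho,\eta)TE$ is determined by $[\tilde\partial_a,\tilde\partial_b]=(L^c_{ab}\circ h\circ\pi)\tilde\partial_c$ (where $[s'_a,s'_b]_{E,h}=L^c_{ab}s'_c$), $[\tilde\partial_a,\dot{\tilde\partial}_b]=[\dot{\tilde\partial}_a,\dot{\tilde\partial}_b]=0$ and the Leibniz rule with anchor $\tilde\rho$. Write $U^a=y^a$; the Liouville section is $\mathbb C=U^a\dot{\tilde\partial}_a$. Sprays. Fix a vector bundle morphism $(g,h):E\to E$ that is invertible on each fibre, let $\tilde g^b_a\circ h$ be the components of the inverse of $g$, and let $\mathcal J$ be the endomorphism of $(\rho,\eta)TE$ with $\mathcal J\tilde\partial_a=(\tilde g^b_a\circ h\circ\pi)\dot{\tilde\partial}_b$ and $\mathcal J\dot{\tilde\partial}_a=0$. Let $\Omega\subseteq E$ be an open set that contains all nonzero vectors (for example $\Omega=E$, or the complement of the zero section). A $(\rho,\eta)$-spray is a section $S$ of $(\rho,\eta)TE$, of class $C^1$ on $E$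 and $C^\infty$ on $\Omega$, with $\mathcal JS=\mathbb C$ and $[\mathbb C,S]-S=0$. A function $f$ on $E$ is 1-homogeneous if $U^a\dot\partial_af=f$. Two sprays $S,\bar S$ are projectively related if $\bar S=S+f\mathbb C$ for some 1-homogeneous function $f$ of class $C^1$ on $E$. Berwald derivative. The horizontal projector of $S$ is $\mathcal H_S(X)=\frac12\big(X+[\mathcal JX,S]-\mathcal J[X,S]\big)$; put $\tilde\delta_a=\mathcal H_S(\tilde\partial_a)=\tilde\partial_a+H^b_a\dot{\tilde\partial}_b$. In a chart pair the Berwald covariant $(\rho,\eta)$-derivative $\nabla$ induced by $\mathcal H_S$ is the linear $(\rho,\eta)$-connection with $$\nabla_{\tilde\delta_a}\tilde\delta_b=-(\dot\partial_bH^c_a)\tilde\delta_c,\qquad \nabla_{\tilde\delta_a}\dot{\tilde\partial}_b=-(\dot\partial_bH^c_a)\dot{\tilde\partial}_c,\qquad \nabla_{\dot{\tilde\partial}_a}\tilde\delta_b=\nabla_{\dot{\tilde\partial}_a}\dot{\tilde\partial}_b=0 .$$ Bars denote the same objects for $\bar S$. Theorem. Let $S,\bar S$ be two $(\rho,\eta)$-sprays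 (for the same $(g,h)$ and $\Omega$) and let $\mathcal A$ be any family of chart pairs whose domains cover $E$. Then $S$ and $\bar S$ are projectively related if and only if there is a 1-homogeneous function $f$ of class $C^1$ on $E$ such that in every chart pair of $\mathcal A$, with $$A^b_a=\tfrac12\big((\tilde g^c_a\circ h\circ\pi)\,U^b\,\dot\partial_cf+f\,(\tilde g^b_a\circ h\circ\pi)\big),$$ the Berwald derivatives $\nabla$ and $\bar\nabla$ induced by $\mathcal H_S$ and $\mathcal H_{\bar S}$ satisfy, at all points of $\Omega$ in the domain of the pair, $$\begin{aligned}\bar\nabla_XY=\nabla_XY&-X^aY^b\dot\partial_bA^c_a\,\tilde\delta_c+\Big(-X^aY^bA^c_m\dot\partial_bH^m_a-X^aY^bA^c_m\dot\partial_bA^m_a-X^a\dot{\tilde Y}^b\dot\partial_bA^c_a\\&-X^aA^m_aY^d\dot\partial_mA^c_d-X^aY^d(\rho^i_a\circ h\circ\pi)\partial_iA^c_d-X^aY^dH^m_a\dot\partial_mA^c_d\\&+X^aY^dA^b_d\dot\partial_bH^c_a-\dot{\tilde X}^aY^d\dot\partial_aA^c_d\Big)\dot{\tilde\partial}_c\end{aligned}$$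 for all smooth local sections $X=X^a\bar{\tilde\delta}_a+\dot{\tilde X}^a\dot{\tilde\partial}_a$ and $Y=Y^b\bar{\tilde\delta}_b+\dot{\tilde Y}^b\dot{\tilde\partial}_b$ of $(\rho,\eta)TE$ over that part of $\Omega$. -/

import Mathlib

open scoped Manifold ContDiff Topology
open Bundle

noncomputable section

namespace GenLie

section Basics

variable {m r : ℕ} {M : Type*} [TopologicalSpace M]
  [ChartedSpace (EuclideanSpace ℝ (Fin m)) M] [IsManifold (𝓡 m) ∞ M]
  {E : M → Type*} [TopologicalSpace (TotalSpace (Fin r → ℝ) E)]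
  [∀ x, AddCommGroup (E x)] [∀ x, Module ℝ (E x)] [∀ x, TopologicalSpace (E x)]
  [FiberBundle (Fin r → ℝ) E] [VectorBundle ℝ (Fin r → ℝ) E]
  [ContMDiffVectorBundle ∞ (Fin r → ℝ) E (𝓡 m)]

variable (m) in
/-- The model with corners of the total space of a rank `r` bundle over an `m`-manifold. -/
abbrev totalModel (r : ℕ) :=
  (𝓡 m).prod 𝓘(ℝ, Fin r → ℝ)

variable (m r E) in
/-- A generalized Lie algebroid structure `([ , ]_{E,h}, (ρ, η))` on the vector bundle `E → M`:
diffeomorphisms `h, η` of `M`, a vector bundle morphism `ρ : E → TM` covering `η`, and a real Lie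
algebra structure on the smooth sections of `E` with the Leibniz rule
`[u, f v] = f [u, v] + (Γ(Th ∘ ρ, h ∘ η)(u) f) v`.
The vector field `Γ(Th ∘ ρ, h ∘ η)(u)` takes at the point `h (η q)` the value `Th (ρ (u q))`. -/
structure GeneralizedLieAlgebroid where
  h : M ≃ₘ⟮𝓡 m, 𝓡 m⟯ M
  η : M ≃ₘ⟮𝓡 m, 𝓡 m⟯ M
  ρ : ∀ q : M, E q →ₗ[ℝ] TangentSpace (𝓡 m) (η q)
  smooth_ρ : ContMDiff (totalModel m r) (𝓡 m).tangent ∞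
    (fun v : TotalSpace (Fin r → ℝ) E ↦ (⟨η v.proj, ρ v.proj v.2⟩ : TangentBundle (𝓡 m) M))
  bracket : Cₛ^∞⟮𝓡 m; Fin r → ℝ, E⟯ →ₗ[ℝ]
    Cₛ^∞⟮𝓡 m; Fin r → ℝ, E⟯ →ₗ[ℝ] Cₛ^∞⟮𝓡 m; Fin r → ℝ, E⟯
  bracket_self : ∀ u, bracket u u = 0
  jacobi : ∀ u v w,
    bracket u (bracket v w) + bracket v (bracket w u) + bracket w (bracket u v) = 0
  leibniz : ∀ (u v w : Cₛ^∞⟮𝓡 m; Fin r → ℝ, E⟯) (f : C^∞⟮𝓡 m, M; 𝓘(ℝ, ℝ), ℝ⟯),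
    (∀ p, w p = f p • v p) → ∀ q : M,
      bracket u w (h (η q)) = f (h (η q)) • bracket u v (h (η q)) +
        (show ℝ from
          mfderiv (𝓡 m) 𝓘(ℝ, ℝ) f (h (η q)) (mfderiv (𝓡 m) (𝓡 m) h (η q) (ρ q (u q)))) •
          v (h (η q))

/-- Every vector of `E` is the value of a smooth global section. -/
theorem exists_section_eq [T2Space M] [SigmaCompactSpace M] (p : M) (z : E p) :
    ∃ s : Cₛ^∞⟮𝓡 m; Fin r → ℝ, E⟯, s p = z := by
  obtain ⟨s, hs⟩ := exists_contMDiffSection_forall_mem_convex_of_local (𝓡 m) (n := (⊤ : ℕ∞))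
    (F_fiber := Fin r → ℝ) E (fun x ↦ {v : E x | ∀ hx : p = x, v = hx ▸ z})
    (by
      intro x v hv w hw a b _ _ hab hx
      rw [hv hx, hw hx, ← add_smul, hab, one_smul])
    (by
      intro x₀
      by_cases h : p = x₀
      · subst h
        obtain ⟨s, hs, hs'⟩ :=
          FiberBundle.exists_contMDiffOn_extend (k := ∞) (𝓡 m) (Fin r → ℝ) z
        refine ⟨s, hs, FiberBundle.extend (Fin r → ℝ) z, hs', ?_⟩
        intro y _ hx
        subst hx
        simp
      · refine ⟨{p}ᶜ, isOpen_compl_singleton.mem_nhds (fun h' ↦ h h'.symm), fun _ ↦ 0,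
          (contMDiff_zeroSection ℝ E).contMDiffOn, ?_⟩
        intro y hy hx
        exact absurd hx.symm hy)
  exact ⟨s, hs p rfl⟩

variable (A : GeneralizedLieAlgebroid m r E)

namespace GeneralizedLieAlgebroid

/-- The anchor `(ρ ∘ h)_x : E_{h(x)} → T_x M` of the pull-back of `E` by `h`, i.e. the map with
components `ρ^i_a ∘ h`. The morphism `ρ` sends `E_{h(x)}` to the tangent space at `η (h x)`; the
Leibniz rule forces `ρ` to vanish on `E_{h(x)}` unless `η (h x) = x`. -/
def anchor (x : M) : E (A.h x) →ₗ[ℝ] TangentSpace (𝓡 m) x := by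
  classical
  exact if hx : A.η (A.h x) = x then
    cast (congrArg (fun y ↦ (E (A.h x) →ₗ[ℝ] TangentSpace (𝓡 m) y)) hx) (A.ρ (A.h x)) else 0

/-- A (not necessarily continuous) section of the bundle `(h ∘ π)^* E ⊕ TE` over `E`. -/
abbrev Field (A : GeneralizedLieAlgebroid m r E) :=
  ∀ u : TotalSpace (Fin r → ℝ) E, E (A.h u.proj) × TangentSpace (totalModel m r) u

/-- The derivative `Γ(ρ̃, Id_E)(X) φ` of a vector-valued function `φ` on `E`. -/
def deriv {V : Type*} [NormedAddCommGroup V] [NormedSpace ℝ V] (X : A.Field)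
    (φ : TotalSpace (Fin r → ℝ) E → V) (u : TotalSpace (Fin r → ℝ) E) : V :=
  mfderiv (totalModel m r) 𝓘(ℝ, V) φ u (X u).2

/-- Membership of `X u` in the fibre of the generalized tangent bundle `(ρ, η)TE`: the base
component of the tangent vector is the anchor of the first component. -/
def MemFiber (X : A.Field) (u : TotalSpace (Fin r → ℝ) E) : Prop :=
  mfderiv (totalModel m r) (𝓡 m) (fun v : TotalSpace (Fin r → ℝ) E ↦ v.proj) u (X u).2 =
    A.anchor u.proj (X u).1

/-- `X` restricts on the set `s ⊆ E` to a section of class `C^n` of `(ρ, η)TE`. -/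
structure IsSectionOn (n : WithTop ℕ∞) (s : Set (TotalSpace (Fin r → ℝ) E)) (X : A.Field) :
    Prop where
  mem : ∀ u ∈ s, A.MemFiber X u
  fst : ContMDiffOn (totalModel m r) (totalModel m r) n
    (fun u ↦ (⟨A.h u.proj, (X u).1⟩ : TotalSpace (Fin r → ℝ) E)) s
  snd : ContMDiffOn (totalModel m r) (totalModel m r).tangent n
    (fun u ↦ (⟨u, (X u).2⟩ : TangentBundle (totalModel m r) (TotalSpace (Fin r → ℝ) E))) s

variable (E) in
/-- The fibre coordinates of a vector of `E` in a trivialization. -/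
abbrev coord (e : Trivialization (Fin r → ℝ) (π (Fin r → ℝ) E))
    (u : TotalSpace (Fin r → ℝ) E) : Fin r → ℝ :=
  (e u).2

section Bracket

variable [T2Space M] [SigmaCompactSpace M]

/-- The bilinear form `(z₁, z₂) ↦ z₁^a z₂^b (L^c_{ab} ∘ h)(x)`, where `[s_a, s_b] = L^c_{ab} s_c`
for the frame `s_a` of the trivialization `e`. It is computed from arbitrary sections `s, t` of `E`
with values `z₁, z₂` at `h x`, by removing from the components of `[s, t]` the terms in which the
components of `s` and `t` are differentiated. -/
def structureForm (e : Trivialization (Fin r → ℝ) (π (Fin r → ℝ) E)) (x : M)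
    (z₁ z₂ : E (A.h x)) : Fin r → ℝ :=
  let s := Classical.choose (exists_section_eq (m := m) (r := r) (A.h x) z₁)
  let t := Classical.choose (exists_section_eq (m := m) (r := r) (A.h x) z₂)
  let ds : Fin r → ℝ :=
    mfderiv (𝓡 m) 𝓘(ℝ, Fin r → ℝ) (fun y ↦ coord E e ⟨A.h y, s (A.h y)⟩) x (A.anchor x z₂)
  let dt : Fin r → ℝ :=
    mfderiv (𝓡 m) 𝓘(ℝ, Fin r → ℝ) (fun y ↦ coord E e ⟨A.h y, t (A.h y)⟩) x (A.anchor x z₁)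
  coord E e ⟨A.h x, A.bracket s t (A.h x)⟩ - dt + ds

/-- The Lie bracket of `(ρ, η)TE`. In a local frame `S_a` of `(h ∘ π)^* E` the first component is
`(ρ̃(X) Y^c - ρ̃(Y) X^c + X^a Y^b L^c_{ab} ∘ h ∘ π) S_c`, the second component is the Lie bracket of
the vector fields `ρ̃(X)` and `ρ̃(Y)` on `E`. -/
def lie (X Y : A.Field) : A.Field := fun u ↦
  let e := trivializationAt (Fin r → ℝ) E (A.h u.proj)
  (e.symm (A.h u.proj)
      (A.deriv X (fun v ↦ coord E e ⟨A.h v.proj, (Y v).1⟩) u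
        - A.deriv Y (fun v ↦ coord E e ⟨A.h v.proj, (X v).1⟩) u
        + A.structureForm e u.proj (X u).1 (Y u).1),
    VectorField.mlieBracket (totalModel m r) (fun v ↦ (X v).2) (fun v ↦ (Y v).2) u)

end Bracket

/-- The vertical lift of `w ∈ E_x` to `u ∈ E_x`: the velocity at `0` of `t ↦ u + t w`. -/
def vlift (u : TotalSpace (Fin r → ℝ) E) (w : E u.proj) : TangentSpace (totalModel m r) u :=
  mfderiv 𝓘(ℝ, ℝ) (totalModel m r)
    (fun t : ℝ ↦ (⟨u.proj, u.2 + t • w⟩ : TotalSpace (Fin r → ℝ) E)) 0 (1 : ℝ)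

/-- The Liouville section `ℂ`. -/
def liouville : A.Field := fun u ↦ (0, vlift u u.2)

/-- A function `f` on `E` is 1-homogeneous if `Γ(ρ̃, Id_E)(ℂ) f = f`. -/
def OneHomogeneous (f : TotalSpace (Fin r → ℝ) E → ℝ) : Prop :=
  ∀ u, A.deriv A.liouville f u = f u

/-- A locally invertible vector bundle morphism `(g, h) : E → E`. -/
structure InvertibleMorphism (A : GeneralizedLieAlgebroid m r E) where
  g : ∀ x : M, E x ≃ₗ[ℝ] E (A.h x)
  smooth_g : ContMDiff (totalModel m r) (totalModel m r) ∞
    (fun v : TotalSpace (Fin r → ℝ) E ↦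
      (⟨A.h v.proj, g v.proj v.2⟩ : TotalSpace (Fin r → ℝ) E))

variable {A} (G : A.InvertibleMorphism)

/-- The almost tangent structure `J_{(g,h)}`. -/
def J (X : A.Field) : A.Field := fun u ↦ (0, vlift u ((G.g u.proj).symm (X u).1))

section Spray

variable [T2Space M] [SigmaCompactSpace M]

/-- `S` is a `(ρ, η)`-spray (with respect to `J_{(g,h)}`), of class `C^1` on `E` and smooth on the
set `Ω`: a section of `(ρ, η)TE` with `J_{(g,h)} S = ℂ` and `[ℂ, S] - S = 0`. -/
structure IsSpray (Ω : Set (TotalSpace (Fin r → ℝ) E)) (S : A.Field) : Prop where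
  section_one : A.IsSectionOn 1 Set.univ S
  section_smooth : A.IsSectionOn ∞ Ω S
  semispray : J G S = A.liouville
  derivation : A.lie A.liouville S - S = 0

variable (A) in
/-- `S'` is a projective change `S + f ℂ` of `S`, with `f` of class `C^1` and 1-homogeneous. -/
def ProjectivelyRelated (S S' : A.Field) : Prop :=
  ∃ f : TotalSpace (Fin r → ℝ) E → ℝ, ContMDiff (totalModel m r) 𝓘(ℝ, ℝ) 1 f ∧
    A.OneHomogeneous f ∧ S' = fun u ↦ S u + f u • A.liouville u

/-- The horizontal projector `H_S X = ½ (X + [J X, S] - J [X, S])`. -/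
def horProj (S X : A.Field) : A.Field :=
  (1 / 2 : ℝ) • (X + A.lie (J G X) S - J G (A.lie X S))

end Spray

end GeneralizedLieAlgebroid

open GeneralizedLieAlgebroid

variable (m r E) in
/-- A pair of vector charts of `E`; `e` is used at the points `x` (it gives the fibre coordinates
`y^a` and the frame of vertical vectors), `e'` at the points `h x` (it gives the frame `S_a` of
`(h ∘ π)^* E`). -/
structure ChartPair where
  e : Trivialization (Fin r → ℝ) (π (Fin r → ℝ) E)
  e' : Trivialization (Fin r → ℝ) (π (Fin r → ℝ) E)
  mem_e : MemTrivializationAtlas e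
  mem_e' : MemTrivializationAtlas e'

namespace ChartPair

variable {A} (c : ChartPair r E)

variable (A) in
/-- The part of `E` over the points `x` in the domain of `e` with `h x` in the domain of `e'`. -/
def domain : Set (TotalSpace (Fin r → ℝ) E) :=
  {u | u.proj ∈ c.e.baseSet ∧ A.h u.proj ∈ c.e'.baseSet}

variable (A) in
/-- The vertical base section `∂̇̃_b`. -/
def dotTilde (b : Fin r) : A.Field := fun u ↦
  (0, vlift u (c.e.symm u.proj (Pi.single b 1)))

variable (A) in
/-- The base section `∂̃_a = S_a ⊕ (ρ^i_a ∘ h ∘ π) ∂_i`, where `∂_i` is taken with the fibre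
coordinates of `e` held fixed. -/
def tilde (a : Fin r) : A.Field := fun u ↦
  let z : E (A.h u.proj) := c.e'.symm (A.h u.proj) (Pi.single a 1)
  (z, mfderiv (𝓡 m) (totalModel m r)
    (fun x ↦ (⟨x, c.e.symm x (coord E c.e u)⟩ : TotalSpace (Fin r → ℝ) E)) u.proj
    (A.anchor u.proj z))

/-- The components `X^a` of `X` on `∂̃_a`. -/
def hcomp (X : A.Field) (a : Fin r) (u : TotalSpace (Fin r → ℝ) E) : ℝ :=
  coord E c.e' ⟨A.h u.proj, (X u).1⟩ a

/-- The components `X̃^a` of `X` on `∂̇̃_a` in the base `(∂̃_a, ∂̇̃_a)`. -/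
def vcomp (X : A.Field) (a : Fin r) (u : TotalSpace (Fin r → ℝ) E) : ℝ :=
  A.deriv X (coord E c.e) u a

variable (A) in
/-- The vertical derivative `∂̇_b φ = ∂φ/∂y^b`. -/
def dot (b : Fin r) (φ : TotalSpace (Fin r → ℝ) E → ℝ) (u : TotalSpace (Fin r → ℝ) E) : ℝ :=
  A.deriv (c.dotTilde A b) φ u

variable (A) in
/-- The derivative `(ρ^i_a ∘ h ∘ π) ∂_i φ`. -/
def rhoPartial (a : Fin r) (φ : TotalSpace (Fin r → ℝ) E → ℝ)
    (u : TotalSpace (Fin r → ℝ) E) : ℝ :=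
  A.deriv (c.tilde A a) φ u

section Berwald

variable [T2Space M] [SigmaCompactSpace M] (G : A.InvertibleMorphism)

/-- The adapted horizontal base section `δ̃_a = H_S ∂̃_a` of `S`. -/
def delta (S : A.Field) (a : Fin r) : A.Field :=
  horProj G S (c.tilde A a)

/-- The components `H^b_a` in `δ̃_a = ∂̃_a + H^b_a ∂̇̃_b`; the connection coefficients of `H_S` are
`(ρ, η)Γ^b_a = -H^b_a`. -/
def H (S : A.Field) (b a : Fin r) : TotalSpace (Fin r → ℝ) E → ℝ :=
  c.vcomp (c.delta G S a) b

/-- The vertical components of `X = X^a δ̃_a + Ẋ^a ∂̇̃_a` in the base adapted to `H_S`. -/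
def acomp (S X : A.Field) (a : Fin r) (u : TotalSpace (Fin r → ℝ) E) : ℝ :=
  c.vcomp X a u - ∑ b, c.hcomp X b u * c.H G S a b u

/-- The Berwald covariant derivative `∇_X Y` induced by `H_S`, i.e. the distinguished linear
connection with components `(∂̇_b Γ^a_c, ∂̇_b Γ^a_c, 0, 0)`, where `Γ^a_c = -H^a_c`. -/
def berwald (S X Y : A.Field) (u : TotalSpace (Fin r → ℝ) E) :
    E (A.h u.proj) × TangentSpace (totalModel m r) u :=
  ∑ k, (A.deriv X (c.hcomp Y k) u
      + ∑ a, ∑ b, c.hcomp X a u * c.hcomp Y b u * c.dot A b (fun v ↦ -c.H G S k a v) u) •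
        c.delta G S k u
  + ∑ k, (A.deriv X (c.acomp G S Y k) u
      + ∑ a, ∑ b, c.hcomp X a u * c.acomp G S Y b u * c.dot A b (fun v ↦ -c.H G S k a v) u) •
        c.dotTilde A k u

/-- The components `g̃^b_a ∘ h ∘ π` of the inverse of `g`. -/
def gInv (b a : Fin r) (u : TotalSpace (Fin r → ℝ) E) : ℝ :=
  coord E c.e ⟨u.proj, (G.g u.proj).symm (c.e'.symm (A.h u.proj) (Pi.single a 1))⟩ b

/-- `A^b_a = ½ (g̃^c_a U^b ∂̇_c f + f g̃^b_a)`. -/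
def tensorA (f : TotalSpace (Fin r → ℝ) E → ℝ) (b a : Fin r)
    (u : TotalSpace (Fin r → ℝ) E) : ℝ :=
  1 / 2 * ((∑ k, c.gInv G k a u * coord E c.e u b * c.dot A k f u) + f u * c.gInv G b a u)

/-- The difference `∇̄_X Y - ∇_X Y` prescribed by the function `f`, for
`X = X^a δ̃'_a + Ẋ^a ∂̇̃_a` and `Y = Y^b δ̃'_b + Ẏ^b ∂̇̃_b` in the base adapted to `H_{S'}`. -/
def berwaldDifference (f : TotalSpace (Fin r → ℝ) E → ℝ) (S S' X Y : A.Field)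
    (u : TotalSpace (Fin r → ℝ) E) : E (A.h u.proj) × TangentSpace (totalModel m r) u :=
  let Xh := fun a ↦ c.hcomp X a u
  let Yh := fun a ↦ c.hcomp Y a u
  let Xv := fun a ↦ c.acomp G S' X a u
  let Yv := fun a ↦ c.acomp G S' Y a u
  let T := fun b a ↦ c.tensorA G f b a
  let N := fun b a ↦ c.H G S b a
  (-∑ k, (∑ a, ∑ b, Xh a * Yh b * c.dot A b (T k a) u) • c.delta G S k u)
  + ∑ k, (- (∑ a, ∑ b, ∑ l, Xh a * Yh b * T k l u * c.dot A b (N l a) u)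
      - (∑ a, ∑ b, ∑ l, Xh a * Yh b * T k l u * c.dot A b (T l a) u)
      - (∑ a, ∑ b, Xh a * Yv b * c.dot A b (T k a) u)
      - (∑ a, ∑ d, ∑ l, Xh a * T l a u * Yh d * c.dot A l (T k d) u)
      - (∑ a, ∑ d, Xh a * Yh d * c.rhoPartial A a (T k d) u)
      - (∑ a, ∑ d, ∑ l, Xh a * Yh d * N l a u * c.dot A l (T k d) u)
      + (∑ a, ∑ d, ∑ b, Xh a * Yh d * T b d u * c.dot A b (N k a) u)
      - (∑ a, ∑ d, Xv a * Yh d * c.dot A a (T k d) u)) • c.dotTilde A k u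

/-- In the chart pair `c`, over the set `Ω`, the Berwald derivatives induced by `H_S` and `H_{S'}`
differ by the expression built from `f`, for all smooth local sections `X, Y` of `(ρ, η)TE`. -/
def BerwaldRelated (Ω : Set (TotalSpace (Fin r → ℝ) E)) (f : TotalSpace (Fin r → ℝ) E → ℝ)
    (S S' : A.Field) : Prop :=
  ∀ X Y : A.Field, A.IsSectionOn ∞ (Ω ∩ c.domain A) X → A.IsSectionOn ∞ (Ω ∩ c.domain A) Y →
    ∀ u ∈ Ω ∩ c.domain A,
      c.berwald G S' X Y u = c.berwald G S X Y u + c.berwaldDifference G f S S' X Y u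

end Berwald

end ChartPair

end Basics

end GenLie

end

/-! Everything is read in a chart pair. The equation `J S = ℂ` fixes the first component of a spray
to be `g u`, so two sprays differ only in the fibre part `D^b = S'^b - S^b`, where `S^b` is the
derivative of `y^b` along `S`. The terms of the horizontal projector that involve the spray only
through its first component or its projection to the base cancel in the difference, which leaves
`H'^b_a - H^b_a = ½ g̃^k_a ∂̇_k D^b` (`IsSpray.H_sub`).

If `S' = S + f ℂ`, then `D^b = f U^b`, and the product rule turns this into `A^b_a`
(`IsSpray.H_sub_eq_tensorA`). The formula for the Berwald derivatives is then the product rule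
together with a change of adapted base (`IsSpray.berwald_eq`, with the index algebra in
`sum_smul_change`).

Conversely, insert base sections `∂̃_a`, `∂̃_b` and keep only the horizontal part of the formula:
`W_a = H'^b_a - H^b_a - A^b_a` has zero vertical derivatives on `Ω`. Put `P = D^b - f U^b`. The
spray equation `[ℂ, S] = S` makes `D^b` homogeneous of degree two, and so is `f U^b`; hence `ℂ P = 2
P`. Contracting with the first component of `S` and using `S^a g̃^k_a = U^k` with Euler's relations
gives `P = S^a W_a`, where `S^a` has degree one and `ℂ W_a = 0`; hence `ℂ P = P`. So `P = 0` on `Ω`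
(`ChartPair.BerwaldRelated.deriv_coord_of_mem`). On the zero section the fibre parts of both sprays
vanish by homogeneity.

Two points need care. `A^b_a` contains first derivatives of a function that is only `C^1`; but a
1-homogeneous function differentiable at zero is linear on each fibre, so `∂̇_k f` is the value of
`f` on a frame vector and is again `C^1`. Further, the bracket of `(ρ, η)TE` is defined through
chosen sections and a chosen trivialization; locality and the Leibniz rule of the algebroid show
that neither choice matters (`structureForm_eq`, `coord_lie_fst`). -/

noncomputable section

set_option linter.unusedSectionVars false

namespace GenLie

/-! ### Vector fields as derivations of functions on a manifold. -/

section VectorFields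

open VectorField Set

variable {E : Type*} [NormedAddCommGroup E] [NormedSpace ℝ E]
  {H : Type*} [TopologicalSpace H] {I : ModelWithCorners ℝ E H}
  {N : Type*} [TopologicalSpace N] [ChartedSpace H N]
  {F : Type*} [NormedAddCommGroup F] [NormedSpace ℝ F]

/-- The derivative of a function along a vector field inherits the regularity of the field. -/
theorem contMDiffAt_mvfderiv [IsManifold I 1 N] {n k : WithTop ℕ∞}
    {V : ∀ x : N, TangentSpace I x} {φ : N → F} {x : N}
    (hV : ContMDiffAt I I.tangent n (fun y ↦ (⟨y, V y⟩ : TangentBundle I N)) x)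
    (hφ : ContMDiffAt I 𝓘(ℝ, F) k φ x) (hnk : n + 1 ≤ k) :
    ContMDiffAt I 𝓘(ℝ, F) n (fun y ↦ mvfderiv I φ y (V y)) x := by
  have h1 := hφ.mfderiv_const hnk
  have h2 := ContMDiffAt.clm_apply_of_inCoordinates h1 hV
    (hφ.of_le (le_trans (by simp) hnk))
  exact (contMDiff_snd_tangentBundle_modelSpace F 𝓘(ℝ, F)).contMDiffAt.comp x h2

/-- The Lie bracket of vector fields acts on functions as the commutator of derivations. -/
theorem mvfderiv_mlieBracket [CompleteSpace E] [I.Boundaryless] [IsManifold I 3 N]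
    {V W : ∀ x : N, TangentSpace I x} {φ : N → F} {x : N}
    (hV : ContMDiffAt I I.tangent 1 (fun y ↦ (⟨y, V y⟩ : TangentBundle I N)) x)
    (hW : ContMDiffAt I I.tangent 1 (fun y ↦ (⟨y, W y⟩ : TangentBundle I N)) x)
    (hφ : ContMDiffAt I 𝓘(ℝ, F) 2 φ x) :
    mvfderiv I φ x (mlieBracket I V W x) =
      mvfderiv I (fun y ↦ mvfderiv I φ y (W y)) x (V x) -
      mvfderiv I (fun y ↦ mvfderiv I φ y (V y)) x (W x) := by
  have : IsManifold I 1 N := .of_le (n := 3) (by norm_num)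
  have : IsManifold I 2 N := .of_le (n := 3) (by norm_num)
  have hWφ := contMDiffAt_mvfderiv hW hφ (by norm_num)
  have hVφ := contMDiffAt_mvfderiv hV hφ (by norm_num)
  have hψ : ∀ z ∈ (extChartAt I x).target, MDifferentiableAt 𝓘(ℝ, E) I (extChartAt I x).symm z :=
    fun z hz ↦ by
      have := mdifferentiableWithinAt_extChartAt_symm hz
      rwa [I.range_eq_univ, mdifferentiableWithinAt_univ] at this
  have hinv : ∀ z ∈ (extChartAt I x).target,
      (mfderiv 𝓘(ℝ, E) I (extChartAt I x).symm z).IsInvertible := fun z hz ↦ by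
    have := isInvertible_mfderivWithin_extChartAt_symm hz
    rwa [I.range_eq_univ, mfderivWithin_univ] at this
  -- Naturality: differentiating along a field on the manifold is the same as differentiating the
  -- chart expression along the pulled-back field. This moves the whole identity into the model
  -- space.
  have hchain : ∀ (χ : N → F) (X : ∀ x : N, TangentSpace I x), ∀ z ∈ (extChartAt I x).target,
      MDifferentiableAt I 𝓘(ℝ, F) χ ((extChartAt I x).symm z) →
      fderiv ℝ (χ ∘ (extChartAt I x).symm) z
        (mpullbackWithin 𝓘(ℝ, E) I (extChartAt I x).symm X (range I) z) =
      mvfderiv I χ ((extChartAt I x).symm z) (X ((extChartAt I x).symm z)) := by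
    intro χ X z hz hχ
    rw [← mfderiv_eq_fderiv, mfderiv_comp z hχ (hψ z hz), mpullbackWithin_apply,
      I.range_eq_univ, mfderivWithin_univ]
    exact congrArg (mfderiv I 𝓘(ℝ, F) χ _) ((hinv z hz).self_apply_inverse _)
  have hnhds : (extChartAt I x).target ∈ 𝓝 (extChartAt I x x) := extChartAt_target_mem_nhds x
  have hx : extChartAt I x x ∈ (extChartAt I x).target := mem_extChartAt_target x
  have hxx : (extChartAt I x).symm (extChartAt I x x) = x := extChartAt_to_inv x
  have key : ∀ X : ∀ x : N, TangentSpace I x,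
      (fun z ↦ fderiv ℝ (φ ∘ (extChartAt I x).symm) z
        (mpullbackWithin 𝓘(ℝ, E) I (extChartAt I x).symm X (range I) z)) =ᶠ[𝓝 (extChartAt I x x)]
      (fun y ↦ mvfderiv I φ y (X y)) ∘ (extChartAt I x).symm := by
    intro X
    have hcont : Filter.Tendsto (extChartAt I x).symm (𝓝 (extChartAt I x x)) (𝓝 x) := by
      simpa [hxx] using (hψ _ hx).continuousAt.tendsto
    filter_upwards [hnhds, hcont.eventually ((contMDiffAt_iff_contMDiffAt_nhds (by simp)).1 hφ)]
      with z hz hz'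
    exact hchain φ X z hz (hz'.mdifferentiableAt (by simp))
  have hsymm : ContMDiffAt 𝓘(ℝ, E) I 2 (extChartAt I x).symm (extChartAt I x x) := by
    have := contMDiffWithinAt_extChartAt_symm_range (n := 2) x hx
    rwa [I.range_eq_univ, contMDiffWithinAt_univ] at this
  have hφ' : ContDiffAt ℝ 2 (φ ∘ (extChartAt I x).symm) (extChartAt I x x) := by
    rw [← contMDiffAt_iff_contDiffAt]
    exact ContMDiffAt.comp _ (by rwa [hxx]) hsymm
  have hd : ∀ {X : ∀ x : N, TangentSpace I x},
      ContMDiffAt I I.tangent 1 (fun y ↦ (⟨y, X y⟩ : TangentBundle I N)) x →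
      DifferentiableAt ℝ (mpullbackWithin 𝓘(ℝ, E) I (extChartAt I x).symm X (range I))
        (extChartAt I x x) := by
    intro X hX
    have := MDifferentiableWithinAt.differentiableWithinAt_mpullbackWithin_vectorField
      (s := univ) (hX.mdifferentiableAt (by simp)).mdifferentiableWithinAt
    rw [preimage_univ, univ_inter] at this
    exact this.differentiableAt (by rw [I.range_eq_univ]; exact Filter.univ_mem)
  -- The commutator identity in the flat model space; the rest translates its three terms back
  -- through the chart.
  have hbr := fderiv_apply_lieBracket hφ' (by simp) (hd hW) (hd hV)
  rw [(key W).fderiv_eq, (key V).fderiv_eq,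
    hchain _ V _ hx (by rw [hxx]; exact hWφ.mdifferentiableAt (by simp)),
    hchain _ W _ hx (by rw [hxx]; exact hVφ.mdifferentiableAt (by simp)), hxx] at hbr
  have hcomp : ∀ v, mvfderiv I φ x v = fderiv ℝ (φ ∘ (extChartAt I x).symm) (extChartAt I x x)
      (mfderiv I 𝓘(ℝ, E) (extChartAt I x) x v) := by
    intro v
    have h : φ =ᶠ[𝓝 x] (φ ∘ (extChartAt I x).symm) ∘ extChartAt I x := by
      filter_upwards [extChartAt_source_mem_nhds (I := I) x] with y hy
      simp only [Function.comp, (extChartAt I x).left_inv hy]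
    rw [mvfderiv, h.mfderiv_eq, mfderiv_comp x
      ((hφ'.differentiableAt (by simp)).mdifferentiableAt)
      (mdifferentiableAt_extChartAt (mem_chart_source H x)), mfderiv_eq_fderiv]
    rfl
  rw [← hbr, hcomp, ← mlieBracketWithin_univ, mlieBracketWithin_apply]
  refine (congrArg (fderiv ℝ (φ ∘ (extChartAt I x).symm) (extChartAt I x x))
    ((isInvertible_mfderiv_extChartAt (mem_extChartAt_source x)).self_apply_inverse _)).trans ?_
  rw [preimage_univ, univ_inter]
  exact congrArg (fderiv ℝ (φ ∘ (extChartAt I x).symm) (extChartAt I x x))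
    (lieBracketWithin_of_mem_nhds (by rw [I.range_eq_univ]; exact Filter.univ_mem))

theorem mvfderiv_congr {φ ψ : N → F} {x : N} (h : φ =ᶠ[𝓝 x] ψ) :
    mvfderiv I φ x = mvfderiv I ψ x := by
  ext v
  exact congrFun (congrArg DFunLike.coe h.mfderiv_eq) v

theorem mvfderiv_of_eventually_const {φ : N → F} {x : N} {c : F} (h : φ =ᶠ[𝓝 x] fun _ ↦ c) :
    mvfderiv I φ x = 0 := by
  rw [mvfderiv_congr h, mvfderiv_const]

variable {E' : Type*} [NormedAddCommGroup E'] [NormedSpace ℝ E']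
  {H' : Type*} [TopologicalSpace H'] {I' : ModelWithCorners ℝ E' H'}
  {N' : Type*} [TopologicalSpace N'] [ChartedSpace H' N']

theorem mvfderiv_comp_mfderiv {φ : N → F} {f : N' → N} {x : N'}
    (hφ : MDifferentiableAt I 𝓘(ℝ, F) φ (f x)) (hf : MDifferentiableAt I' I f x)
    (v : TangentSpace I' x) :
    mvfderiv I' (fun y ↦ φ (f y)) x v = mvfderiv I φ (f x) (mfderiv I' I f x v) :=
  mfderiv_comp_apply x hφ hf v

theorem mvfderiv_pi_apply {ι : Type*} [Fintype ι] {φ : N → ι → ℝ} {x : N}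
    (hφ : MDifferentiableAt I 𝓘(ℝ, ι → ℝ) φ x) (v : TangentSpace I x) (i : ι) :
    mvfderiv I φ x v i = mvfderiv I (fun y ↦ φ y i) x v := by
  have h := mvfderiv_comp_mfderiv (φ := fun w : ι → ℝ ↦ w i) (f := φ) (x := x) (I := 𝓘(ℝ, ι → ℝ))
    (ContinuousLinearMap.proj (R := ℝ) (φ := fun _ : ι ↦ ℝ) i).differentiableAt.mdifferentiableAt
    hφ v
  rw [h]
  exact (congrFun (congrArg DFunLike.coe
    (ContinuousLinearMap.proj (R := ℝ) (φ := fun _ : ι ↦ ℝ) i).hasFDerivAt.hasMFDerivAt.mfderiv)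
    _).symm

theorem mdifferentiableAt_pi_apply {ι : Type*} [Fintype ι] {φ : N → ι → ℝ} {x : N}
    (hφ : MDifferentiableAt I 𝓘(ℝ, ι → ℝ) φ x) (i : ι) :
    MDifferentiableAt I 𝓘(ℝ, ℝ) (fun y ↦ φ y i) x :=
  MDifferentiableAt.comp x (ContinuousLinearMap.proj (R := ℝ)
    (φ := fun _ : ι ↦ ℝ) i).differentiableAt.mdifferentiableAt hφ

theorem contMDiffAt_pi_apply {ι : Type*} [Fintype ι] {n : WithTop ℕ∞} {φ : N → ι → ℝ} {x : N}
    (hφ : ContMDiffAt I 𝓘(ℝ, ι → ℝ) n φ x) (i : ι) :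
    ContMDiffAt I 𝓘(ℝ, ℝ) n (fun y ↦ φ y i) x :=
  contMDiffAt_pi_space.1 hφ i

theorem mdifferentiableAt_finsetSum {ι : Type*} {s : Finset ι} {φ : ι → N → F} {x : N}
    (hφ : ∀ i ∈ s, MDifferentiableAt I 𝓘(ℝ, F) (φ i) x) :
    MDifferentiableAt I 𝓘(ℝ, F) (fun y ↦ ∑ i ∈ s, φ i y) x := by
  classical
  induction s using Finset.induction_on with
  | empty => simpa using mdifferentiableAt_const
  | insert a s ha ih =>
    simp only [Finset.sum_insert ha]
    exact MDifferentiableAt.add (hφ a (Finset.mem_insert_self a s))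
      (ih fun i hi ↦ hφ i (Finset.mem_insert_of_mem hi))

theorem mvfderiv_finsetSum {ι : Type*} {s : Finset ι} {φ : ι → N → F} {x : N}
    (hφ : ∀ i ∈ s, MDifferentiableAt I 𝓘(ℝ, F) (φ i) x) (v : TangentSpace I x) :
    mvfderiv I (fun y ↦ ∑ i ∈ s, φ i y) x v = ∑ i ∈ s, mvfderiv I (φ i) x v := by
  classical
  induction s using Finset.induction_on with
  | empty => simp [mvfderiv_const]
  | insert a s ha ih =>
    simp only [Finset.sum_insert ha]
    rw [mvfderiv_fun_add (hφ a (Finset.mem_insert_self a s))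
        (mdifferentiableAt_finsetSum fun i hi ↦ hφ i (Finset.mem_insert_of_mem hi)),
      add_apply, ih fun i hi ↦ hφ i (Finset.mem_insert_of_mem hi)]

end VectorFields

/-! ### Fibre coordinates, and horizontal and vertical lifts on the total space. -/

section Trivializations

open GeneralizedLieAlgebroid

variable {m r : ℕ} {M : Type*} [TopologicalSpace M]
  [ChartedSpace (EuclideanSpace ℝ (Fin m)) M] [IsManifold (𝓡 m) ∞ M]
  {E : M → Type*} [TopologicalSpace (TotalSpace (Fin r → ℝ) E)]
  [∀ x, AddCommGroup (E x)] [∀ x, Module ℝ (E x)] [∀ x, TopologicalSpace (E x)]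
  [FiberBundle (Fin r → ℝ) E] [VectorBundle ℝ (Fin r → ℝ) E]
  [ContMDiffVectorBundle ∞ (Fin r → ℝ) E (𝓡 m)]

variable (e : Trivialization (Fin r → ℝ) (π (Fin r → ℝ) E)) [MemTrivializationAtlas e]

section Linear

variable {e} {x : M} (hx : x ∈ e.baseSet)
include hx

theorem coord_eq (z : E x) : coord E e ⟨x, z⟩ = e.linearMapAt ℝ x z := by
  rw [e.coe_linearMapAt_of_mem hx]

theorem coord_add (z w : E x) : coord E e ⟨x, z + w⟩ = coord E e ⟨x, z⟩ + coord E e ⟨x, w⟩ := by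
  simp only [coord_eq hx, map_add]

theorem coord_smul (a : ℝ) (z : E x) : coord E e ⟨x, a • z⟩ = a • coord E e ⟨x, z⟩ := by
  simp only [coord_eq hx, map_smul]

theorem coord_zero : coord E e ⟨x, (0 : E x)⟩ = 0 := by
  simp only [coord_eq hx, map_zero]

theorem coord_sum {ι : Type*} (s : Finset ι) (z : ι → E x) :
    coord E e ⟨x, ∑ i ∈ s, z i⟩ = ∑ i ∈ s, coord E e ⟨x, z i⟩ := by
  simp only [coord_eq hx, map_sum]

theorem coord_symm (y : Fin r → ℝ) : coord E e ⟨x, e.symm x y⟩ = y := by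
  rw [coord_eq hx, e.linearMapAt_symm hx]

theorem symm_coord (z : E x) : e.symm x (coord E e ⟨x, z⟩) = z := by
  rw [coord_eq hx, e.symm_linearMapAt hx]

theorem coord_injective {z w : E x} (h : coord E e ⟨x, z⟩ = coord E e ⟨x, w⟩) : z = w := by
  rw [← symm_coord hx z, h, symm_coord hx]

theorem symm_sum_single (z : E x) :
    ∑ a, coord E e ⟨x, z⟩ a • e.symm x (Pi.single a 1) = z := by
  apply coord_injective hx
  rw [coord_sum hx]
  simp only [coord_smul hx, coord_symm hx]
  ext b
  simp [Pi.single_apply]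

end Linear

section Smooth

variable {e}

theorem contMDiffAt_coord {n : WithTop ℕ∞} [ENat.LEInfty n] {u : TotalSpace (Fin r → ℝ) E}
    (hu : u.proj ∈ e.baseSet) :
    ContMDiffAt (totalModel m r) 𝓘(ℝ, Fin r → ℝ) n (coord E e) u :=
  ((e.contMDiffAt_iff (IM := totalModel m r) (IB := 𝓡 m) (f := id) (e.mem_source.2 hu)).1
    contMDiffAt_id).2

theorem mdifferentiableAt_coord {u : TotalSpace (Fin r → ℝ) E} (hu : u.proj ∈ e.baseSet) :
    MDifferentiableAt (totalModel m r) 𝓘(ℝ, Fin r → ℝ) (coord E e) u :=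
  (contMDiffAt_coord (n := 1) hu).mdifferentiableAt (by simp)

theorem mdifferentiableAt_proj (u : TotalSpace (Fin r → ℝ) E) :
    MDifferentiableAt (totalModel m r) (𝓡 m)
      (fun v : TotalSpace (Fin r → ℝ) E ↦ v.proj) u :=
  Bundle.mdifferentiableAt_proj E

/-- The derivative of the projection to the base, as a linear map into the model space. -/
def projDeriv (u : TotalSpace (Fin r → ℝ) E) :
    TangentSpace (totalModel m r) u →L[ℝ] TangentSpace (𝓡 m) u.proj :=
  mfderiv (totalModel m r) (𝓡 m) (fun v : TotalSpace (Fin r → ℝ) E ↦ v.proj) u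

theorem mdifferentiable_trivialization (e : Trivialization (Fin r → ℝ) (π (Fin r → ℝ) E))
    [MemTrivializationAtlas e] :
    e.toOpenPartialHomeomorph.MDifferentiable (totalModel m r) (totalModel m r) :=
  ⟨(e.contMDiffOn (IB := 𝓡 m) (n := 1)).mdifferentiableOn (by simp),
    (e.contMDiffOn_symm (IB := 𝓡 m) (n := 1)).mdifferentiableOn (by simp)⟩

/-- A trivialization is the pair of the projection and the fibre coordinates. Since it is a local
diffeomorphism, this splitting lets equalities of tangent vectors be checked on those two parts. -/
theorem mfderiv_trivialization {u : TotalSpace (Fin r → ℝ) E} (hu : u.proj ∈ e.baseSet)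
    (v : TangentSpace (totalModel m r) u) :
    mfderiv (totalModel m r) (totalModel m r) e u v =
      ((projDeriv u v, mvfderiv (totalModel m r) (coord E e) u v) :
        EuclideanSpace ℝ (Fin m) × (Fin r → ℝ)) := by
  have heq : (e : TotalSpace (Fin r → ℝ) E → M × (Fin r → ℝ)) =ᶠ[𝓝 u]
      fun v ↦ (v.proj, coord E e v) := by
    filter_upwards [e.open_source.mem_nhds (e.mem_source.2 hu)] with v hv
    exact (e.mk_proj_snd hv).symm
  rw [heq.mfderiv_eq, mfderiv_prodMk (mdifferentiableAt_proj (m := m) u)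
    (mdifferentiableAt_coord (m := m) hu)]
  rfl

/-- A tangent vector of the total space is determined by its projection to the base and by the
derivative of the fibre coordinates. -/
theorem tangent_ext {u : TotalSpace (Fin r → ℝ) E} (hu : u.proj ∈ e.baseSet)
    {v w : TangentSpace (totalModel m r) u} (h₁ : projDeriv u v = projDeriv u w)
    (h₂ : mvfderiv (totalModel m r) (coord E e) u v = mvfderiv (totalModel m r) (coord E e) u w) :
    v = w := by
  apply (mdifferentiable_trivialization (m := m) e).mfderiv_injective (e.mem_source.2 hu)
  exact (mfderiv_trivialization hu v).trans
    ((Prod.ext h₁ h₂).trans (mfderiv_trivialization hu w).symm)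

theorem mvfderiv_comp_proj {F : Type*} [NormedAddCommGroup F] [NormedSpace ℝ F] {ψ : M → F}
    {u : TotalSpace (Fin r → ℝ) E} (hψ : MDifferentiableAt (𝓡 m) 𝓘(ℝ, F) ψ u.proj)
    (v : TangentSpace (totalModel m r) u) :
    mvfderiv (totalModel m r) (fun v : TotalSpace (Fin r → ℝ) E ↦ ψ v.proj) u v =
      mvfderiv (𝓡 m) ψ u.proj (projDeriv u v) :=
  mvfderiv_comp_mfderiv hψ (mdifferentiableAt_proj u) v

section HorizontalLift

variable (e) in
/-- The lift of a tangent vector of the base along which the fibre coordinates are constant. -/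
def hlift (u : TotalSpace (Fin r → ℝ) E) (w : TangentSpace (𝓡 m) u.proj) :
    TangentSpace (totalModel m r) u :=
  mfderiv (𝓡 m) (totalModel m r)
    (fun x ↦ (⟨x, e.symm x (coord E e u)⟩ : TotalSpace (Fin r → ℝ) E)) u.proj w

theorem contMDiffAt_mk {n : WithTop ℕ∞} [ENat.LEInfty n] {H : Type*} [TopologicalSpace H]
    {E' : Type*} [NormedAddCommGroup E'] [NormedSpace ℝ E'] {I : ModelWithCorners ℝ E' H}
    {N : Type*} [TopologicalSpace N] [ChartedSpace H N] {b : N → M} {z : ∀ y, E (b y)} {y₀ : N}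
    (hy₀ : b y₀ ∈ e.baseSet) (hb : ContMDiffAt I (𝓡 m) n b y₀)
    (hz : ContMDiffAt I 𝓘(ℝ, Fin r → ℝ) n (fun y ↦ coord E e ⟨b y, z y⟩) y₀) :
    ContMDiffAt I (totalModel m r) n
      (fun y ↦ (⟨b y, z y⟩ : TotalSpace (Fin r → ℝ) E)) y₀ :=
  (e.contMDiffAt_iff (IB := 𝓡 m) (f := fun y ↦ (⟨b y, z y⟩ : TotalSpace (Fin r → ℝ) E))
    (e.mem_source.2 hy₀)).2 ⟨hb, hz⟩

theorem contMDiffAt_symm_const {n : WithTop ℕ∞} [ENat.LEInfty n] {x : M} (hx : x ∈ e.baseSet)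
    (y : Fin r → ℝ) :
    ContMDiffAt (𝓡 m) (totalModel m r) n
      (fun x ↦ (⟨x, e.symm x y⟩ : TotalSpace (Fin r → ℝ) E)) x := by
  refine contMDiffAt_mk hx contMDiffAt_id
    ((contMDiffAt_const (c := y)).congr_of_eventuallyEq ?_)
  filter_upwards [e.open_baseSet.mem_nhds hx] with x' hx'
  exact coord_symm hx' y

variable {u : TotalSpace (Fin r → ℝ) E} (hu : u.proj ∈ e.baseSet)
include hu

theorem projDeriv_hlift (w : TangentSpace (𝓡 m) u.proj) : projDeriv u (hlift e u w) = w := by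
  have h := mfderiv_comp_apply_of_eq (x := u.proj) (y := u)
    (f := fun x ↦ (⟨x, e.symm x (coord E e u)⟩ : TotalSpace (Fin r → ℝ) E))
    (g := fun v : TotalSpace (Fin r → ℝ) E ↦ v.proj) (mdifferentiableAt_proj u)
    ((contMDiffAt_symm_const (n := 1) hu _).mdifferentiableAt (by simp))
    (by rw [symm_coord hu]) w
  refine h.symm.trans ?_
  exact congrFun (congrArg DFunLike.coe (mfderiv_id (I := 𝓡 m) (x := u.proj))) w

theorem mvfderiv_coord_hlift (w : TangentSpace (𝓡 m) u.proj) :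
    mvfderiv (totalModel m r) (coord E e) u (hlift e u w) = 0 := by
  have h := mfderiv_comp_apply_of_eq (x := u.proj) (y := u)
    (f := fun x ↦ (⟨x, e.symm x (coord E e u)⟩ : TotalSpace (Fin r → ℝ) E))
    (g := coord E e) (mdifferentiableAt_coord hu)
    ((contMDiffAt_symm_const (n := 1) hu _).mdifferentiableAt (by simp))
    (by rw [symm_coord hu]) w
  refine h.symm.trans ?_
  have hc : coord E e ∘ (fun x ↦ (⟨x, e.symm x (coord E e u)⟩ : TotalSpace (Fin r → ℝ) E))
      =ᶠ[𝓝 u.proj] fun _ ↦ coord E e u := by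
    filter_upwards [e.open_baseSet.mem_nhds hu] with x' hx'
    exact coord_symm hx' _
  exact congrFun (congrArg DFunLike.coe (mvfderiv_of_eventually_const (I := 𝓡 m) hc)) w

theorem contMDiffAt_add_smul {n : WithTop ℕ∞} [ENat.LEInfty n] (w : E u.proj) (t : ℝ) :
    ContMDiffAt 𝓘(ℝ, ℝ) (totalModel m r) n
      (fun t : ℝ ↦ (⟨u.proj, u.2 + t • w⟩ : TotalSpace (Fin r → ℝ) E)) t := by
  refine contMDiffAt_mk hu contMDiffAt_const ?_
  simp only [coord_add hu, coord_smul hu]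
  apply ContDiffAt.contMDiffAt
  fun_prop

theorem mdifferentiableAt_add_smul (w : E u.proj) (t : ℝ) :
    MDifferentiableAt 𝓘(ℝ, ℝ) (totalModel m r)
      (fun t : ℝ ↦ (⟨u.proj, u.2 + t • w⟩ : TotalSpace (Fin r → ℝ) E)) t :=
  (contMDiffAt_add_smul (n := 1) hu w t).mdifferentiableAt (by simp)

theorem projDeriv_vlift (w : E u.proj) : projDeriv (m := m) u (vlift u w) = 0 := by
  have h := mfderiv_comp_apply_of_eq (x := (0 : ℝ)) (y := u)
    (f := fun t : ℝ ↦ (⟨u.proj, u.2 + t • w⟩ : TotalSpace (Fin r → ℝ) E))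
    (g := fun v : TotalSpace (Fin r → ℝ) E ↦ v.proj) (mdifferentiableAt_proj (m := m) u)
    (mdifferentiableAt_add_smul hu w 0) (by simp) (1 : ℝ)
  refine h.symm.trans ?_
  exact congrFun (congrArg DFunLike.coe
    (mfderiv_const (I := 𝓘(ℝ, ℝ)) (I' := 𝓡 m) (x := (0 : ℝ)) (c := u.proj))) _

/-- The chain rule along the line `t ↦ u + t w`, whose velocity is the vertical lift: vertical
derivatives become one-variable derivatives inside a fibre. -/
theorem mvfderiv_vlift {F : Type*} [NormedAddCommGroup F] [NormedSpace ℝ F]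
    {φ : TotalSpace (Fin r → ℝ) E → F} (hφ : MDifferentiableAt (totalModel m r) 𝓘(ℝ, F) φ u)
    (w : E u.proj) :
    mvfderiv (totalModel m r) φ u (vlift u w) =
      fderiv ℝ (fun t : ℝ ↦ φ ⟨u.proj, u.2 + t • w⟩) 0 1 := by
  have h := mfderiv_comp_apply_of_eq (x := (0 : ℝ)) (y := u)
    (f := fun t : ℝ ↦ (⟨u.proj, u.2 + t • w⟩ : TotalSpace (Fin r → ℝ) E))
    (g := φ) hφ
    (mdifferentiableAt_add_smul hu w 0) (by simp) (1 : ℝ)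
  refine h.symm.trans ?_
  rw [mfderiv_eq_fderiv]
  rfl

theorem mvfderiv_coord_vlift (w : E u.proj) :
    mvfderiv (totalModel m r) (coord E e) u (vlift u w) = coord E e ⟨u.proj, w⟩ := by
  rw [mvfderiv_vlift hu (mdifferentiableAt_coord hu)]
  simp only [coord_add hu, coord_smul hu]
  have : HasDerivAt (fun t : ℝ ↦ coord E e ⟨u.proj, u.2⟩ + t • coord E e ⟨u.proj, w⟩)
      ((1 : ℝ) • coord E e ⟨u.proj, w⟩) 0 := ((hasDerivAt_id 0).smul_const _).const_add _
  simpa using this.deriv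

theorem mvfderiv_comp_proj_vlift {F : Type*} [NormedAddCommGroup F] [NormedSpace ℝ F] {ψ : M → F}
    (hψ : MDifferentiableAt (𝓡 m) 𝓘(ℝ, F) ψ u.proj) (w : E u.proj) :
    mvfderiv (totalModel m r) (fun v : TotalSpace (Fin r → ℝ) E ↦ ψ v.proj) u (vlift u w) = 0 := by
  rw [mvfderiv_comp_proj hψ, projDeriv_vlift hu, map_zero]

/-- A tangent vector decomposes into the lift of its projection and its vertical part. -/
theorem eq_hlift_add_vlift (v : TangentSpace (totalModel m r) u) :
    v = hlift e u (projDeriv u v) +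
      vlift u (e.symm u.proj (mvfderiv (totalModel m r) (coord E e) u v)) := by
  apply tangent_ext hu
  · rw [map_add, projDeriv_hlift hu, projDeriv_vlift hu, add_zero]
  · rw [map_add, mvfderiv_coord_hlift hu, mvfderiv_coord_vlift hu, coord_symm hu, zero_add]

theorem vlift_eq_iff {v : TangentSpace (totalModel m r) u} (w : E u.proj)
    (h₁ : projDeriv u v = 0)
    (h₂ : mvfderiv (totalModel m r) (coord E e) u v = coord E e ⟨u.proj, w⟩) : v = vlift u w :=
  tangent_ext hu (h₁.trans (projDeriv_vlift hu w).symm)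
    (h₂.trans (mvfderiv_coord_vlift hu w).symm)

theorem vlift_smul (a : ℝ) (w : E u.proj) : vlift (m := m) u (a • w) = a • vlift u w := by
  refine (vlift_eq_iff hu _ ?_ ?_).symm
  · simp [projDeriv_vlift hu]
  · simp [mvfderiv_coord_vlift hu, coord_smul hu]

theorem vlift_zero : vlift (m := m) u (0 : E u.proj) = 0 := by
  refine (vlift_eq_iff hu _ ?_ ?_).symm
  · simp
  · simp [coord_zero hu]

theorem vlift_sum {ι : Type*} (s : Finset ι) (w : ι → E u.proj) :
    vlift (m := m) u (∑ i ∈ s, w i) = ∑ i ∈ s, vlift u (w i) := by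
  refine (vlift_eq_iff hu _ ?_ ?_).symm
  · simp [projDeriv_vlift hu]
  · simp [mvfderiv_coord_vlift hu, coord_sum hu]

theorem vlift_injective {w w' : E u.proj} (h : vlift (m := m) u w = vlift u w') : w = w' := by
  apply coord_injective hu
  rw [← mvfderiv_coord_vlift (m := m) hu, h, mvfderiv_coord_vlift hu]

end HorizontalLift

end Smooth

end Trivializations

/-! ### Global functions and sections with prescribed germs. -/

section Bumps

open GeneralizedLieAlgebroid

variable {m r : ℕ} {M : Type*} [TopologicalSpace M]
  [ChartedSpace (EuclideanSpace ℝ (Fin m)) M] [IsManifold (𝓡 m) ∞ M]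
  {E : M → Type*} [TopologicalSpace (TotalSpace (Fin r → ℝ) E)]
  [∀ x, AddCommGroup (E x)] [∀ x, Module ℝ (E x)] [∀ x, TopologicalSpace (E x)]
  [FiberBundle (Fin r → ℝ) E] [VectorBundle ℝ (Fin r → ℝ) E]
  [ContMDiffVectorBundle ∞ (Fin r → ℝ) E (𝓡 m)]

variable [T2Space M] [SigmaCompactSpace M]

theorem exists_bump {p : M} {U : Set M} (hU : U ∈ 𝓝 p) :
    ∃ χ : C^∞⟮𝓡 m, M; 𝓘(ℝ, ℝ), ℝ⟯, (χ =ᶠ[𝓝 p] fun _ ↦ (1 : ℝ)) ∧ tsupport χ ⊆ U := by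
  have : LocallyCompactSpace M := ChartedSpace.locallyCompactSpace (EuclideanSpace ℝ (Fin m)) M
  obtain ⟨V, hVU, hV, hpV⟩ := mem_nhds_iff.1 hU
  obtain ⟨f, h0, h1, -⟩ := exists_contMDiffMap_zero_one_nhds_of_isClosed (n := ⊤) (𝓡 m)
    hV.isClosed_compl (isClosed_singleton (x := p)) (by simpa using hpV)
  rw [nhdsSet_singleton] at h1
  refine ⟨f, h1, fun y hy ↦ ?_⟩
  by_contra hyU
  have h : ∀ᶠ z in 𝓝 y, f z = 0 := (Filter.eventually_mem_set.2 (mem_nhdsSet_iff_exists.1 h0 |>.elim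
    fun W hW ↦ Filter.mem_of_superset (hW.1.mem_nhds (hW.2.1 (fun h' ↦ hyU (hVU h')))) hW.2.2))
  exact (notMem_tsupport_iff_eventuallyEq.2 h) hy

/-- The bracket and its Leibniz rule accept only global smooth objects; multiplying by a bump
function supplies global representatives of local germs. -/
theorem exists_function_eventuallyEq {p : M} {U : Set M} (hU : U ∈ 𝓝 p) {g : M → ℝ}
    (hg : ∀ x ∈ U, ContMDiffAt (𝓡 m) 𝓘(ℝ, ℝ) ∞ g x) :
    ∃ f : C^∞⟮𝓡 m, M; 𝓘(ℝ, ℝ), ℝ⟯, f =ᶠ[𝓝 p] g := by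
  obtain ⟨χ, h1, hs⟩ := exists_bump (m := m) hU
  refine ⟨⟨fun x ↦ χ x * g x, contMDiff_of_tsupport fun x hx ↦ ?_⟩, ?_⟩
  · exact χ.contMDiff.contMDiffAt.mul (hg x (hs (tsupport_mul_subset_left hx)))
  · filter_upwards [h1] with y hy
    simp [hy]

theorem exists_section_eventuallyEq {p : M} {U : Set M} (hU : IsOpen U) (hp : p ∈ U)
    {s : ∀ x, E x}
    (hs : ContMDiffOn (𝓡 m) (totalModel m r) ∞
      (fun x ↦ (⟨x, s x⟩ : TotalSpace (Fin r → ℝ) E)) U) :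
    ∃ t : Cₛ^∞⟮𝓡 m; Fin r → ℝ, E⟯, ∀ᶠ x in 𝓝 p, t x = s x := by
  obtain ⟨χ, h1, hχ⟩ := exists_bump (m := m) (hU.mem_nhds hp)
  refine ⟨⟨_, ContMDiffOn.smul_section_of_tsupport χ.contMDiff.contMDiffOn hU hχ hs⟩, ?_⟩
  filter_upwards [h1] with y hy
  change χ y • s y = s y
  rw [hy, one_smul]

/-- A local frame extends, near a point, to smooth global sections. -/
theorem exists_frame_extension (e : Trivialization (Fin r → ℝ) (π (Fin r → ℝ) E))
    [MemTrivializationAtlas e] {p : M} (hp : p ∈ e.baseSet) :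
    ∃ v : Fin r → Cₛ^∞⟮𝓡 m; Fin r → ℝ, E⟯,
      ∀ᶠ x in 𝓝 p, ∀ a, v a x = e.symm x (Pi.single a 1) := by
  have h := fun a : Fin r ↦ exists_section_eventuallyEq (m := m) e.open_baseSet hp
    (s := fun x ↦ e.symm x (Pi.single a 1))
    fun x hx ↦ (contMDiffAt_symm_const hx _).contMDiffWithinAt
  choose v hv using h
  exact ⟨v, Filter.eventually_all.2 hv⟩

/-- Some chart coordinate detects `ξ`, since the differential of the chart is injective; a cut-off
makes that coordinate global. -/
theorem exists_function_mvfderiv_ne_zero {p : M} {ξ : TangentSpace (𝓡 m) p} (hξ : ξ ≠ 0) :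
    ∃ f : C^∞⟮𝓡 m, M; 𝓘(ℝ, ℝ), ℝ⟯, mvfderiv (𝓡 m) f p ξ ≠ 0 := by
  have hinj := (isInvertible_mfderiv_extChartAt (I := 𝓡 m) (mem_extChartAt_source p)).injective
  have hne : mfderiv (𝓡 m) 𝓘(ℝ, EuclideanSpace ℝ (Fin m)) (extChartAt (𝓡 m) p) p ξ ≠ 0 :=
    fun h ↦ hξ (hinj (h.trans (map_zero _).symm))
  obtain ⟨i, hi⟩ : ∃ i, mvfderiv (𝓡 m) (extChartAt (𝓡 m) p) p ξ i ≠ 0 := by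
    by_contra! h
    exact hne (PiLp.ext (x := mvfderiv (𝓡 m) (extChartAt (𝓡 m) p) p ξ) (y := 0) h)
  have hsm : ∀ x ∈ (chartAt (EuclideanSpace ℝ (Fin m)) p).source,
      ContMDiffAt (𝓡 m) 𝓘(ℝ, EuclideanSpace ℝ (Fin m)) ∞ (extChartAt (𝓡 m) p) x :=
    fun x hx ↦ contMDiffAt_extChartAt' hx
  let L : EuclideanSpace ℝ (Fin m) →L[ℝ] ℝ := EuclideanSpace.proj i
  obtain ⟨f, hf⟩ := exists_function_eventuallyEq (m := m) (p := p)
    (chart_source_mem_nhds (EuclideanSpace ℝ (Fin m)) p) (g := fun x ↦ L (extChartAt (𝓡 m) p x))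
    fun x hx ↦ L.contDiff.contDiffAt.contMDiffAt.comp x (hsm x hx)
  refine ⟨f, ?_⟩
  rw [mvfderiv_congr hf, mvfderiv_comp_mfderiv (φ := L) L.differentiableAt.mdifferentiableAt
    ((hsm p (mem_chart_source _ p)).mdifferentiableAt (by simp))]
  refine fun h ↦ hi (Eq.trans ?_ h)
  exact (congrFun (congrArg DFunLike.coe L.hasFDerivAt.hasMFDerivAt.mfderiv) _).symm

end Bumps

/-! ### Consequences of the Leibniz rule: support of the anchor, locality, structure functions. -/

section Leibniz

open GeneralizedLieAlgebroid

variable {m r : ℕ} {M : Type*} [TopologicalSpace M]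
  [ChartedSpace (EuclideanSpace ℝ (Fin m)) M] [IsManifold (𝓡 m) ∞ M]
  {E : M → Type*} [TopologicalSpace (TotalSpace (Fin r → ℝ) E)]
  [∀ x, AddCommGroup (E x)] [∀ x, Module ℝ (E x)] [∀ x, TopologicalSpace (E x)]
  [FiberBundle (Fin r → ℝ) E] [VectorBundle ℝ (Fin r → ℝ) E]
  [ContMDiffVectorBundle ∞ (Fin r → ℝ) E (𝓡 m)]

variable (A : GeneralizedLieAlgebroid m r E)

namespace GeneralizedLieAlgebroid

theorem leibniz' (u v w : Cₛ^∞⟮𝓡 m; Fin r → ℝ, E⟯) (f : C^∞⟮𝓡 m, M; 𝓘(ℝ, ℝ), ℝ⟯)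
    (hw : ∀ p, w p = f p • v p) (q : M) :
    A.bracket u w (A.h (A.η q)) = f (A.h (A.η q)) • A.bracket u v (A.h (A.η q)) +
      mvfderiv (𝓡 m) f (A.h (A.η q)) (mfderiv (𝓡 m) (𝓡 m) A.h (A.η q) (A.ρ q (u q))) •
        v (A.h (A.η q)) :=
  A.leibniz u v w f hw q

theorem bracket_skew (u v : Cₛ^∞⟮𝓡 m; Fin r → ℝ, E⟯) : A.bracket u v = -A.bracket v u := by
  have h := A.bracket_self (u + v)
  simp only [map_add, LinearMap.add_apply, A.bracket_self, zero_add, add_zero] at h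
  exact eq_neg_of_add_eq_zero_right h

theorem mdifferentiableAt_h (x : M) : MDifferentiableAt (𝓡 m) (𝓡 m) A.h x :=
  A.h.contMDiff.mdifferentiable (by simp) x

theorem mfderiv_h_injective (x : M) : Function.Injective (mfderiv (𝓡 m) (𝓡 m) A.h x) :=
  (A.h.mfderivToContinuousLinearEquiv (by simp) x).injective

section

variable [T2Space M] [SigmaCompactSpace M]

/-- The anchor vanishes at the points that `h ∘ η` moves. -/
theorem rho_eq_zero {q : M} (hq : A.h (A.η q) ≠ q) : A.ρ q = 0 := by
  ext z
  set p := A.h (A.η q) with hp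
  by_contra hz
  have hz' : mfderiv (𝓡 m) (𝓡 m) A.h (A.η q) (A.ρ q z) ≠ 0 := fun h ↦
    hz (A.mfderiv_h_injective _ (h.trans (map_zero _).symm))
  obtain ⟨f, hf⟩ := exists_function_mvfderiv_ne_zero hz'
  -- A nonzero vector is needed in the fibre over `p`; in rank zero `z` is itself zero and there is
  -- nothing to prove.
  have hr : Nonempty (Fin r) := by
    by_contra hr
    rw [not_nonempty_iff] at hr
    have : z = 0 := coord_injective (FiberBundle.mem_baseSet_trivializationAt (Fin r → ℝ) E q)
      (Subsingleton.elim _ _)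
    exact hz (by rw [this, map_zero]; rfl)
  obtain ⟨u, hu⟩ := exists_section_eq (m := m) (r := r) q z
  have hpb := FiberBundle.mem_baseSet_trivializationAt (Fin r → ℝ) E p
  obtain ⟨v, hv⟩ := exists_section_eq (m := m) (r := r) p
    ((trivializationAt (Fin r → ℝ) E p).symm p 1)
  have hv0 : v p ≠ 0 := by
    intro h
    have h1 := coord_symm hpb (1 : Fin r → ℝ)
    rw [← hv, h, coord_zero hpb] at h1
    obtain ⟨i⟩ := hr
    exact zero_ne_one (congrFun h1 i)
  -- As `p ≠ q`, a cut-off can be 1 near `q` and 0 near `p`. Then `w = χ u` still has the value `z`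
  -- at `q`, but all its brackets vanish at `p`.
  obtain ⟨χ, h1, hχ⟩ := exists_bump (m := m) (isOpen_compl_singleton.mem_nhds (Ne.symm hq))
  have hχq : χ q = 1 := h1.self_of_nhds
  have hχp : χ =ᶠ[𝓝 p] fun _ ↦ (0 : ℝ) :=
    notMem_tsupport_iff_eventuallyEq.1 fun h ↦ hχ h rfl
  let w : Cₛ^∞⟮𝓡 m; Fin r → ℝ, E⟯ :=
    ⟨fun x ↦ χ x • u x, ContMDiff.smul_section χ.contMDiff u.contMDiff⟩
  let fv : Cₛ^∞⟮𝓡 m; Fin r → ℝ, E⟯ :=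
    ⟨fun x ↦ f x • v x, ContMDiff.smul_section f.contMDiff v.contMDiff⟩
  have key : ∀ X, A.bracket w X p = 0 := by
    intro X
    rw [bracket_skew]
    change -(A.bracket X w p) = 0
    rw [hp, A.leibniz' X u w χ (fun _ ↦ rfl) q, ← hp, mvfderiv_of_eventually_const hχp,
      hχp.self_of_nhds]
    simp
  -- Both brackets in this Leibniz rule vanish at `p`, so the derivative term, which is nonzero by
  -- the choice of `f` and `v`, would have to be zero.
  have h := A.leibniz' w v fv f (fun _ ↦ rfl) q
  rw [← hp, key, key] at h
  have hwq : w q = z := by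
    change χ q • u q = z
    rw [hχq, one_smul, hu]
  rw [hwq, smul_zero, zero_add] at h
  exact smul_ne_zero hf hv0 h.symm

/-- The two tangent vectors live in types over points that are only propositionally equal, so they
are compared in the tangent bundle. Generalizing the base point makes the cast in `anchor`
disappear. -/
theorem anchor_eq {x : M} (hx : A.η (A.h x) = x) (z : E (A.h x)) :
    (⟨x, A.anchor x z⟩ : TangentBundle (𝓡 m) M) = ⟨A.η (A.h x), A.ρ (A.h x) z⟩ := by
  have key : ∀ (y : M) (hy : y = x) (L : E (A.h x) →ₗ[ℝ] TangentSpace (𝓡 m) y),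
      (⟨x, (cast (congrArg (fun y ↦ (E (A.h x) →ₗ[ℝ] TangentSpace (𝓡 m) y)) hy) L :
        E (A.h x) →ₗ[ℝ] TangentSpace (𝓡 m) x) z⟩ : TangentBundle (𝓡 m) M) = ⟨y, L z⟩ := by
    rintro y rfl L
    rfl
  rw [anchor, dif_pos hx]
  exact key _ hx _

theorem anchor_of_ne {x : M} (hx : A.η (A.h x) ≠ x) : A.anchor x = 0 := by
  rw [anchor, dif_neg hx]

/-- If `h ∘ η` fixes `q`, this is the definition of the anchor up to transport; otherwise the left
side is zero by definition and the right side by `rho_eq_zero`. -/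
theorem anchor_section (q : M) (s : ∀ x, E x) :
    A.anchor (A.η q) (s (A.h (A.η q))) = A.ρ q (s q) := by
  by_cases hq : A.h (A.η q) = q
  · have h := A.anchor_eq (x := A.η q) (by rw [hq]) (s (A.h (A.η q)))
    have h2 : ∀ q', q' = q → (⟨A.η q', A.ρ q' (s q')⟩ : TangentBundle (𝓡 m) M) =
        ⟨A.η q, A.ρ q (s q)⟩ := by
      rintro _ rfl
      rfl
    rw [h2 _ hq] at h
    exact eq_of_heq (Bundle.TotalSpace.mk.inj h).2
  · rw [A.rho_eq_zero hq, A.anchor_of_ne fun h ↦ hq (A.η.injective h)]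
    rfl

/-- The Leibniz rule in terms of the anchor of the pull-back of `E` by `h`. -/
theorem bracket_smul (u v w : Cₛ^∞⟮𝓡 m; Fin r → ℝ, E⟯) (f : C^∞⟮𝓡 m, M; 𝓘(ℝ, ℝ), ℝ⟯)
    (hw : ∀ p, w p = f p • v p) (x : M) :
    A.bracket u w (A.h x) = f (A.h x) • A.bracket u v (A.h x) +
      mvfderiv (𝓡 m) (fun y ↦ f (A.h y)) x (A.anchor x (u (A.h x))) • v (A.h x) := by
  obtain ⟨q, rfl⟩ : ∃ q, A.η q = x := A.η.surjective x
  rw [A.leibniz' u v w f hw q, mvfderiv_comp_mfderiv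
    (f.contMDiff.mdifferentiable (by simp) _) (A.mdifferentiableAt_h _), anchor_section]

/-- Locality of the bracket: `w = (1 - χ) w` for a bump function `χ` supported where `w` vanishes,
and both Leibniz terms are zero because `1 - χ` vanishes near `h x`. -/
theorem bracket_of_eventually_eq_zero (u w : Cₛ^∞⟮𝓡 m; Fin r → ℝ, E⟯) {x : M}
    (hw : ∀ᶠ y in 𝓝 (A.h x), w y = 0) : A.bracket u w (A.h x) = 0 := by
  obtain ⟨χ, h1, hχ⟩ := exists_bump (m := m) hw
  let f : C^∞⟮𝓡 m, M; 𝓘(ℝ, ℝ), ℝ⟯ := ⟨fun y ↦ 1 - χ y, contMDiff_const.sub χ.contMDiff⟩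
  have hf : ∀ᶠ y in 𝓝 (A.h x), f y = 0 := by
    filter_upwards [h1] with y hy
    change 1 - χ y = 0
    rw [hy, sub_self]
  have hf' : (fun y ↦ f (A.h y)) =ᶠ[𝓝 x] fun _ ↦ (0 : ℝ) :=
    A.h.continuous.continuousAt.eventually hf
  rw [A.bracket_smul u w w f (fun y ↦ ?_) x, mvfderiv_of_eventually_const hf', hf.self_of_nhds]
  · simp
  · by_cases hy : y ∈ tsupport χ
    · rw [show w y = 0 from hχ hy, smul_zero]
    · change w y = (1 - χ y) • w y
      rw [image_eq_zero_of_notMem_tsupport hy, sub_zero, one_smul]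

theorem section_sum_apply {ι : Type*} (s : Finset ι) (g : ι → Cₛ^∞⟮𝓡 m; Fin r → ℝ, E⟯) (y : M) :
    (∑ a ∈ s, g a) y = ∑ a ∈ s, g a y :=
  (congrFun (map_sum (ContMDiffSection.coeAddHom (𝓡 m) (Fin r → ℝ) ∞ E) g s) y).trans
    (Finset.sum_apply _ _ _)

section StructureForm

variable {e : Trivialization (Fin r → ℝ) (π (Fin r → ℝ) E)} [MemTrivializationAtlas e]
  {x : M} (hx : A.h x ∈ e.baseSet)

include hx in
theorem mdifferentiableAt_coord_section (s : Cₛ^∞⟮𝓡 m; Fin r → ℝ, E⟯) :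
    MDifferentiableAt (𝓡 m) 𝓘(ℝ, Fin r → ℝ) (fun y ↦ coord E e ⟨A.h y, s (A.h y)⟩) x := by
  have h := (s.contMDiff.mdifferentiable (by simp) (A.h x)).comp x (A.mdifferentiableAt_h x)
  exact MDifferentiableAt.comp (g := coord E e)
    (f := fun y ↦ (⟨A.h y, s (A.h y)⟩ : TotalSpace (Fin r → ℝ) E)) x
    (mdifferentiableAt_coord (u := ⟨A.h x, s (A.h x)⟩) hx) h

include hx in
/-- The bracket with a section, expanded in a local frame. -/
theorem coord_bracket_eq {v : Fin r → Cₛ^∞⟮𝓡 m; Fin r → ℝ, E⟯}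
    (hv : ∀ᶠ y in 𝓝 (A.h x), ∀ a, v a y = e.symm y (Pi.single a 1))
    (t s : Cₛ^∞⟮𝓡 m; Fin r → ℝ, E⟯) :
    coord E e ⟨A.h x, A.bracket t s (A.h x)⟩ =
      mvfderiv (𝓡 m) (fun y ↦ coord E e ⟨A.h y, s (A.h y)⟩) x (A.anchor x (t (A.h x))) +
      ∑ a, coord E e ⟨A.h x, s (A.h x)⟩ a • coord E e ⟨A.h x, A.bracket t (v a) (A.h x)⟩ := by
  have hsm : ∀ a, ∀ y ∈ e.baseSet,
      ContMDiffAt (𝓡 m) 𝓘(ℝ, ℝ) ∞ (fun y ↦ coord E e ⟨y, s y⟩ a) y := fun a y hy ↦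
    contMDiffAt_pi_apply (ContMDiffAt.comp (g := coord E e)
      (f := fun y ↦ (⟨y, s y⟩ : TotalSpace (Fin r → ℝ) E)) y
      (contMDiffAt_coord (u := ⟨y, s y⟩) hy) (s.contMDiff y)) a
  choose f hf using fun a ↦ exists_function_eventuallyEq (m := m) (e.open_baseSet.mem_nhds hx)
    (hsm a)
  let fv : Fin r → Cₛ^∞⟮𝓡 m; Fin r → ℝ, E⟯ := fun a ↦
    ⟨fun x ↦ f a x • v a x, ContMDiff.smul_section (f a).contMDiff (v a).contMDiff⟩
  -- Near `h x` the section `s` equals its frame expansion with globalized coefficients; by locality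
  -- the bracket cannot tell the two apart.
  have hw : ∀ᶠ y in 𝓝 (A.h x), (s - ∑ a, fv a) y = 0 := by
    filter_upwards [hv, Filter.eventually_all.2 hf, e.open_baseSet.mem_nhds hx] with y h1 h2 h3
    change s y - (∑ a, fv a) y = 0
    rw [section_sum_apply, sub_eq_zero]
    change s y = ∑ a, f a y • v a y
    simp only [h1, h2]
    exact (symm_sum_single h3 (s y)).symm
  have hb := A.bracket_of_eventually_eq_zero t _ hw
  rw [map_sub, map_sum] at hb
  change A.bracket t s (A.h x) - (∑ a, A.bracket t (fv a)) (A.h x) = 0 at hb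
  rw [sub_eq_zero, section_sum_apply] at hb
  rw [hb, coord_sum hx]
  have hterm : ∀ a, coord E e ⟨A.h x, A.bracket t (fv a) (A.h x)⟩ =
      coord E e ⟨A.h x, s (A.h x)⟩ a • coord E e ⟨A.h x, A.bracket t (v a) (A.h x)⟩ +
      mvfderiv (𝓡 m) (fun y ↦ coord E e ⟨A.h y, s (A.h y)⟩) x (A.anchor x (t (A.h x))) a •
        Pi.single a 1 := by
    intro a
    rw [A.bracket_smul t (v a) (fv a) (f a) (fun _ ↦ rfl), coord_add hx, coord_smul hx,
      coord_smul hx, (hf a).self_of_nhds, hv.self_of_nhds a, coord_symm hx,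
      mvfderiv_pi_apply (A.mdifferentiableAt_coord_section hx s)]
    congr 3
    exact mvfderiv_congr (A.h.continuous.continuousAt.eventually (hf a))
  simp only [hterm, Finset.sum_add_distrib]
  rw [add_comm]
  congr 1
  ext b
  simp [Pi.single_apply]

include hx in
/-- The bracket of two sections, after removal of the terms in which the components of the sections
are differentiated, is bilinear in the values of the sections. -/
theorem coord_bracket_sub_add {v : Fin r → Cₛ^∞⟮𝓡 m; Fin r → ℝ, E⟯}
    (hv : ∀ᶠ y in 𝓝 (A.h x), ∀ a, v a y = e.symm y (Pi.single a 1))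
    (s t : Cₛ^∞⟮𝓡 m; Fin r → ℝ, E⟯) :
    coord E e ⟨A.h x, A.bracket s t (A.h x)⟩
      - mvfderiv (𝓡 m) (fun y ↦ coord E e ⟨A.h y, t (A.h y)⟩) x (A.anchor x (s (A.h x)))
      + mvfderiv (𝓡 m) (fun y ↦ coord E e ⟨A.h y, s (A.h y)⟩) x (A.anchor x (t (A.h x))) =
    ∑ b, coord E e ⟨A.h x, t (A.h x)⟩ b • ∑ a, coord E e ⟨A.h x, s (A.h x)⟩ a •
      coord E e ⟨A.h x, A.bracket (v a) (v b) (A.h x)⟩ := by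
  have hneg : ∀ a b : Cₛ^∞⟮𝓡 m; Fin r → ℝ, E⟯, coord E e ⟨A.h x, A.bracket a b (A.h x)⟩ =
      -coord E e ⟨A.h x, A.bracket b a (A.h x)⟩ := by
    intro a b
    rw [bracket_skew]
    change coord E e ⟨A.h x, -A.bracket b a (A.h x)⟩ = _
    rw [coord_eq hx, map_neg, coord_eq hx]
  have hterm : ∀ b, coord E e ⟨A.h x, A.bracket s (v b) (A.h x)⟩ =
      -mvfderiv (𝓡 m) (fun y ↦ coord E e ⟨A.h y, s (A.h y)⟩) x
        (A.anchor x (e.symm (A.h x) (Pi.single b 1))) +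
      ∑ a, coord E e ⟨A.h x, s (A.h x)⟩ a •
        coord E e ⟨A.h x, A.bracket (v a) (v b) (A.h x)⟩ := by
    intro b
    rw [hneg, A.coord_bracket_eq hx hv (v b) s, neg_add, hv.self_of_nhds b,
      ← Finset.sum_neg_distrib]
    congr 1
    refine Finset.sum_congr rfl fun a _ ↦ ?_
    rw [hneg (v b), smul_neg, neg_neg]
  rw [A.coord_bracket_eq hx hv s t]
  simp only [hterm, smul_add, smul_neg, Finset.sum_add_distrib, Finset.sum_neg_distrib]
  -- Expanding the anchor of `t` in the frame shows that the derivatives of the components of `s`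
  -- cancel.
  have : mvfderiv (𝓡 m) (fun y ↦ coord E e ⟨A.h y, s (A.h y)⟩) x (A.anchor x (t (A.h x))) =
      ∑ b, coord E e ⟨A.h x, t (A.h x)⟩ b •
        mvfderiv (𝓡 m) (fun y ↦ coord E e ⟨A.h y, s (A.h y)⟩) x
          (A.anchor x (e.symm (A.h x) (Pi.single b 1))) := by
    conv_lhs => rw [← symm_sum_single hx (t (A.h x))]
    simp only [map_sum, map_smul]
  rw [this]
  abel

include hx in
-- The right side sees only the values `z₁`, `z₂`, so the sections chosen in the definition are
-- irrelevant; its coefficients are the structure functions of the frame.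
theorem structureForm_eq {v : Fin r → Cₛ^∞⟮𝓡 m; Fin r → ℝ, E⟯}
    (hv : ∀ᶠ y in 𝓝 (A.h x), ∀ a, v a y = e.symm y (Pi.single a 1)) (z₁ z₂ : E (A.h x)) :
    A.structureForm e x z₁ z₂ =
      ∑ b, coord E e ⟨A.h x, z₂⟩ b • ∑ a, coord E e ⟨A.h x, z₁⟩ a •
        coord E e ⟨A.h x, A.bracket (v a) (v b) (A.h x)⟩ := by
  have h₁ := Classical.choose_spec (exists_section_eq (m := m) (r := r) (A.h x) z₁)
  have h₂ := Classical.choose_spec (exists_section_eq (m := m) (r := r) (A.h x) z₂)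
  have h := A.coord_bracket_sub_add hx hv
    (Classical.choose (exists_section_eq (m := m) (r := r) (A.h x) z₁))
    (Classical.choose (exists_section_eq (m := m) (r := r) (A.h x) z₂))
  rw [h₁, h₂] at h
  exact h

include hx in
theorem structureForm_section (s t : Cₛ^∞⟮𝓡 m; Fin r → ℝ, E⟯) :
    A.structureForm e x (s (A.h x)) (t (A.h x)) =
    coord E e ⟨A.h x, A.bracket s t (A.h x)⟩
      - mvfderiv (𝓡 m) (fun y ↦ coord E e ⟨A.h y, t (A.h y)⟩) x (A.anchor x (s (A.h x)))
      + mvfderiv (𝓡 m) (fun y ↦ coord E e ⟨A.h y, s (A.h y)⟩) x (A.anchor x (t (A.h x))) := by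
  obtain ⟨v, hv⟩ := exists_frame_extension (m := m) e hx
  rw [A.structureForm_eq hx hv, A.coord_bracket_sub_add hx hv]

include hx in
theorem structureForm_zero_left (z : E (A.h x)) : A.structureForm e x 0 z = 0 := by
  obtain ⟨v, hv⟩ := exists_frame_extension (m := m) e hx
  rw [A.structureForm_eq hx hv, coord_zero hx]
  simp

end StructureForm

end

end GeneralizedLieAlgebroid

end Leibniz

/-! ### Smoothness of lifted vector fields and of the anchor. -/

section Fields

open GeneralizedLieAlgebroid

variable {m r : ℕ} {M : Type*} [TopologicalSpace M]
  [ChartedSpace (EuclideanSpace ℝ (Fin m)) M] [IsManifold (𝓡 m) ∞ M]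
  {E : M → Type*} [TopologicalSpace (TotalSpace (Fin r → ℝ) E)]
  [∀ x, AddCommGroup (E x)] [∀ x, Module ℝ (E x)] [∀ x, TopologicalSpace (E x)]
  [FiberBundle (Fin r → ℝ) E] [VectorBundle ℝ (Fin r → ℝ) E]
  [ContMDiffVectorBundle ∞ (Fin r → ℝ) E (𝓡 m)]

section Regularity

variable {e : Trivialization (Fin r → ℝ) (π (Fin r → ℝ) E)} [MemTrivializationAtlas e]
  {u : TotalSpace (Fin r → ℝ) E} (hu : u.proj ∈ e.baseSet)

theorem contMDiffAt_tangentBundle_mk {n : WithTop ℕ∞} {F : Type*} [NormedAddCommGroup F]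
    [NormedSpace ℝ F] {H : Type*} [TopologicalSpace H]
    {E' : Type*} [NormedAddCommGroup E'] [NormedSpace ℝ E'] {I : ModelWithCorners ℝ E' H}
    {N : Type*} [TopologicalSpace N] [ChartedSpace H N] {a b : N → F} {x : N}
    (ha : ContMDiffAt I 𝓘(ℝ, F) n a x) (hb : ContMDiffAt I 𝓘(ℝ, F) n b x) :
    ContMDiffAt I 𝓘(ℝ, F).tangent n (fun y ↦ (⟨a y, b y⟩ : TangentBundle 𝓘(ℝ, F) F)) x := by
  refine (Bundle.contMDiffAt_totalSpace (IB := 𝓘(ℝ, F)) (F := F) (E := TangentSpace 𝓘(ℝ, F))).2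
    ⟨ha, ?_⟩
  simpa only [trivializationAt_model_space_apply] using hb

include hu in
/-- A vector field on the total space is smooth if its projection to the base and its fibre
components are smooth. -/
theorem contMDiffAt_field {X : ∀ v : TotalSpace (Fin r → ℝ) E, TangentSpace (totalModel m r) v}
    (h₁ : ContMDiffAt (totalModel m r) (𝓡 m).tangent ∞
      (fun v ↦ (⟨v.proj, projDeriv v (X v)⟩ : TangentBundle (𝓡 m) M)) u)
    (h₂ : ContMDiffAt (totalModel m r) 𝓘(ℝ, Fin r → ℝ) ∞
      (fun v ↦ mvfderiv (totalModel m r) (coord E e) v (X v)) u) :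
    ContMDiffAt (totalModel m r) (totalModel m r).tangent ∞
      (fun v ↦ (⟨v, X v⟩ : TangentBundle (totalModel m r) (TotalSpace (Fin r → ℝ) E))) u := by
  -- The field written in the product `M × ℝ^r`, where smoothness can be checked on the two factors.
  -- The tangent map of the inverse trivialization carries it back to `X`.
  let g : TotalSpace (Fin r → ℝ) E → TangentBundle (totalModel m r) (M × (Fin r → ℝ)) := fun v ↦
    (equivTangentBundleProd (𝓡 m) M 𝓘(ℝ, Fin r → ℝ) (Fin r → ℝ)).symm
      (⟨v.proj, projDeriv v (X v)⟩,
        ⟨coord E e v, mvfderiv (totalModel m r) (coord E e) v (X v)⟩)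
  have hg : ContMDiffAt (totalModel m r) (totalModel m r).tangent ∞ g u :=
    (contMDiff_equivTangentBundleProd_symm.contMDiffAt).comp u
      (h₁.prodMk (contMDiffAt_tangentBundle_mk (contMDiffAt_coord hu) h₂))
  have hs := (e.contMDiffOn_symm (IB := 𝓡 m) (n := ∞)).contMDiffOn_tangentMapWithin (m := ∞)
    (by simp) e.open_target.uniqueMDiffOn
  have hgu : (g u).proj = e u := e.mk_proj_snd (e.mem_source.2 hu)
  have hmem : (g u) ∈ (π _ (TangentSpace (totalModel m r)) ⁻¹' e.target :
      Set (TangentBundle (totalModel m r) (M × (Fin r → ℝ)))) := by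
    change (g u).proj ∈ e.target
    rw [hgu]
    exact e.map_source (e.mem_source.2 hu)
  have hs' := (hs _ hmem).contMDiffAt ((e.open_target.preimage
    (FiberBundle.continuous_proj _ _)).mem_nhds hmem)
  refine (hs'.comp u hg).congr_of_eventuallyEq ?_
  filter_upwards [e.open_source.mem_nhds (e.mem_source.2 hu)] with v hv
  have hgv : g v = ⟨e v, mfderiv (totalModel m r) (totalModel m r) e v (X v)⟩ := by
    have key : ∀ (p : M × (Fin r → ℝ)) (_ : p = e v)
        (w w' : EuclideanSpace ℝ (Fin m) × (Fin r → ℝ)),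
        w = w' → (⟨p, w⟩ : TangentBundle (totalModel m r) (M × (Fin r → ℝ))) = ⟨e v, w'⟩ := by
      rintro p rfl w w' rfl
      rfl
    exact key _ (e.mk_proj_snd hv) _ _ (mfderiv_trivialization (e.mem_source.1 hv) (X v)).symm
  have hd := (mdifferentiable_trivialization (m := m) e).symm_comp_deriv hv
  have key : ∀ (p : TotalSpace (Fin r → ℝ) E) (_ : p = v)
      (w w' : EuclideanSpace ℝ (Fin m) × (Fin r → ℝ)), w = w' →
      (⟨v, w'⟩ : TangentBundle (totalModel m r) (TotalSpace (Fin r → ℝ) E)) = ⟨p, w⟩ := by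
    rintro p rfl w w' rfl
    rfl
  change _ = tangentMapWithin _ _ _ _ (g v)
  rw [hgv]
  refine key _ (e.left_inv hv) _ _ ?_
  have hmf : mfderivWithin (totalModel m r) (totalModel m r) e.toOpenPartialHomeomorph.symm
      e.target (e v) = mfderiv (totalModel m r) (totalModel m r)
        e.toOpenPartialHomeomorph.symm (e v) :=
    mfderivWithin_of_mem_nhds (e.open_target.mem_nhds (e.map_source hv))
  exact (congrFun (congrArg DFunLike.coe hmf) _).trans
    (congrFun (congrArg DFunLike.coe hd) (X v))

include hu in
theorem contMDiffAt_vlift {w : ∀ v : TotalSpace (Fin r → ℝ) E, E v.proj}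
    (hw : ContMDiffAt (totalModel m r) 𝓘(ℝ, Fin r → ℝ) ∞
      (fun v ↦ coord E e ⟨v.proj, w v⟩) u) :
    ContMDiffAt (totalModel m r) (totalModel m r).tangent ∞
      (fun v ↦ (⟨v, vlift v (w v)⟩ :
        TangentBundle (totalModel m r) (TotalSpace (Fin r → ℝ) E))) u := by
  have hb : ∀ᶠ v : TotalSpace (Fin r → ℝ) E in 𝓝 u, v.proj ∈ e.baseSet :=
    (FiberBundle.continuous_proj (Fin r → ℝ) E).continuousAt.eventually
      (e.open_baseSet.mem_nhds hu)
  refine contMDiffAt_field hu ?_ (hw.congr_of_eventuallyEq ?_)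
  · have h := ((Bundle.contMDiff_zeroSection ℝ (TangentSpace (𝓡 m) : M → Type _)
      (F := EuclideanSpace ℝ (Fin m))
      (IB := 𝓡 m) (n := ∞)).contMDiffAt (x := u.proj)).comp u
      (Bundle.contMDiffAt_proj E (IB := 𝓡 m) (F := Fin r → ℝ) (n := ∞) (p := u))
    refine h.congr_of_eventuallyEq ?_
    filter_upwards [hb] with v hv
    rw [projDeriv_vlift hv]
    rfl
  · filter_upwards [hb] with v hv
    exact mvfderiv_coord_vlift hv _

include hu in
theorem contMDiffAt_hlift {w : ∀ x : M, TangentSpace (𝓡 m) x}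
    (hw : ContMDiffAt (𝓡 m) (𝓡 m).tangent ∞
      (fun x ↦ (⟨x, w x⟩ : TangentBundle (𝓡 m) M)) u.proj) :
    ContMDiffAt (totalModel m r) (totalModel m r).tangent ∞
      (fun v ↦ (⟨v, hlift e v (w v.proj)⟩ :
        TangentBundle (totalModel m r) (TotalSpace (Fin r → ℝ) E))) u := by
  have hb : ∀ᶠ v : TotalSpace (Fin r → ℝ) E in 𝓝 u, v.proj ∈ e.baseSet :=
    (FiberBundle.continuous_proj (Fin r → ℝ) E).continuousAt.eventually
      (e.open_baseSet.mem_nhds hu)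
  refine contMDiffAt_field hu ?_
    ((contMDiffAt_const (c := (0 : Fin r → ℝ))).congr_of_eventuallyEq ?_)
  · refine (hw.comp u (Bundle.contMDiffAt_proj E (IB := 𝓡 m) (F := Fin r → ℝ) (n := ∞)
      (p := u))).congr_of_eventuallyEq ?_
    filter_upwards [hb] with v hv
    rw [projDeriv_hlift hv]
    rfl
  · filter_upwards [hb] with v hv
    exact mvfderiv_coord_hlift hv _

end Regularity

section Anchor

variable (A : GeneralizedLieAlgebroid m r E) [T2Space M] [SigmaCompactSpace M]

/-- The case distinction in `anchor` causes no singularity. Near a fixed point of `η ∘ h`, the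
points `x` and `η (h x)` lie in one trivialization of the tangent bundle, and the coordinates of the
anchor equal those of `ρ`: both vanish where the points differ. The points that are not fixed form
an open set, on which the anchor is zero. -/
theorem GeneralizedLieAlgebroid.contMDiffAt_anchor {z : ∀ x : M, E (A.h x)} {x₀ : M}
    (hz : ContMDiffAt (𝓡 m) (totalModel m r) ∞
      (fun x ↦ (⟨A.h x, z x⟩ : TotalSpace (Fin r → ℝ) E)) x₀) :
    ContMDiffAt (𝓡 m) (𝓡 m).tangent ∞
      (fun x ↦ (⟨x, A.anchor x (z x)⟩ : TangentBundle (𝓡 m) M)) x₀ := by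
  have hρ : ContMDiffAt (𝓡 m) (𝓡 m).tangent ∞
      (fun x ↦ (⟨A.η (A.h x), A.ρ (A.h x) (z x)⟩ : TangentBundle (𝓡 m) M)) x₀ :=
    ContMDiffAt.comp x₀ (A.smooth_ρ _) hz
  have hcont : Continuous fun x ↦ A.η (A.h x) := A.η.continuous.comp A.h.continuous
  by_cases hx₀ : A.η (A.h x₀) = x₀
  · let τ := trivializationAt (EuclideanSpace ℝ (Fin m)) (TangentSpace (𝓡 m) : M → Type _) x₀
    have hmem : x₀ ∈ τ.baseSet := FiberBundle.mem_baseSet_trivializationAt _ _ x₀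
    have hmem' : A.η (A.h x₀) ∈ τ.baseSet := by
      rw [hx₀]
      exact hmem
    have hρ' := ((τ.contMDiffAt_iff (IB := 𝓡 m) (τ.mem_source.2 hmem')).1 hρ).2
    refine (τ.contMDiffAt_iff (IB := 𝓡 m) (τ.mem_source.2 hmem)).2
      ⟨contMDiffAt_id, hρ'.congr_of_eventuallyEq ?_⟩
    filter_upwards [τ.open_baseSet.mem_nhds hmem, hcont.continuousAt.preimage_mem_nhds
      (τ.open_baseSet.mem_nhds hmem')] with x h₁ h₂
    by_cases hx : A.η (A.h x) = x
    · rw [A.anchor_eq hx]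
    · have h0 : A.ρ (A.h x) = 0 := A.rho_eq_zero fun h ↦ hx (A.h.injective h)
      rw [A.anchor_of_ne hx, h0]
      change (τ (zeroSection _ _ x)).2 = (τ (zeroSection _ _ (A.η (A.h x)))).2
      rw [τ.zeroSection ℝ h₁, τ.zeroSection ℝ h₂]
  · have h : ∀ᶠ x in 𝓝 x₀, A.η (A.h x) ≠ x :=
      (isOpen_ne_fun hcont continuous_id).mem_nhds hx₀
    refine ((Bundle.contMDiff_zeroSection ℝ (TangentSpace (𝓡 m) : M → Type _)
      (F := EuclideanSpace ℝ (Fin m))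
      (IB := 𝓡 m) (n := ∞)).contMDiffAt (x := x₀)).congr_of_eventuallyEq ?_
    filter_upwards [h] with x hx
    rw [A.anchor_of_ne hx]
    rfl

end Anchor

end Fields

/-! ### Independence of the bracket of `(ρ, η)TE` from the trivialization. -/

section LieChart

open GeneralizedLieAlgebroid

variable {m r : ℕ} {M : Type*} [TopologicalSpace M]
  [ChartedSpace (EuclideanSpace ℝ (Fin m)) M] [IsManifold (𝓡 m) ∞ M]
  {E : M → Type*} [TopologicalSpace (TotalSpace (Fin r → ℝ) E)]
  [∀ x, AddCommGroup (E x)] [∀ x, Module ℝ (E x)] [∀ x, TopologicalSpace (E x)]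
  [FiberBundle (Fin r → ℝ) E] [VectorBundle ℝ (Fin r → ℝ) E]
  [ContMDiffVectorBundle ∞ (Fin r → ℝ) E (𝓡 m)]

variable (A : GeneralizedLieAlgebroid m r E)

theorem continuous_proj_bundle : Continuous fun v : TotalSpace (Fin r → ℝ) E ↦ v.proj :=
  FiberBundle.continuous_proj (Fin r → ℝ) E

namespace GeneralizedLieAlgebroid

theorem deriv_eq {V : Type*} [NormedAddCommGroup V] [NormedSpace ℝ V] (X : A.Field)
    (φ : TotalSpace (Fin r → ℝ) E → V) (u : TotalSpace (Fin r → ℝ) E) :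
    A.deriv X φ u = mvfderiv (totalModel m r) φ u (X u).2 :=
  rfl

theorem contMDiffAt_h_proj {n : WithTop ℕ∞} [ENat.LEInfty n] (u : TotalSpace (Fin r → ℝ) E) :
    ContMDiffAt (totalModel m r) (𝓡 m) n
      (fun v : TotalSpace (Fin r → ℝ) E ↦ A.h v.proj) u :=
  ((A.h.contMDiff.of_le ENat.LEInfty.out).contMDiffAt (x := u.proj)).comp u
    (Bundle.contMDiffAt_proj E)

theorem eventually_h_proj_mem {e : Trivialization (Fin r → ℝ) (π (Fin r → ℝ) E)}
    {u : TotalSpace (Fin r → ℝ) E} (hu : A.h u.proj ∈ e.baseSet) :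
    ∀ᶠ v : TotalSpace (Fin r → ℝ) E in 𝓝 u, A.h v.proj ∈ e.baseSet :=
  (A.contMDiffAt_h_proj (n := 1) u).continuousAt.eventually (e.open_baseSet.mem_nhds hu)

theorem contMDiffAt_coord_frame {e e' : Trivialization (Fin r → ℝ) (π (Fin r → ℝ) E)}
    [MemTrivializationAtlas e] [MemTrivializationAtlas e'] {u : TotalSpace (Fin r → ℝ) E}
    (hu : A.h u.proj ∈ e.baseSet) (hu' : A.h u.proj ∈ e'.baseSet) (y : Fin r → ℝ) :
    ContMDiffAt (totalModel m r) 𝓘(ℝ, Fin r → ℝ) ∞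
      (fun v : TotalSpace (Fin r → ℝ) E ↦ coord E e' ⟨A.h v.proj, e.symm (A.h v.proj) y⟩) u :=
  ContMDiffAt.comp (g := fun x ↦ coord E e' ⟨x, e.symm x y⟩)
    (f := fun v : TotalSpace (Fin r → ℝ) E ↦ A.h v.proj) u
    (ContMDiffAt.comp (g := coord E e')
      (f := fun x ↦ (⟨x, e.symm x y⟩ : TotalSpace (Fin r → ℝ) E)) (A.h u.proj)
      (contMDiffAt_coord (u := ⟨A.h u.proj, e.symm (A.h u.proj) y⟩) hu')
      (contMDiffAt_symm_const hu y)) (A.contMDiffAt_h_proj u)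

/-- The derivative of a section along `h ∘ π` that vanishes at a point does not depend on the
trivialization. -/
theorem mvfderiv_coord_of_eq_zero {e e' : Trivialization (Fin r → ℝ) (π (Fin r → ℝ) E)}
    [MemTrivializationAtlas e] [MemTrivializationAtlas e'] {u : TotalSpace (Fin r → ℝ) E}
    (hu : A.h u.proj ∈ e.baseSet) (hu' : A.h u.proj ∈ e'.baseSet)
    {z : ∀ v : TotalSpace (Fin r → ℝ) E, E (A.h v.proj)} (hz : z u = 0)
    (hd : MDifferentiableAt (totalModel m r) 𝓘(ℝ, Fin r → ℝ)
      (fun v ↦ coord E e ⟨A.h v.proj, z v⟩) u) (ξ : TangentSpace (totalModel m r) u) :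
    mvfderiv (totalModel m r) (fun v ↦ coord E e' ⟨A.h v.proj, z v⟩) u ξ =
      coord E e' ⟨A.h u.proj, e.symm (A.h u.proj)
        (mvfderiv (totalModel m r) (fun v ↦ coord E e ⟨A.h v.proj, z v⟩) u ξ)⟩ := by
  -- Change of frame. In the product rule the derivative of the transition coefficients is
  -- multiplied by the components of `z`, which vanish at `u`.
  have h : (fun v ↦ coord E e' ⟨A.h v.proj, z v⟩) =ᶠ[𝓝 u]
      fun v ↦ ∑ a, coord E e ⟨A.h v.proj, z v⟩ a •
        coord E e' ⟨A.h v.proj, e.symm (A.h v.proj) (Pi.single a 1)⟩ := by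
    filter_upwards [A.eventually_h_proj_mem hu, A.eventually_h_proj_mem hu'] with v h1 h2
    conv_lhs => rw [← symm_sum_single h1 (z v)]
    rw [coord_sum h2]
    simp only [coord_smul h2]
  have hda := fun a ↦ mdifferentiableAt_pi_apply hd a
  have hfr := fun a : Fin r ↦ (A.contMDiffAt_coord_frame hu hu' (Pi.single a 1)).mdifferentiableAt
    (by simp)
  rw [mvfderiv_congr h, mvfderiv_finsetSum
    (φ := fun a v ↦ coord E e ⟨A.h v.proj, z v⟩ a •
      coord E e' ⟨A.h v.proj, e.symm (A.h v.proj) (Pi.single a 1)⟩)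
    fun a _ ↦ (hda a).smul (hfr a)]
  generalize hw : mvfderiv (totalModel m r) (fun v ↦ coord E e ⟨A.h v.proj, z v⟩) u ξ = w
  have hws := symm_sum_single hu (e.symm (A.h u.proj) w)
  rw [← hws, coord_sum hu']
  refine Finset.sum_congr rfl fun a _ ↦ ?_
  rw [coord_smul hu', coord_symm hu]
  have := mvfderiv_smul (hda a) (hfr a)
  have h2 := congrFun (congrArg DFunLike.coe this) ξ
  refine h2.trans ?_
  rw [hz, ← hw, mvfderiv_pi_apply hd]
  simp [coord_zero hu]

section

variable [T2Space M] [SigmaCompactSpace M]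

theorem lie_fst (X Y : A.Field) (u : TotalSpace (Fin r → ℝ) E) :
    (A.lie X Y u).1 = (trivializationAt (Fin r → ℝ) E (A.h u.proj)).symm (A.h u.proj)
      (A.deriv X (fun v ↦ coord E (trivializationAt (Fin r → ℝ) E (A.h u.proj))
          ⟨A.h v.proj, (Y v).1⟩) u
        - A.deriv Y (fun v ↦ coord E (trivializationAt (Fin r → ℝ) E (A.h u.proj))
          ⟨A.h v.proj, (X v).1⟩) u
        + A.structureForm (trivializationAt (Fin r → ℝ) E (A.h u.proj)) u.proj
          (X u).1 (Y u).1) :=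
  rfl

theorem lie_snd (X Y : A.Field) (u : TotalSpace (Fin r → ℝ) E) :
    (A.lie X Y u).2 =
      VectorField.mlieBracket (totalModel m r) (fun v ↦ (X v).2) (fun v ↦ (Y v).2) u :=
  rfl

theorem memFiber_iff (X : A.Field) (u : TotalSpace (Fin r → ℝ) E) :
    A.MemFiber X u ↔ projDeriv u (X u).2 = A.anchor u.proj (X u).1 :=
  Iff.rfl

/-- The components of the bracket in an arbitrary trivialization, in terms of sections with the
prescribed values. -/
theorem deriv_sub_deriv_add_structureForm {e : Trivialization (Fin r → ℝ) (π (Fin r → ℝ) E)}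
    [MemTrivializationAtlas e] {u : TotalSpace (Fin r → ℝ) E} (hu : A.h u.proj ∈ e.baseSet)
    {X Y : A.Field} (hXu : A.MemFiber X u) (hYu : A.MemFiber Y u)
    (hX : MDifferentiableAt (totalModel m r) (totalModel m r)
      (fun v ↦ (⟨A.h v.proj, (X v).1⟩ : TotalSpace (Fin r → ℝ) E)) u)
    (hY : MDifferentiableAt (totalModel m r) (totalModel m r)
      (fun v ↦ (⟨A.h v.proj, (Y v).1⟩ : TotalSpace (Fin r → ℝ) E)) u)
    {s t : Cₛ^∞⟮𝓡 m; Fin r → ℝ, E⟯} (hs : s (A.h u.proj) = (X u).1)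
    (ht : t (A.h u.proj) = (Y u).1) :
    A.deriv X (fun v ↦ coord E e ⟨A.h v.proj, (Y v).1⟩) u
        - A.deriv Y (fun v ↦ coord E e ⟨A.h v.proj, (X v).1⟩) u
        + A.structureForm e u.proj (X u).1 (Y u).1 =
      coord E e ⟨A.h u.proj, A.bracket s t (A.h u.proj)⟩
        + A.deriv X (fun v ↦ coord E e ⟨A.h v.proj, (Y v).1 - t (A.h v.proj)⟩) u
        - A.deriv Y (fun v ↦ coord E e ⟨A.h v.proj, (X v).1 - s (A.h v.proj)⟩) u := by
  have hcd : ∀ {Z : A.Field}, MDifferentiableAt (totalModel m r) (totalModel m r)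
      (fun v ↦ (⟨A.h v.proj, (Z v).1⟩ : TotalSpace (Fin r → ℝ) E)) u →
      MDifferentiableAt (totalModel m r) 𝓘(ℝ, Fin r → ℝ)
        (fun v ↦ coord E e ⟨A.h v.proj, (Z v).1⟩) u := fun {Z} hZ ↦
    MDifferentiableAt.comp (g := coord E e)
      (f := fun v ↦ (⟨A.h v.proj, (Z v).1⟩ : TotalSpace (Fin r → ℝ) E)) u
      (mdifferentiableAt_coord (u := ⟨A.h u.proj, (Z u).1⟩) hu) hZ
  have hst : ∀ s : Cₛ^∞⟮𝓡 m; Fin r → ℝ, E⟯, MDifferentiableAt (totalModel m r) 𝓘(ℝ, Fin r → ℝ)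
        (fun v : TotalSpace (Fin r → ℝ) E ↦ coord E e ⟨A.h v.proj, s (A.h v.proj)⟩) u := fun s ↦
    MDifferentiableAt.comp (g := fun y ↦ coord E e ⟨A.h y, s (A.h y)⟩)
      (f := fun v : TotalSpace (Fin r → ℝ) E ↦ v.proj) u
      (A.mdifferentiableAt_coord_section hu s) (mdifferentiableAt_proj u)
  -- A section pulled back from the base is differentiated along `W` only through the anchor of the
  -- first component of `W`. This produces exactly the terms that `structureForm` removes.
  have hsub : ∀ {Z W : A.Field} (s : Cₛ^∞⟮𝓡 m; Fin r → ℝ, E⟯), A.MemFiber W u →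
      MDifferentiableAt (totalModel m r) (totalModel m r)
      (fun v ↦ (⟨A.h v.proj, (Z v).1⟩ : TotalSpace (Fin r → ℝ) E)) u →
      A.deriv W (fun v ↦ coord E e ⟨A.h v.proj, (Z v).1 - s (A.h v.proj)⟩) u =
        A.deriv W (fun v ↦ coord E e ⟨A.h v.proj, (Z v).1⟩) u -
        mvfderiv (𝓡 m) (fun y ↦ coord E e ⟨A.h y, s (A.h y)⟩) u.proj
          (A.anchor u.proj (W u).1) := by
    intro Z W s hW hZ
    have h : (fun v ↦ coord E e ⟨A.h v.proj, (Z v).1 - s (A.h v.proj)⟩) =ᶠ[𝓝 u]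
        (fun v ↦ coord E e ⟨A.h v.proj, (Z v).1⟩ - coord E e ⟨A.h v.proj, s (A.h v.proj)⟩) := by
      filter_upwards [A.eventually_h_proj_mem hu] with v hv
      simp only [coord_eq hv, map_sub]
    rw [deriv_eq, mvfderiv_congr h, mvfderiv_fun_sub (hcd hZ) (hst s), sub_apply, deriv_eq,
      ← (A.memFiber_iff W u).1 hW,
      mvfderiv_comp_proj (ψ := fun y ↦ coord E e ⟨A.h y, s (A.h y)⟩)
        (A.mdifferentiableAt_coord_section hu s)]
  rw [hsub t hXu hY, hsub s hYu hX, ← hs, ← ht, A.structureForm_section hu]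
  abel

/-- The first component of the Lie bracket in an arbitrary trivialization. -/
theorem coord_lie_fst {e : Trivialization (Fin r → ℝ) (π (Fin r → ℝ) E)}
    [MemTrivializationAtlas e] {u : TotalSpace (Fin r → ℝ) E} (hu : A.h u.proj ∈ e.baseSet)
    {X Y : A.Field} (hXu : A.MemFiber X u) (hYu : A.MemFiber Y u)
    (hX : MDifferentiableAt (totalModel m r) (totalModel m r)
      (fun v ↦ (⟨A.h v.proj, (X v).1⟩ : TotalSpace (Fin r → ℝ) E)) u)
    (hY : MDifferentiableAt (totalModel m r) (totalModel m r)
      (fun v ↦ (⟨A.h v.proj, (Y v).1⟩ : TotalSpace (Fin r → ℝ) E)) u) :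
    coord E e ⟨A.h u.proj, (A.lie X Y u).1⟩ =
      A.deriv X (fun v ↦ coord E e ⟨A.h v.proj, (Y v).1⟩) u
        - A.deriv Y (fun v ↦ coord E e ⟨A.h v.proj, (X v).1⟩) u
        + A.structureForm e u.proj (X u).1 (Y u).1 := by
  obtain ⟨s, hs⟩ := exists_section_eq (m := m) (r := r) (A.h u.proj) (X u).1
  obtain ⟨t, ht⟩ := exists_section_eq (m := m) (r := r) (A.h u.proj) (Y u).1
  have hu₀ := FiberBundle.mem_baseSet_trivializationAt (Fin r → ℝ) E (A.h u.proj)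
  have hd : ∀ {Z : A.Field} (s : Cₛ^∞⟮𝓡 m; Fin r → ℝ, E⟯),
      MDifferentiableAt (totalModel m r) (totalModel m r)
      (fun v ↦ (⟨A.h v.proj, (Z v).1⟩ : TotalSpace (Fin r → ℝ) E)) u →
      MDifferentiableAt (totalModel m r) 𝓘(ℝ, Fin r → ℝ)
        (fun v ↦ coord E (trivializationAt (Fin r → ℝ) E (A.h u.proj))
          ⟨A.h v.proj, (Z v).1 - s (A.h v.proj)⟩) u := by
    intro Z s hZ
    have h1 := MDifferentiableAt.comp (g := coord E (trivializationAt (Fin r → ℝ) E (A.h u.proj)))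
      (f := fun v ↦ (⟨A.h v.proj, (Z v).1⟩ : TotalSpace (Fin r → ℝ) E)) u
      (mdifferentiableAt_coord (u := ⟨A.h u.proj, (Z u).1⟩) hu₀) hZ
    have h2 := MDifferentiableAt.comp
      (g := fun y ↦ coord E (trivializationAt (Fin r → ℝ) E (A.h u.proj)) ⟨A.h y, s (A.h y)⟩)
      (f := fun v : TotalSpace (Fin r → ℝ) E ↦ v.proj) u
      (A.mdifferentiableAt_coord_section hu₀ s) (mdifferentiableAt_proj u)
    refine (h1.sub h2).congr_of_eventuallyEq ?_
    filter_upwards [A.eventually_h_proj_mem hu₀] with v hv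
    simp only [coord_eq hv, map_sub, Pi.sub_apply, Function.comp]
  -- After subtraction of `s` and `t` the differentiated sections vanish at `u`, so all three terms
  -- transform as vectors between the two trivializations.
  rw [A.deriv_sub_deriv_add_structureForm hu hXu hYu hX hY hs ht, lie_fst,
    A.deriv_sub_deriv_add_structureForm hu₀ hXu hYu hX hY hs ht]
  rw [deriv_eq, deriv_eq, deriv_eq, deriv_eq,
    A.mvfderiv_coord_of_eq_zero hu₀ hu (sub_eq_zero.2 ht.symm) (hd t hY),
    A.mvfderiv_coord_of_eq_zero hu₀ hu (sub_eq_zero.2 hs.symm) (hd s hX),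
    ← Bundle.Trivialization.symmₗ_apply (R := ℝ) _ hu₀, map_sub, map_add,
    Bundle.Trivialization.symmₗ_apply (R := ℝ) _ hu₀,
    Bundle.Trivialization.symmₗ_apply (R := ℝ) _ hu₀,
    Bundle.Trivialization.symmₗ_apply (R := ℝ) _ hu₀, symm_coord hu₀]
  simp only [coord_eq hu, map_sub, map_add]

end

end GeneralizedLieAlgebroid

end LieChart

attribute [instance] ChartPair.mem_e ChartPair.mem_e'

/-! ### Components in a chart pair and the inverse of `g`. -/

section ChartPairs

open GeneralizedLieAlgebroid

variable {m r : ℕ} {M : Type*} [TopologicalSpace M]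
  [ChartedSpace (EuclideanSpace ℝ (Fin m)) M] [IsManifold (𝓡 m) ∞ M]
  {E : M → Type*} [TopologicalSpace (TotalSpace (Fin r → ℝ) E)]
  [∀ x, AddCommGroup (E x)] [∀ x, Module ℝ (E x)] [∀ x, TopologicalSpace (E x)]
  [FiberBundle (Fin r → ℝ) E] [VectorBundle ℝ (Fin r → ℝ) E]
  [ContMDiffVectorBundle ∞ (Fin r → ℝ) E (𝓡 m)]

section Vertical

variable {e : Trivialization (Fin r → ℝ) (π (Fin r → ℝ) E)} [MemTrivializationAtlas e]
  {u : TotalSpace (Fin r → ℝ) E} (hu : u.proj ∈ e.baseSet)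
include hu

/-- The vertical derivative of a function that is linear on a fibre. -/
theorem mvfderiv_vlift_of_linear {F : Type*} [NormedAddCommGroup F] [NormedSpace ℝ F]
    {φ : TotalSpace (Fin r → ℝ) E → F} (hφ : MDifferentiableAt (totalModel m r) 𝓘(ℝ, F) φ u)
    (L : E u.proj →ₗ[ℝ] F) (hL : ∀ z, φ ⟨u.proj, z⟩ = L z) (w : E u.proj) :
    mvfderiv (totalModel m r) φ u (vlift u w) = L w := by
  rw [mvfderiv_vlift hu hφ]
  simp only [hL, map_add, map_smul]
  have : HasDerivAt (fun t : ℝ ↦ L u.2 + t • L w) ((1 : ℝ) • L w) 0 :=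
    ((hasDerivAt_id 0).smul_const _).const_add _
  simpa using this.deriv

end Vertical

namespace ChartPair

variable {A : GeneralizedLieAlgebroid m r E} (c : ChartPair r E)

theorem isOpen_domain : IsOpen (c.domain A) :=
  (c.e.open_baseSet.preimage continuous_proj_bundle).inter
    (c.e'.open_baseSet.preimage (A.h.continuous.comp continuous_proj_bundle))

variable {c} {u : TotalSpace (Fin r → ℝ) E} (hu : u ∈ c.domain A)
include hu

theorem eventually_mem_domain : ∀ᶠ v in 𝓝 u, v ∈ c.domain A :=
  c.isOpen_domain.mem_nhds hu

theorem hcomp_tilde (a b : Fin r) : c.hcomp (c.tilde A a) b u = (Pi.single a 1 : Fin r → ℝ) b := by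
  change coord E c.e' ⟨A.h u.proj, c.e'.symm (A.h u.proj) (Pi.single a 1)⟩ b = _
  rw [coord_symm hu.2]

theorem deriv_dotTilde_coord (a : Fin r) :
    A.deriv (c.dotTilde A a) (coord E c.e) u = Pi.single a 1 :=
  (mvfderiv_coord_vlift hu.1 _).trans (coord_symm hu.1 _)

theorem memFiber_tilde (a : Fin r) : A.MemFiber (c.tilde A a) u :=
  projDeriv_hlift hu.1 _

theorem vlift_eq_sum (w : E u.proj) :
    vlift (m := m) u w = ∑ a, coord E c.e ⟨u.proj, w⟩ a • (c.dotTilde A a u).2 := by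
  conv_lhs => rw [← symm_sum_single hu.1 w, vlift_sum hu.1]
  exact Finset.sum_congr rfl fun a _ ↦ vlift_smul hu.1 _ _

/-- The expansion of a vector of `(ρ, η)TE` in the base `(∂̃_a, ∂̇̃_a)`. -/
theorem eq_sum {X : A.Field} (hX : A.MemFiber X u) :
    X u = ∑ a, c.hcomp X a u • c.tilde A a u + ∑ a, c.vcomp X a u • c.dotTilde A a u := by
  refine Prod.ext ?_ ?_
  · rw [Prod.fst_add, Prod.fst_sum, Prod.fst_sum]
    have h0 : ∑ a, (c.vcomp X a u • c.dotTilde A a u).1 = 0 :=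
      Finset.sum_eq_zero fun a _ ↦ smul_zero _
    rw [h0, add_zero]
    exact (symm_sum_single hu.2 (X u).1).symm
  · rw [Prod.snd_add, Prod.snd_sum, Prod.snd_sum]
    refine (eq_hlift_add_vlift hu.1 (X u).2).trans ?_
    congr 1
    · have h1 : projDeriv u (X u).2 = A.anchor u.proj (X u).1 := hX
      rw [h1]
      conv_lhs => rw [← symm_sum_single hu.2 (X u).1]
      rw [map_sum]
      unfold hlift
      rw [map_sum]
      refine Finset.sum_congr rfl fun a _ ↦ ?_
      rw [map_smul, map_smul]
      rfl
    · rw [vlift_eq_sum hu, coord_symm hu.1]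
      rfl

theorem deriv_eq_sum {X : A.Field} (hX : A.MemFiber X u) {V : Type*} [NormedAddCommGroup V]
    [NormedSpace ℝ V] (φ : TotalSpace (Fin r → ℝ) E → V) :
    A.deriv X φ u = ∑ a, c.hcomp X a u • A.deriv (c.tilde A a) φ u +
      ∑ a, c.vcomp X a u • A.deriv (c.dotTilde A a) φ u := by
  have h := congrArg Prod.snd (eq_sum hu hX)
  rw [Prod.snd_add, Prod.snd_sum, Prod.snd_sum] at h
  rw [A.deriv_eq, h, map_add, map_sum, map_sum]
  congr 1 <;> exact Finset.sum_congr rfl fun a _ ↦ map_smul _ _ _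

/-- Two vectors of `(ρ, η)TE` with the same components coincide. -/
theorem eq_of_components {X Y : A.Field} (hX : A.MemFiber X u) (hY : A.MemFiber Y u)
    (hh : ∀ a, c.hcomp X a u = c.hcomp Y a u) (hv : ∀ a, c.vcomp X a u = c.vcomp Y a u) :
    X u = Y u := by
  rw [eq_sum hu hX, eq_sum hu hY]
  simp only [hh, hv]

theorem contMDiffAt_tilde_fst (a : Fin r) :
    ContMDiffAt (totalModel m r) (totalModel m r) ∞
      (fun v ↦ (⟨A.h v.proj, (c.tilde A a v).1⟩ : TotalSpace (Fin r → ℝ) E)) u :=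
  (contMDiffAt_symm_const hu.2 (Pi.single a 1)).comp u (A.contMDiffAt_h_proj u)

theorem contMDiffAt_tilde_snd [T2Space M] [SigmaCompactSpace M] (a : Fin r) :
    ContMDiffAt (totalModel m r) (totalModel m r).tangent ∞
      (fun v ↦ (⟨v, (c.tilde A a v).2⟩ :
        TangentBundle (totalModel m r) (TotalSpace (Fin r → ℝ) E))) u :=
  contMDiffAt_hlift hu.1 (A.contMDiffAt_anchor
    ((contMDiffAt_symm_const hu.2 (Pi.single a 1)).comp u.proj (A.h.contMDiff.contMDiffAt)))

theorem contMDiffAt_liouville_snd :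
    ContMDiffAt (totalModel m r) (totalModel m r).tangent ∞
      (fun v ↦ (⟨v, (A.liouville v).2⟩ :
        TangentBundle (totalModel m r) (TotalSpace (Fin r → ℝ) E))) u :=
  contMDiffAt_vlift hu.1 (contMDiffAt_coord hu.1)

theorem contMDiffAt_hcomp {n : WithTop ℕ∞} [ENat.LEInfty n] {X : A.Field}
    (hX : ContMDiffAt (totalModel m r) (totalModel m r) n
      (fun v ↦ (⟨A.h v.proj, (X v).1⟩ : TotalSpace (Fin r → ℝ) E)) u) :
    ContMDiffAt (totalModel m r) 𝓘(ℝ, Fin r → ℝ) n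
      (fun v ↦ coord E c.e' ⟨A.h v.proj, (X v).1⟩) u :=
  ContMDiffAt.comp (g := coord E c.e')
    (f := fun v ↦ (⟨A.h v.proj, (X v).1⟩ : TotalSpace (Fin r → ℝ) E)) u
    (contMDiffAt_coord (u := ⟨A.h u.proj, (X u).1⟩) hu.2) hX

theorem deriv_liouville_coord :
    A.deriv A.liouville (coord E c.e) u = coord E c.e u :=
  mvfderiv_coord_vlift hu.1 _

end ChartPair

namespace ChartPair

section Inverse

variable {A : GeneralizedLieAlgebroid m r E} {c : ChartPair r E} (G : A.InvertibleMorphism)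

/-- The components of `g⁻¹ s'_a`. -/
def gVec (c : ChartPair r E) (a : Fin r) (u : TotalSpace (Fin r → ℝ) E) : Fin r → ℝ :=
  coord E c.e ⟨u.proj, (G.g u.proj).symm (c.e'.symm (A.h u.proj) (Pi.single a 1))⟩

/-- The components of the morphism `g`. -/
def gEquiv {x : M} (hx : x ∈ c.e.baseSet) (hx' : A.h x ∈ c.e'.baseSet) :
    (Fin r → ℝ) ≃L[ℝ] (Fin r → ℝ) :=
  (((c.e.linearEquivAt ℝ x hx).symm.trans (G.g x)).trans
    (c.e'.linearEquivAt ℝ (A.h x) hx')).toContinuousLinearEquiv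

variable {u : TotalSpace (Fin r → ℝ) E} (hu : u ∈ c.domain A)
include hu

theorem coord_g_symm (z : E (A.h u.proj)) :
    coord E c.e ⟨u.proj, (G.g u.proj).symm z⟩ =
      ∑ a, coord E c.e' ⟨A.h u.proj, z⟩ a • c.gVec G a u := by
  conv_lhs => rw [← symm_sum_single hu.2 z, map_sum, coord_sum hu.1]
  refine Finset.sum_congr rfl fun a _ ↦ ?_
  rw [map_smul, coord_smul hu.1]
  rfl

theorem contMDiffAt_g :
    ContMDiffAt (totalModel m r) 𝓘(ℝ, Fin r → ℝ) ∞
      (fun v : TotalSpace (Fin r → ℝ) E ↦ coord E c.e' ⟨A.h v.proj, G.g v.proj v.2⟩) u :=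
  ContMDiffAt.comp (g := coord E c.e')
    (f := fun v : TotalSpace (Fin r → ℝ) E ↦
      (⟨A.h v.proj, G.g v.proj v.2⟩ : TotalSpace (Fin r → ℝ) E)) u
    (contMDiffAt_coord (u := ⟨A.h u.proj, G.g u.proj u.2⟩) hu.2) (G.smooth_g u)

/-- Smoothness is assumed for `g` alone. Its matrix is smooth, and inversion is smooth at an
invertible operator; applying the inverse to a basis vector gives the components sought. -/
theorem contMDiffAt_gVec_base (a : Fin r) :
    ContMDiffAt (𝓡 m) 𝓘(ℝ, Fin r → ℝ) ∞
      (fun x ↦ coord E c.e ⟨x, (G.g x).symm (c.e'.symm (A.h x) (Pi.single a 1))⟩) u.proj := by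
  let Γ : M → (Fin r → ℝ) →L[ℝ] (Fin r → ℝ) := fun x ↦
    ∑ a, (ContinuousLinearMap.proj (R := ℝ) (φ := fun _ : Fin r ↦ ℝ) a).smulRight
      (coord E c.e' ⟨A.h x, G.g x (c.e.symm x (Pi.single a 1))⟩)
  have hb : ∀ᶠ x in 𝓝 u.proj, x ∈ c.e.baseSet ∧ A.h x ∈ c.e'.baseSet :=
    Filter.Eventually.and (c.e.open_baseSet.mem_nhds hu.1)
      (A.h.continuous.continuousAt.preimage_mem_nhds (c.e'.open_baseSet.mem_nhds hu.2))
  have hΓeq : ∀ x (hx : x ∈ c.e.baseSet) (hx' : A.h x ∈ c.e'.baseSet),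
      Γ x = gEquiv G hx hx' := by
    intro x hx hx'
    ext1 y
    have h1 : gEquiv G hx hx' y = coord E c.e' ⟨A.h x, G.g x (c.e.symm x y)⟩ := rfl
    change Γ x y = gEquiv G hx hx' y
    rw [h1]
    conv_rhs => rw [← symm_sum_single hx (c.e.symm x y), map_sum, coord_sum hx', coord_symm hx]
    simp only [Γ, sum_apply, ContinuousLinearMap.smulRight_apply, map_smul,
      coord_smul hx', ContinuousLinearMap.proj_apply]
  have hΓ : ContMDiffAt (𝓡 m) 𝓘(ℝ, (Fin r → ℝ) →L[ℝ] (Fin r → ℝ)) ∞ Γ u.proj := by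
    refine ContMDiffAt.sum fun a _ ↦ ?_
    have h1 : ContMDiffAt (𝓡 m) 𝓘(ℝ, Fin r → ℝ) ∞
        (fun x ↦ coord E c.e' ⟨A.h x, G.g x (c.e.symm x (Pi.single a 1))⟩) u.proj :=
      ContMDiffAt.comp (g := fun v : TotalSpace (Fin r → ℝ) E ↦
          coord E c.e' ⟨A.h v.proj, G.g v.proj v.2⟩)
        (f := fun x ↦ (⟨x, c.e.symm x (Pi.single a 1)⟩ : TotalSpace (Fin r → ℝ) E)) u.proj
        (contMDiffAt_g G (u := ⟨u.proj, c.e.symm u.proj (Pi.single a 1)⟩) hu)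
        (contMDiffAt_symm_const hu.1 _)
    exact ((ContinuousLinearMap.smulRightL ℝ (Fin r → ℝ) (Fin r → ℝ)
      (ContinuousLinearMap.proj a)).contDiff.contMDiff.contMDiffAt).comp u.proj h1
  have hinv : ContMDiffAt (𝓡 m) 𝓘(ℝ, (Fin r → ℝ) →L[ℝ] (Fin r → ℝ)) ∞
      (fun x ↦ ContinuousLinearMap.inverse (Γ x)) u.proj := by
    have h2 := contDiffAt_map_inverse (n := ∞) (gEquiv G hu.1 hu.2)
    rw [← hΓeq] at h2
    exact h2.contMDiffAt.comp u.proj hΓ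
  have happ := ((ContinuousLinearMap.apply ℝ (Fin r → ℝ)
    (Pi.single a 1 : Fin r → ℝ)).contDiff (n := ∞)).contMDiff.contMDiffAt.comp u.proj hinv
  refine happ.congr_of_eventuallyEq ?_
  filter_upwards [hb] with x hx
  change _ = ContinuousLinearMap.inverse (Γ x) (Pi.single a 1)
  rw [hΓeq x hx.1 hx.2, ContinuousLinearMap.inverse_equiv]
  rfl

theorem contMDiffAt_gVec (a : Fin r) :
    ContMDiffAt (totalModel m r) 𝓘(ℝ, Fin r → ℝ) ∞ (c.gVec G a) u :=
  ContMDiffAt.comp (g := fun x ↦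
      coord E c.e ⟨x, (G.g x).symm (c.e'.symm (A.h x) (Pi.single a 1))⟩)
    (f := fun v : TotalSpace (Fin r → ℝ) E ↦ v.proj) u (contMDiffAt_gVec_base G hu a)
    (Bundle.contMDiffAt_proj E)

theorem contMDiffAt_J_tilde_snd (a : Fin r) :
    ContMDiffAt (totalModel m r) (totalModel m r).tangent ∞
      (fun v ↦ (⟨v, (J G (c.tilde A a) v).2⟩ :
        TangentBundle (totalModel m r) (TotalSpace (Fin r → ℝ) E))) u :=
  contMDiffAt_vlift hu.1 (contMDiffAt_gVec G hu a)

theorem deriv_gVec (X : A.Field) (a : Fin r) :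
    A.deriv X (c.gVec G a) u = mvfderiv (𝓡 m) (fun x ↦
      coord E c.e ⟨x, (G.g x).symm (c.e'.symm (A.h x) (Pi.single a 1))⟩) u.proj
        (projDeriv u (X u).2) :=
  mvfderiv_comp_proj ((contMDiffAt_gVec_base G hu a).mdifferentiableAt (by simp)) _

theorem deriv_J_tilde_coord (a : Fin r) :
    A.deriv (J G (c.tilde A a)) (coord E c.e) u = c.gVec G a u :=
  mvfderiv_coord_vlift hu.1 _

theorem deriv_J_tilde {V : Type*} [NormedAddCommGroup V] [NormedSpace ℝ V] (a : Fin r)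
    (φ : TotalSpace (Fin r → ℝ) E → V) :
    A.deriv (J G (c.tilde A a)) φ u =
      ∑ b, c.gInv G b a u • A.deriv (c.dotTilde A b) φ u := by
  have h : (J G (c.tilde A a) u).2 = ∑ b, c.gInv G b a u • (c.dotTilde A b u).2 :=
    vlift_eq_sum hu _
  rw [A.deriv_eq, h, map_sum]
  exact Finset.sum_congr rfl fun b _ ↦ map_smul _ _ _

end Inverse

end ChartPair

end ChartPairs

/-! ### Components of a spray and of its horizontal projector. -/

section Sprays

open GeneralizedLieAlgebroid

variable {m r : ℕ} {M : Type*} [TopologicalSpace M]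
  [ChartedSpace (EuclideanSpace ℝ (Fin m)) M] [IsManifold (𝓡 m) ∞ M]
  {E : M → Type*} [TopologicalSpace (TotalSpace (Fin r → ℝ) E)]
  [∀ x, AddCommGroup (E x)] [∀ x, Module ℝ (E x)] [∀ x, TopologicalSpace (E x)]
  [FiberBundle (Fin r → ℝ) E] [VectorBundle ℝ (Fin r → ℝ) E]
  [ContMDiffVectorBundle ∞ (Fin r → ℝ) E (𝓡 m)]

theorem GeneralizedLieAlgebroid.mdifferentiableAt_zero (A : GeneralizedLieAlgebroid m r E)
    (u : TotalSpace (Fin r → ℝ) E) : MDifferentiableAt (totalModel m r) (totalModel m r)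
      (fun v : TotalSpace (Fin r → ℝ) E ↦ (⟨A.h v.proj, 0⟩ : TotalSpace (Fin r → ℝ) E)) u :=
  (((Bundle.contMDiff_zeroSection ℝ E (IB := 𝓡 m) (F := Fin r → ℝ) (n := 1)).contMDiffAt
    (x := A.h u.proj)).comp u (A.contMDiffAt_h_proj u)).mdifferentiableAt (by simp)

variable [T2Space M] [SigmaCompactSpace M] {A : GeneralizedLieAlgebroid m r E}
  {G : A.InvertibleMorphism} {Ω : Set (TotalSpace (Fin r → ℝ) E)} {S S' : A.Field}

namespace GeneralizedLieAlgebroid.IsSpray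

variable (hS : IsSpray G Ω S) (hS' : IsSpray G Ω S')
include hS

/-- Vertical lifts are injective, so `J S = ℂ` says `g⁻¹ (S u).1 = u`. The first component is
therefore common to all sprays, linear on fibres, and smooth even outside `Ω`. -/
theorem fst_eq (u : TotalSpace (Fin r → ℝ) E) : (S u).1 = G.g u.proj u.2 := by
  have h := vlift_injective (m := m)
    (FiberBundle.mem_baseSet_trivializationAt (Fin r → ℝ) E u.proj)
    (congrArg Prod.snd (congrFun hS.semispray u))
  rw [← h, LinearEquiv.apply_symm_apply]

theorem contMDiffAt_fst (u : TotalSpace (Fin r → ℝ) E) :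
    ContMDiffAt (totalModel m r) (totalModel m r) ∞
      (fun v ↦ (⟨A.h v.proj, (S v).1⟩ : TotalSpace (Fin r → ℝ) E)) u := by
  simp only [hS.fst_eq]
  exact G.smooth_g u

theorem memFiber (u : TotalSpace (Fin r → ℝ) E) : A.MemFiber S u :=
  hS.section_one.mem u trivial

theorem contMDiffAt_snd_one (u : TotalSpace (Fin r → ℝ) E) :
    ContMDiffAt (totalModel m r) (totalModel m r).tangent 1
      (fun v ↦ (⟨v, (S v).2⟩ : TangentBundle (totalModel m r) (TotalSpace (Fin r → ℝ) E))) u :=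
  (hS.section_one.snd u trivial).contMDiffAt Filter.univ_mem

theorem contMDiffAt_snd (hΩ : IsOpen Ω) {u : TotalSpace (Fin r → ℝ) E} (hu : u ∈ Ω) :
    ContMDiffAt (totalModel m r) (totalModel m r).tangent ∞
      (fun v ↦ (⟨v, (S v).2⟩ : TangentBundle (totalModel m r) (TotalSpace (Fin r → ℝ) E))) u :=
  (hS.section_smooth.snd u hu).contMDiffAt (hΩ.mem_nhds hu)

section Chart

variable {c : ChartPair r E} {u : TotalSpace (Fin r → ℝ) E} (hu : u ∈ c.domain A)
include hu

theorem deriv_vertical_hcomp {X : A.Field} {w : E u.proj} (hX : (X u).2 = vlift u w) :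
    A.deriv X (fun v ↦ coord E c.e' ⟨A.h v.proj, (S v).1⟩) u =
      coord E c.e' ⟨A.h u.proj, G.g u.proj w⟩ := by
  rw [A.deriv_eq, hX, mvfderiv_vlift_of_linear hu.1
    ((ChartPair.contMDiffAt_hcomp hu (hS.contMDiffAt_fst u)).mdifferentiableAt (by simp))
    ((c.e'.linearMapAt ℝ (A.h u.proj)).comp (G.g u.proj).toLinearMap)]
  · exact (coord_eq hu.2 _).symm
  · intro z
    rw [hS.fst_eq, coord_eq hu.2]
    rfl

theorem deriv_liouville_hcomp :
    A.deriv A.liouville (fun v ↦ coord E c.e' ⟨A.h v.proj, (S v).1⟩) u =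
      coord E c.e' ⟨A.h u.proj, (S u).1⟩ := by
  rw [hS.deriv_vertical_hcomp hu (X := A.liouville) rfl, hS.fst_eq]

theorem deriv_J_tilde_hcomp (a : Fin r) :
    A.deriv (J G (c.tilde A a)) (fun v ↦ coord E c.e' ⟨A.h v.proj, (S v).1⟩) u =
      Pi.single a 1 := by
  rw [hS.deriv_vertical_hcomp hu (X := J G (c.tilde A a)) rfl, LinearEquiv.apply_symm_apply]
  exact coord_symm hu.2 _

theorem contMDiffAt_deriv_coord_one :
    ContMDiffAt (totalModel m r) 𝓘(ℝ, Fin r → ℝ) 1 (fun v ↦ A.deriv S (coord E c.e) v) u :=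
  contMDiffAt_mvfderiv (k := ∞) (hS.contMDiffAt_snd_one u) (contMDiffAt_coord hu.1)
    (by rw [one_add_one_eq_two]; exact ENat.LEInfty.out)

theorem contMDiffAt_deriv_coord (hΩ : IsOpen Ω) (huΩ : u ∈ Ω) :
    ContMDiffAt (totalModel m r) 𝓘(ℝ, Fin r → ℝ) ∞ (fun v ↦ A.deriv S (coord E c.e) v) u :=
  contMDiffAt_mvfderiv (k := ∞) (hS.contMDiffAt_snd hΩ huΩ) (contMDiffAt_coord hu.1) (by simp)

/-- The vertical components of a spray are homogeneous of degree two. -/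
theorem deriv_liouville_deriv_coord :
    A.deriv A.liouville (fun v ↦ A.deriv S (coord E c.e) v) u =
      (2 : ℝ) • A.deriv S (coord E c.e) u := by
  have h1 := congrArg (fun X : A.Field ↦ mvfderiv (totalModel m r) (coord E c.e) u (X u).2)
    (sub_eq_zero.1 hS.derivation)
  have h2 := mvfderiv_mlieBracket (V := fun v ↦ (A.liouville v).2) (W := fun v ↦ (S v).2)
    ((ChartPair.contMDiffAt_liouville_snd hu).of_le ENat.LEInfty.out) (hS.contMDiffAt_snd_one u)
    (contMDiffAt_coord (n := 2) hu.1)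
  -- Since `ℂ y = y`, the equation `[ℂ, S] y = S y` reads `ℂ (S y) - S y = S y`.
  have h3 : (fun v ↦ mvfderiv (totalModel m r) (coord E c.e) v (A.liouville v).2) =ᶠ[𝓝 u]
      coord E c.e := by
    filter_upwards [ChartPair.eventually_mem_domain hu] with v hv
    exact ChartPair.deriv_liouville_coord hv
  rw [mvfderiv_congr h3] at h2
  have h4 := h2.symm.trans h1
  rw [two_smul]
  exact sub_eq_iff_eq_add.1 h4

theorem coord_lie_J_tilde_fst (a : Fin r) :
    coord E c.e' ⟨A.h u.proj, (A.lie (J G (c.tilde A a)) S u).1⟩ = Pi.single a 1 := by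
  have h0 : A.MemFiber (J G (c.tilde A a)) u :=
    (projDeriv_vlift hu.1 _).trans (map_zero (A.anchor u.proj)).symm
  rw [A.coord_lie_fst hu.2 h0 (hS.memFiber u) (A.mdifferentiableAt_zero u)
    ((hS.contMDiffAt_fst u).mdifferentiableAt (by simp)), hS.deriv_J_tilde_hcomp hu]
  have h1 : A.structureForm c.e' u.proj (J G (c.tilde A a) u).1 (S u).1 = 0 :=
    A.structureForm_zero_left hu.2 _
  have h2 : (fun v : TotalSpace (Fin r → ℝ) E ↦
      coord E c.e' ⟨A.h v.proj, (J G (c.tilde A a) v).1⟩) =ᶠ[𝓝 u] fun _ ↦ 0 := by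
    filter_upwards [ChartPair.eventually_mem_domain hu] with v hv
    exact coord_zero hv.2
  rw [h1, A.deriv_eq S, mvfderiv_of_eventually_const h2]
  simp

theorem lie_J_tilde_fst (a : Fin r) :
    (A.lie (J G (c.tilde A a)) S u).1 = (c.tilde A a u).1 :=
  coord_injective hu.2 ((hS.coord_lie_J_tilde_fst hu a).trans (coord_symm hu.2 _).symm)

/-- Test against functions `ψ ∘ π`: they are killed by the vertical field `J ∂̃_a`, and their
derivative along `S` is linear on fibres, namely `dψ ∘ anchor ∘ g`. Differentiating this in the
direction `g⁻¹ s'_a` cancels `g`. -/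
theorem projDeriv_lie_J_tilde (a : Fin r) :
    projDeriv u (A.lie (J G (c.tilde A a)) S u).2 = A.anchor u.proj (c.tilde A a u).1 := by
  set p := u.proj with hp
  let ψ : M → EuclideanSpace ℝ (Fin m) := extChartAt (𝓡 m) p
  have hψ : ∀ x ∈ (chartAt (EuclideanSpace ℝ (Fin m)) p).source,
      ContMDiffAt (𝓡 m) 𝓘(ℝ, EuclideanSpace ℝ (Fin m)) ∞ ψ x := fun x hx ↦
    contMDiffAt_extChartAt' hx
  have hψp := hψ p (mem_chart_source _ p)
  have hφ : ContMDiffAt (totalModel m r) 𝓘(ℝ, EuclideanSpace ℝ (Fin m)) ∞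
      (fun v : TotalSpace (Fin r → ℝ) E ↦ ψ v.proj) u :=
    ContMDiffAt.comp (g := ψ) (f := fun v : TotalSpace (Fin r → ℝ) E ↦ v.proj) u hψp
      (Bundle.contMDiffAt_proj E)
  have hinj : Function.Injective (mvfderiv (𝓡 m) ψ p) :=
    (isInvertible_mfderiv_extChartAt (I := 𝓡 m) (mem_extChartAt_source p)).injective
  apply hinj
  rw [← mvfderiv_comp_proj (hψp.mdifferentiableAt (by simp)), A.lie_snd,
    mvfderiv_mlieBracket ((ChartPair.contMDiffAt_J_tilde_snd G hu a).of_le ENat.LEInfty.out)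
      (hS.contMDiffAt_snd_one u) (hφ.of_le ENat.LEInfty.out)]
  have h0 : (fun v ↦ mvfderiv (totalModel m r)
      (fun v : TotalSpace (Fin r → ℝ) E ↦ ψ v.proj) v (J G (c.tilde A a) v).2) =ᶠ[𝓝 u]
      fun _ ↦ 0 := by
    filter_upwards [ChartPair.eventually_mem_domain hu,
      continuous_proj_bundle.continuousAt.preimage_mem_nhds
        ((chartAt (EuclideanSpace ℝ (Fin m)) p).open_source.mem_nhds (mem_chart_source _ p))]
      with v hv hv'
    exact mvfderiv_comp_proj_vlift hv.1 ((hψ _ hv').mdifferentiableAt (by simp)) _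
  rw [mvfderiv_of_eventually_const h0, zero_apply, sub_zero]
  have hd : MDifferentiableAt (totalModel m r) 𝓘(ℝ, EuclideanSpace ℝ (Fin m))
      (fun v ↦ mvfderiv (totalModel m r)
        (fun v : TotalSpace (Fin r → ℝ) E ↦ ψ v.proj) v (S v).2) u :=
    (contMDiffAt_mvfderiv (hS.contMDiffAt_snd_one u) hφ
      (by rw [one_add_one_eq_two]; exact ENat.LEInfty.out)).mdifferentiableAt
      (by simp)
  refine (mvfderiv_vlift_of_linear hu.1 hd
    (((mvfderiv (𝓡 m) ψ p).toLinearMap.comp (A.anchor p)).comp (G.g p).toLinearMap)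
    (fun z ↦ ?_) _).trans ?_
  · rw [mvfderiv_comp_proj (u := ⟨u.proj, z⟩) (hψp.mdifferentiableAt (by simp))]
    have h1 := hS.memFiber ⟨u.proj, z⟩
    rw [memFiber_iff, hS.fst_eq] at h1
    exact congrArg (mvfderiv (𝓡 m) ψ p) h1
  · change mvfderiv (𝓡 m) ψ p (A.anchor p (G.g p ((G.g p).symm _))) = _
    rw [LinearEquiv.apply_symm_apply]

theorem delta_fst (a : Fin r) : (c.delta G S a u).1 = (c.tilde A a u).1 := by
  change (1 / 2 : ℝ) • ((c.tilde A a u).1 + (A.lie (J G (c.tilde A a)) S u).1 - 0) = _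
  rw [hS.lie_J_tilde_fst hu, sub_zero, ← two_smul ℝ, smul_smul]
  norm_num

/-- Of the three terms of the projector, `∂̃_a` and `[J ∂̃_a, S]` have the required projection and
the third is vertical; the factor ½ averages the first two. -/
theorem memFiber_delta (a : Fin r) : A.MemFiber (c.delta G S a) u := by
  rw [memFiber_iff, hS.delta_fst hu]
  change projDeriv u ((1 / 2 : ℝ) • ((c.tilde A a u).2 + (A.lie (J G (c.tilde A a)) S u).2 -
    vlift u _)) = _
  rw [map_smul, map_sub, map_add, projDeriv_vlift hu.1, hS.projDeriv_lie_J_tilde hu,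
    (A.memFiber_iff _ _).1 (ChartPair.memFiber_tilde hu a), sub_zero, ← two_smul ℝ, smul_smul]
  norm_num

theorem hcomp_delta (a b : Fin r) : c.hcomp (c.delta G S a) b u = c.hcomp (c.tilde A a) b u := by
  unfold ChartPair.hcomp
  rw [hS.delta_fst hu]

theorem delta_eq (a : Fin r) :
    c.delta G S a u = c.tilde A a u + ∑ b, c.H G S b a u • c.dotTilde A b u := by
  rw [ChartPair.eq_sum hu (hS.memFiber_delta hu a)]
  congr 1
  simp only [hS.hcomp_delta hu, ChartPair.hcomp_tilde hu, Pi.single_apply, ite_smul, one_smul,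
    zero_smul, Finset.sum_ite_eq', Finset.mem_univ, if_true]

theorem coord_lie_tilde_fst (a : Fin r) :
    coord E c.e' ⟨A.h u.proj, (A.lie (c.tilde A a) S u).1⟩ =
      A.deriv (c.tilde A a) (fun v ↦ coord E c.e' ⟨A.h v.proj, (S v).1⟩) u +
        A.structureForm c.e' u.proj (c.tilde A a u).1 (S u).1 := by
  have h2 : (fun v : TotalSpace (Fin r → ℝ) E ↦
      coord E c.e' ⟨A.h v.proj, (c.tilde A a v).1⟩) =ᶠ[𝓝 u] fun _ ↦ Pi.single a 1 := by
    filter_upwards [ChartPair.eventually_mem_domain hu] with v hv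
    exact coord_symm hv.2 _
  rw [A.coord_lie_fst hu.2 (ChartPair.memFiber_tilde hu a) (hS.memFiber u)
    ((ChartPair.contMDiffAt_tilde_fst hu a).mdifferentiableAt (by simp))
    ((hS.contMDiffAt_fst u).mdifferentiableAt (by simp)),
    A.deriv_eq S, mvfderiv_of_eventually_const h2]
  simp

/-- The components of the horizontal projector. -/
theorem H_eq (b a : Fin r) :
    c.H G S b a u = 1 / 2 * (A.deriv (J G (c.tilde A a)) (fun v ↦ A.deriv S (coord E c.e) v) u b
      - A.deriv S (c.gVec G a) u b
      - ∑ k, coord E c.e' ⟨A.h u.proj, (A.lie (c.tilde A a) S u).1⟩ k * c.gVec G k u b) := by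
  -- The bracket `[J ∂̃_a, S]` is applied to the fibre coordinates as a commutator; `J ∂̃_a` sends
  -- them to the components of `g⁻¹ s'_a`.
  have h1 : (fun v ↦ mvfderiv (totalModel m r) (coord E c.e) v (J G (c.tilde A a) v).2) =ᶠ[𝓝 u]
      c.gVec G a := by
    filter_upwards [ChartPair.eventually_mem_domain hu] with v hv
    exact ChartPair.deriv_J_tilde_coord G hv a
  have h2 := mvfderiv_mlieBracket (V := fun v ↦ (J G (c.tilde A a) v).2) (W := fun v ↦ (S v).2)
    ((ChartPair.contMDiffAt_J_tilde_snd G hu a).of_le ENat.LEInfty.out) (hS.contMDiffAt_snd_one u)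
    (contMDiffAt_coord (n := 2) hu.1)
  rw [mvfderiv_congr h1] at h2
  have h3 : A.deriv (c.delta G S a) (coord E c.e) u = (1 / 2 : ℝ) •
      (A.deriv (c.tilde A a) (coord E c.e) u +
        A.deriv (A.lie (J G (c.tilde A a)) S) (coord E c.e) u -
        mvfderiv (totalModel m r) (coord E c.e) u
          (vlift u ((G.g u.proj).symm (A.lie (c.tilde A a) S u).1))) := by
    change mvfderiv (totalModel m r) (coord E c.e) u ((1 / 2 : ℝ) • ((c.tilde A a u).2 +
      (A.lie (J G (c.tilde A a)) S u).2 - vlift u _)) = _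
    rw [map_smul, map_sub, map_add]
    rfl
  have h4 : A.deriv (c.tilde A a) (coord E c.e) u = 0 := mvfderiv_coord_hlift hu.1 _
  change A.deriv (c.delta G S a) (coord E c.e) u b = _
  rw [h3, h4, mvfderiv_coord_vlift hu.1, ChartPair.coord_g_symm G hu, A.deriv_eq, A.lie_snd, h2]
  simp [A.deriv_eq, Finset.sum_apply]

/-- Only the first component of `S` enters, so this part of the projector is smooth on the whole
chart domain, including the zero section. -/
theorem contMDiffAt_coord_lie_tilde_fst (a : Fin r) :
    ContMDiffAt (totalModel m r) 𝓘(ℝ, Fin r → ℝ) ∞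
      (fun v ↦ coord E c.e' ⟨A.h v.proj, (A.lie (c.tilde A a) S v).1⟩) u := by
  obtain ⟨s, hs⟩ := exists_frame_extension (m := m) c.e' hu.2
  have hσ := ChartPair.contMDiffAt_hcomp hu (hS.contMDiffAt_fst u)
  have hτ := ChartPair.contMDiffAt_hcomp hu (ChartPair.contMDiffAt_tilde_fst (c := c) hu a)
  have hbr : ∀ k l, ContMDiffAt (totalModel m r) 𝓘(ℝ, Fin r → ℝ) ∞
      (fun v : TotalSpace (Fin r → ℝ) E ↦
        coord E c.e' ⟨A.h v.proj, A.bracket (s k) (s l) (A.h v.proj)⟩) u := fun k l ↦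
    ContMDiffAt.comp (g := coord E c.e') (f := fun v : TotalSpace (Fin r → ℝ) E ↦
        (⟨A.h v.proj, A.bracket (s k) (s l) (A.h v.proj)⟩ : TotalSpace (Fin r → ℝ) E)) u
      (contMDiffAt_coord
        (u := ⟨A.h u.proj, A.bracket (s k) (s l) (A.h u.proj)⟩) hu.2)
      (((A.bracket (s k) (s l)).contMDiff.contMDiffAt (x := A.h u.proj)).comp u
        (A.contMDiffAt_h_proj u))
  have h1 : ContMDiffAt (totalModel m r) 𝓘(ℝ, Fin r → ℝ) ∞ (fun v ↦
      mvfderiv (totalModel m r) (fun v ↦ coord E c.e' ⟨A.h v.proj, (S v).1⟩) v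
        (c.tilde A a v).2 +
      ∑ l, coord E c.e' ⟨A.h v.proj, (S v).1⟩ l •
        ∑ k, coord E c.e' ⟨A.h v.proj, (c.tilde A a v).1⟩ k •
          coord E c.e' ⟨A.h v.proj, A.bracket (s k) (s l) (A.h v.proj)⟩) u :=
    (contMDiffAt_mvfderiv (ChartPair.contMDiffAt_tilde_snd hu a) hσ (by simp)).add
      (ContMDiffAt.sum fun l _ ↦ (contMDiffAt_pi_apply hσ l).smul
        (ContMDiffAt.sum fun k _ ↦ (contMDiffAt_pi_apply hτ k).smul (hbr k l)))
  refine h1.congr_of_eventuallyEq ?_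
  filter_upwards [ChartPair.eventually_mem_domain hu,
    (A.contMDiffAt_h_proj (n := 1) u).continuousAt.eventually (eventually_eventually_nhds.2 hs)]
    with v hv hv'
  rw [hS.coord_lie_tilde_fst hv, A.structureForm_eq hv.2 hv']
  rfl

theorem contMDiffAt_H (hΩ : IsOpen Ω) (huΩ : u ∈ Ω) (b a : Fin r) :
    ContMDiffAt (totalModel m r) 𝓘(ℝ, ℝ) ∞ (c.H G S b a) u := by
  have h1 := contMDiffAt_mvfderiv (k := ∞) (ChartPair.contMDiffAt_J_tilde_snd G hu a)
    (hS.contMDiffAt_deriv_coord hu hΩ huΩ) (by simp)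
  have h2 := contMDiffAt_mvfderiv (k := ∞) (hS.contMDiffAt_snd hΩ huΩ)
    (ChartPair.contMDiffAt_gVec G hu a) (by simp)
  have h3 := hS.contMDiffAt_coord_lie_tilde_fst hu a
  have h4 : ContMDiffAt (totalModel m r) 𝓘(ℝ, ℝ) ∞ (fun v ↦ 1 / 2 *
      (A.deriv (J G (c.tilde A a)) (fun v ↦ A.deriv S (coord E c.e) v) v b
      - A.deriv S (c.gVec G a) v b
      - ∑ k, coord E c.e' ⟨A.h v.proj, (A.lie (c.tilde A a) S v).1⟩ k * c.gVec G k v b)) u :=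
    contMDiffAt_const.mul (((contMDiffAt_pi_apply h1 b).sub (contMDiffAt_pi_apply h2 b)).sub
      (ContMDiffAt.sum fun k _ ↦ (contMDiffAt_pi_apply h3 k).mul
        (contMDiffAt_pi_apply (ChartPair.contMDiffAt_gVec G hu k) b)))
  refine h4.congr_of_eventuallyEq ?_
  filter_upwards [ChartPair.eventually_mem_domain hu] with v hv
  exact hS.H_eq hv b a

include hS'

/-- The difference of the components of the horizontal projectors of two sprays. -/
theorem H_sub (b a : Fin r) :
    c.H G S' b a u - c.H G S b a u = 1 / 2 * ∑ k, c.gInv G k a u *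
      c.dot A k (fun v ↦ A.deriv S' (coord E c.e) v b - A.deriv S (coord E c.e) v b) u := by
  have hfst : (fun v ↦ coord E c.e' ⟨A.h v.proj, (S v).1⟩) =
      fun v ↦ coord E c.e' ⟨A.h v.proj, (S' v).1⟩ := by
    funext v
    rw [hS.fst_eq, hS'.fst_eq]
  have hp : projDeriv u (S' u).2 = projDeriv u (S u).2 := by
    rw [(A.memFiber_iff _ _).1 (hS.memFiber u), (A.memFiber_iff _ _).1 (hS'.memFiber u),
      hS.fst_eq, hS'.fst_eq]
  have h1 := (hS.contMDiffAt_deriv_coord_one hu).mdifferentiableAt (by simp)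
  have h2 := (hS'.contMDiffAt_deriv_coord_one hu).mdifferentiableAt (by simp)
  have hdot : ∀ k, c.dot A k
      (fun v ↦ A.deriv S' (coord E c.e) v b - A.deriv S (coord E c.e) v b) u =
      A.deriv (c.dotTilde A k) (fun v ↦ A.deriv S' (coord E c.e) v) u b -
        A.deriv (c.dotTilde A k) (fun v ↦ A.deriv S (coord E c.e) v) u b := by
    intro k
    rw [ChartPair.dot, A.deriv_eq, mvfderiv_fun_sub (mdifferentiableAt_pi_apply h2 b)
      (mdifferentiableAt_pi_apply h1 b), sub_apply, ← mvfderiv_pi_apply h1,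
      ← mvfderiv_pi_apply h2]
    rfl
  -- Two of the three terms in `H_eq` agree for `S` and `S'`: the components of `g⁻¹ s'_a` come from
  -- the base, so only the projection of the spray acts on them, and the bracket with `∂̃_a` uses
  -- only the first component.
  rw [hS.H_eq hu, hS'.H_eq hu, hS.coord_lie_tilde_fst hu, hS'.coord_lie_tilde_fst hu, hfst,
    hS.fst_eq, hS'.fst_eq, ChartPair.deriv_gVec G hu, ChartPair.deriv_gVec G hu, hp,
    ChartPair.deriv_J_tilde G hu, ChartPair.deriv_J_tilde G hu]
  simp only [hdot, mul_sub, Finset.sum_sub_distrib, Finset.sum_apply, Pi.smul_apply, smul_eq_mul]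
  ring

theorem delta_sub (a : Fin r) :
    c.delta G S' a u = c.delta G S a u +
      ∑ b, (c.H G S' b a u - c.H G S b a u) • c.dotTilde A b u := by
  rw [hS.delta_eq hu, hS'.delta_eq hu, add_assoc, ← Finset.sum_add_distrib]
  simp only [sub_smul, add_sub_cancel]

end Chart

end GeneralizedLieAlgebroid.IsSpray

end Sprays

/-! ### Index algebra for a change of adapted base. -/

section Algebra

variable {ι W : Type*} [Fintype ι] [AddCommGroup W] [Module ℝ W]

theorem sum_smul_add_sum_smul (c : ι → ℝ) (T : ι → ι → ℝ) (δ d : ι → W) :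
    ∑ k, c k • (δ k + ∑ b, T b k • d b) =
      ∑ k, c k • δ k + ∑ k, (∑ l, T k l * c l) • d k := by
  simp only [smul_add, Finset.sum_add_distrib, Finset.smul_sum, Finset.sum_smul, smul_smul]
  congr 1
  rw [Finset.sum_comm]
  simp only [mul_comm]

/-- The Berwald formula at one point, stripped of geometry. `x, Xv` and `Y, Yv` are the components
of `X` and `Y` adapted to `S'`; `y, z` are the derivatives along `X` of `Y`'s components; `N` and
`T` stand for `H` and the tensor `A`; `dN k a b` and `dT k a b` are `∂̇_b` of the entries `(k, a)`,
and `R k l a` is `(ρ^i_a ∘ h ∘ π) ∂_i A^k_l`. The left side is expanded by replacing the new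
horizontal vectors by `δ + T d`. -/
theorem sum_smul_change (x Y Xv Yv y z : ι → ℝ) (N T : ι → ι → ℝ) (dN dT R : ι → ι → ι → ℝ)
    (δ d : ι → W) :
    ∑ k, (y k + ∑ a, ∑ b, x a * Y b * (-dN k a b - dT k a b)) • (δ k + ∑ b, T b k • d b) +
      ∑ k, (z k + ∑ a, ∑ b, x a * Yv b * (-dN k a b - dT k a b)) • d k =
    (∑ k, (y k + ∑ a, ∑ b, x a * Y b * (-dN k a b)) • δ k +
      ∑ k, (z k + ∑ l, (y l * T k l + Y l * (∑ a, x a * R k l a +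
          ∑ a, (Xv a + ∑ b, x b * (N a b + T a b)) * dT k l a)) +
        ∑ a, ∑ b, x a * (Yv b + ∑ l, Y l * T b l) * (-dN k a b)) • d k) +
    (-∑ k, (∑ a, ∑ b, x a * Y b * dT k a b) • δ k +
      ∑ k, (- (∑ a, ∑ b, ∑ l, x a * Y b * T k l * dN l a b)
        - (∑ a, ∑ b, ∑ l, x a * Y b * T k l * dT l a b)
        - (∑ a, ∑ b, x a * Yv b * dT k a b)
        - (∑ a, ∑ l, ∑ p, x a * T p a * Y l * dT k l p)
        - (∑ a, ∑ l, x a * Y l * R k l a)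
        - (∑ a, ∑ l, ∑ p, x a * Y l * N p a * dT k l p)
        + (∑ a, ∑ l, ∑ b, x a * Y l * T b l * dN k a b)
        - (∑ a, ∑ l, Xv a * Y l * dT k l a)) • d k) := by
  have e1 : ∀ k, ∑ l, T k l * (y l + ∑ a, ∑ b, x a * Y b * (-dN l a b - dT l a b)) =
      ∑ l, y l * T k l - ∑ a, ∑ b, ∑ l, x a * Y b * T k l * dN l a b -
        ∑ a, ∑ b, ∑ l, x a * Y b * T k l * dT l a b := by
    intro k
    have : ∑ l, T k l * ∑ a, ∑ b, x a * Y b * (-dN l a b - dT l a b) =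
        -∑ a, ∑ b, ∑ l, x a * Y b * T k l * dN l a b -
        ∑ a, ∑ b, ∑ l, x a * Y b * T k l * dT l a b := by
      simp only [Finset.mul_sum, ← Finset.sum_neg_distrib, ← Finset.sum_sub_distrib]
      rw [Finset.sum_comm]
      refine Finset.sum_congr rfl fun a _ ↦ ?_
      rw [Finset.sum_comm]
      refine Finset.sum_congr rfl fun b _ ↦ Finset.sum_congr rfl fun l _ ↦ ?_
      ring
    simp only [mul_add, Finset.sum_add_distrib, this, mul_comm (T k _) (y _)]
    ring
  have e3 : ∀ k, ∑ a, ∑ b, x a * (Yv b + ∑ l, Y l * T b l) * (-dN k a b) =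
      ∑ a, ∑ b, x a * Yv b * (-dN k a b) - ∑ a, ∑ l, ∑ b, x a * Y l * T b l * dN k a b := by
    intro k
    rw [← Finset.sum_sub_distrib]
    refine Finset.sum_congr rfl fun a _ ↦ ?_
    rw [Finset.sum_comm (γ := ι) (t := Finset.univ), ← Finset.sum_sub_distrib]
    refine Finset.sum_congr rfl fun b _ ↦ ?_
    have : ∑ l, x a * Y l * T b l * dN k a b = x a * (∑ l, Y l * T b l) * dN k a b := by
      rw [Finset.mul_sum, Finset.sum_mul]
      exact Finset.sum_congr rfl fun l _ ↦ by ring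
    rw [this]
    ring
  have e4 : ∀ k, ∑ l, Y l * (∑ a, x a * R k l a +
        ∑ a, (Xv a + ∑ b, x b * (N a b + T a b)) * dT k l a) =
      ∑ a, ∑ l, x a * Y l * R k l a + ∑ a, ∑ l, Xv a * Y l * dT k l a +
        ∑ a, ∑ l, ∑ p, x a * Y l * N p a * dT k l p +
        ∑ a, ∑ l, ∑ p, x a * T p a * Y l * dT k l p := by
    intro k
    rw [Finset.sum_comm (f := fun a l ↦ x a * Y l * R k l a),
      Finset.sum_comm (f := fun a l ↦ Xv a * Y l * dT k l a),
      Finset.sum_comm (f := fun a l ↦ ∑ p, x a * Y l * N p a * dT k l p),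
      Finset.sum_comm (f := fun a l ↦ ∑ p, x a * T p a * Y l * dT k l p)]
    simp only [← Finset.sum_add_distrib]
    refine Finset.sum_congr rfl fun l _ ↦ ?_
    simp only [Finset.sum_add_distrib, add_mul, mul_add, Finset.mul_sum, Finset.sum_mul]
    rw [Finset.sum_comm (f := fun a p ↦ x a * Y l * N p a * dT k l p),
      Finset.sum_comm (f := fun a p ↦ x a * T p a * Y l * dT k l p)]
    simp only [← Finset.sum_add_distrib]
    refine Finset.sum_congr rfl fun a _ ↦ ?_
    simp only [Finset.sum_add_distrib, add_assoc]
    refine congrArg₂ _ (by ring) (congrArg₂ _ (by ring) (congrArg₂ _ ?_ ?_)) <;>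
      exact Finset.sum_congr rfl fun b _ ↦ by ring
  have e2 : ∀ (V : ι → ℝ) k, ∑ a, ∑ b, x a * V b * (-dN k a b - dT k a b) =
      ∑ a, ∑ b, x a * V b * (-dN k a b) - ∑ a, ∑ b, x a * V b * dT k a b := by
    intro V k
    simp only [mul_sub, Finset.sum_sub_distrib]
  rw [sum_smul_add_sum_smul, add_assoc, add_add_add_comm]
  refine congrArg₂ (· + ·) ?_ ?_
  · rw [← Finset.sum_neg_distrib, ← Finset.sum_add_distrib]
    refine Finset.sum_congr rfl fun k _ ↦ ?_
    rw [← neg_smul, ← add_smul, e2]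
    congr 1
    ring
  · rw [← Finset.sum_add_distrib, ← Finset.sum_add_distrib]
    refine Finset.sum_congr rfl fun k _ ↦ ?_
    rw [← add_smul, ← add_smul, e1, e3, e2, Finset.sum_add_distrib, e4]
    congr 1
    ring

end Algebra

/-! ### A projective change alters the Berwald derivative by the stated formula. -/

section Projective

open GeneralizedLieAlgebroid

variable {m r : ℕ} {M : Type*} [TopologicalSpace M]
  [ChartedSpace (EuclideanSpace ℝ (Fin m)) M] [IsManifold (𝓡 m) ∞ M]
  {E : M → Type*} [TopologicalSpace (TotalSpace (Fin r → ℝ) E)]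
  [∀ x, AddCommGroup (E x)] [∀ x, Module ℝ (E x)] [∀ x, TopologicalSpace (E x)]
  [FiberBundle (Fin r → ℝ) E] [VectorBundle ℝ (Fin r → ℝ) E]
  [ContMDiffVectorBundle ∞ (Fin r → ℝ) E (𝓡 m)]

variable [T2Space M] [SigmaCompactSpace M] {A : GeneralizedLieAlgebroid m r E}
  {G : A.InvertibleMorphism} {Ω : Set (TotalSpace (Fin r → ℝ) E)} {S S' : A.Field}
  {c : ChartPair r E}

theorem ChartPair.acomp_eq (S S' Y : A.Field) (k : Fin r) (v : TotalSpace (Fin r → ℝ) E) :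
    c.acomp G S Y k v = c.acomp G S' Y k v +
      ∑ l, c.hcomp Y l v * (c.H G S' k l v - c.H G S k l v) := by
  simp only [ChartPair.acomp, mul_sub, Finset.sum_sub_distrib]
  ring

variable {u : TotalSpace (Fin r → ℝ) E} (hu : u ∈ c.domain A)
include hu

namespace ChartPair

theorem dot_coord (a b : Fin r) :
    c.dot A a (fun v ↦ coord E c.e v b) u = (Pi.single a 1 : Fin r → ℝ) b := by
  rw [← congrFun (deriv_dotTilde_coord hu a) b, A.deriv_eq,
    mvfderiv_pi_apply (mdifferentiableAt_coord hu.1)]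
  rfl

theorem dot_mul_coord {f : TotalSpace (Fin r → ℝ) E → ℝ}
    (hf : MDifferentiableAt (totalModel m r) 𝓘(ℝ, ℝ) f u) (a b : Fin r) :
    c.dot A a (fun v ↦ f v * coord E c.e v b) u =
      coord E c.e u b * c.dot A a f u + f u * (Pi.single a 1 : Fin r → ℝ) b := by
  rw [← dot_coord (A := A) hu, dot, A.deriv_eq,
    mvfderiv_fun_mul hf (mdifferentiableAt_pi_apply (mdifferentiableAt_coord hu.1) b)]
  simp [dot, A.deriv_eq]
  ring

theorem deriv_add_smul_liouville (f : TotalSpace (Fin r → ℝ) E → ℝ) (b : Fin r) :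
    A.deriv (fun v ↦ S v + f v • A.liouville v) (coord E c.e) u b =
      A.deriv S (coord E c.e) u b + f u * coord E c.e u b := by
  rw [A.deriv_eq, Prod.snd_add, Prod.smul_snd, map_add, map_smul, ← A.deriv_eq, ← A.deriv_eq,
    deriv_liouville_coord hu]
  rfl

end ChartPair

namespace GeneralizedLieAlgebroid.IsSpray

variable (hS : IsSpray G Ω S) (hS' : IsSpray G Ω S')
include hS hS'

/-- The components of the horizontal projector change by `A^b_a` under a projective change. -/
theorem H_sub_eq_tensorA {f : TotalSpace (Fin r → ℝ) E → ℝ}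
    (hf : ContMDiff (totalModel m r) 𝓘(ℝ, ℝ) 1 f) (h : S' = fun v ↦ S v + f v • A.liouville v)
    (b a : Fin r) :
    c.H G S' b a u - c.H G S b a u = c.tensorA G f b a u := by
  have h1 : (fun v ↦ A.deriv S' (coord E c.e) v b - A.deriv S (coord E c.e) v b) =ᶠ[𝓝 u]
      fun v ↦ f v * coord E c.e v b := by
    filter_upwards [ChartPair.eventually_mem_domain hu] with v hv
    rw [h, ChartPair.deriv_add_smul_liouville hv, add_sub_cancel_left]
  have h2 : ∀ k, c.dot A k
      (fun v ↦ A.deriv S' (coord E c.e) v b - A.deriv S (coord E c.e) v b) u =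
      coord E c.e u b * c.dot A k f u + f u * (Pi.single k 1 : Fin r → ℝ) b := fun k ↦ by
    rw [← ChartPair.dot_mul_coord hu ((hf u).mdifferentiableAt (by simp))]
    exact congrFun (congrArg DFunLike.coe (mvfderiv_congr h1)) _
  rw [hS.H_sub hS' hu]
  simp only [h2, ChartPair.tensorA, mul_add, Finset.sum_add_distrib, Pi.single_apply]
  simp only [mul_ite, mul_one, mul_zero, Finset.sum_ite_eq, Finset.mem_univ, if_true]
  refine congrArg₂ _ (congrArg (1 / 2 * ·) (Finset.sum_congr rfl fun k _ ↦ by ring)) (by ring)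

/-- The change of the Berwald derivative when the components of the horizontal projector change
by `A^b_a`. -/
theorem berwald_eq (hΩ : IsOpen Ω) (huΩ : u ∈ Ω) {f : TotalSpace (Fin r → ℝ) E → ℝ}
    (h : ∀ v ∈ c.domain A, ∀ b a, c.H G S' b a v - c.H G S b a v = c.tensorA G f b a v)
    {X Y : A.Field} (hX : A.MemFiber X u) (hY : A.IsSectionOn ∞ (Ω ∩ c.domain A) Y) :
    c.berwald G S' X Y u = c.berwald G S X Y u + c.berwaldDifference G f S S' X Y u := by
  have hO : Ω ∩ c.domain A ∈ 𝓝 u := (hΩ.inter c.isOpen_domain).mem_nhds ⟨huΩ, hu⟩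
  have hHd := fun k a ↦ (hS.contMDiffAt_H hu hΩ huΩ k a).mdifferentiableAt (by simp)
  have hHd' := fun k a ↦ (hS'.contMDiffAt_H hu hΩ huΩ k a).mdifferentiableAt (by simp)
  have hTH : ∀ k a, c.tensorA G f k a =ᶠ[𝓝 u] fun v ↦ c.H G S' k a v - c.H G S k a v := by
    intro k a
    filter_upwards [ChartPair.eventually_mem_domain hu] with v hv
    exact (h v hv k a).symm
  -- Differentiability of `A^k_a`, which involves `∂̇ f`, is inherited from the smoothness of `H`
  -- and `H'` on `Ω`.
  have hTd : ∀ k a, MDifferentiableAt (totalModel m r) 𝓘(ℝ, ℝ) (c.tensorA G f k a) u :=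
    fun k a ↦ ((hHd' k a).sub (hHd k a)).congr_of_eventuallyEq (hTH k a)
  have hYh : ∀ l, MDifferentiableAt (totalModel m r) 𝓘(ℝ, ℝ) (c.hcomp Y l) u := fun l ↦
    mdifferentiableAt_pi_apply ((ChartPair.contMDiffAt_hcomp hu
      ((hY.fst u ⟨huΩ, hu⟩).contMDiffAt hO)).mdifferentiableAt (by simp)) l
  have hYv : ∀ k, MDifferentiableAt (totalModel m r) 𝓘(ℝ, ℝ) (c.acomp G S' Y k) u := by
    intro k
    have h1 := (contMDiffAt_mvfderiv (k := ∞) ((hY.snd u ⟨huΩ, hu⟩).contMDiffAt hO)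
      (contMDiffAt_coord (e := c.e) hu.1) (by simp)).mdifferentiableAt (by simp)
    exact (mdifferentiableAt_pi_apply h1 k).sub
      (mdifferentiableAt_finsetSum fun l _ ↦ (hYh l).mul (hHd' k l))
  have hneg : ∀ k a b, c.dot A b (fun v ↦ -c.H G S k a v) u = -c.dot A b (c.H G S k a) u :=
    fun k a b ↦ by
      rw [ChartPair.dot, A.deriv_eq, mvfderiv_fun_neg]
      rfl
  have hneg' : ∀ k a b, c.dot A b (fun v ↦ -c.H G S' k a v) u =
      -c.dot A b (c.H G S k a) u - c.dot A b (c.tensorA G f k a) u := fun k a b ↦ by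
    rw [ChartPair.dot, A.deriv_eq, mvfderiv_fun_neg, ChartPair.dot, ChartPair.dot, A.deriv_eq,
      A.deriv_eq, mvfderiv_congr (hTH k a), mvfderiv_fun_sub (hHd' k a) (hHd k a)]
    simp only [neg_apply, sub_apply]
    ring
  -- The vertical component of `X` in the base `(∂̃, ∂̇̃)` is its component adapted to `S'` plus
  -- `X^b H'^a_b`, with `H' = H + A`.
  have hXT : ∀ k l, A.deriv X (c.tensorA G f k l) u =
      ∑ a, c.hcomp X a u * c.rhoPartial A a (c.tensorA G f k l) u +
      ∑ a, (c.acomp G S' X a u + ∑ b, c.hcomp X b u * (c.H G S a b u + c.tensorA G f a b u)) *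
        c.dot A a (c.tensorA G f k l) u := by
    intro k l
    rw [ChartPair.deriv_eq_sum hu hX]
    refine congrArg₂ _ rfl (Finset.sum_congr rfl fun a _ ↦ congrArg₂ _ ?_ rfl)
    simp only [← h u hu, add_sub_cancel, ChartPair.acomp, sub_add_cancel]
  -- The components of `Y` adapted to `S` and to `S'` differ by `Y^l A^k_l`; differentiating this
  -- product yields the terms with derivatives of `A`.
  have hac : ∀ k, A.deriv X (c.acomp G S Y k) u = A.deriv X (c.acomp G S' Y k) u +
      ∑ l, (A.deriv X (c.hcomp Y l) u * c.tensorA G f k l u +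
        c.hcomp Y l u * A.deriv X (c.tensorA G f k l) u) := by
    intro k
    have h1 : c.acomp G S Y k =ᶠ[𝓝 u] fun v ↦ c.acomp G S' Y k v +
        ∑ l, c.hcomp Y l v * c.tensorA G f k l v := by
      filter_upwards [ChartPair.eventually_mem_domain hu] with v hv
      rw [ChartPair.acomp_eq S S' Y k v]
      simp only [h v hv]
    have h2 : MDifferentiableAt (totalModel m r) 𝓘(ℝ, ℝ)
        (fun v ↦ ∑ l, c.hcomp Y l v * c.tensorA G f k l v) u :=
      mdifferentiableAt_finsetSum fun l _ ↦ (hYh l).mul (hTd k l)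
    rw [A.deriv_eq, mvfderiv_congr h1, mvfderiv_fun_add (hYv k) h2, add_apply,
      mvfderiv_finsetSum (φ := fun l v ↦ c.hcomp Y l v * c.tensorA G f k l v)
        fun l _ ↦ (hYh l).mul (hTd k l)]
    refine congrArg₂ _ rfl (Finset.sum_congr rfl fun l _ ↦ ?_)
    rw [mvfderiv_fun_mul (hYh l) (hTd k l)]
    simp [A.deriv_eq]
    ring
  have hδ : ∀ k, c.delta G S' k u = c.delta G S k u +
      ∑ b, c.tensorA G f b k u • c.dotTilde A b u := fun k ↦ by
    rw [hS.delta_sub hS' hu]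
    simp only [h u hu]
  have hacu : ∀ k, c.acomp G S Y k u = c.acomp G S' Y k u +
      ∑ l, c.hcomp Y l u * c.tensorA G f k l u := fun k ↦ by
    rw [ChartPair.acomp_eq S S' Y k u]
    simp only [h u hu]
  have key := sum_smul_change (fun a ↦ c.hcomp X a u) (fun a ↦ c.hcomp Y a u)
    (fun a ↦ c.acomp G S' X a u) (fun a ↦ c.acomp G S' Y a u)
    (fun k ↦ A.deriv X (c.hcomp Y k) u) (fun k ↦ A.deriv X (c.acomp G S' Y k) u)
    (fun b a ↦ c.H G S b a u) (fun b a ↦ c.tensorA G f b a u)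
    (fun k a b ↦ c.dot A b (c.H G S k a) u) (fun k a b ↦ c.dot A b (c.tensorA G f k a) u)
    (fun k d a ↦ c.rhoPartial A a (c.tensorA G f k d) u)
    (fun k ↦ c.delta G S k u) (fun k ↦ c.dotTilde A k u)
  simp only [ChartPair.berwald, ChartPair.berwaldDifference, hneg, hneg', hδ, hac, hXT, hacu]
  exact key

end GeneralizedLieAlgebroid.IsSpray

end Projective

/-! ### Euler's relation at a point of differentiability. -/

section Homogeneous

/-- A differentiable function that satisfies Euler's relation of degree one is linear. -/
theorem eq_fderiv_zero_of_homogeneous {V : Type*} [NormedAddCommGroup V] [NormedSpace ℝ V]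
    {F : V → ℝ} (hF : Differentiable ℝ F) (h : ∀ y, fderiv ℝ F y y = F y) (y : V) :
    F y = fderiv ℝ F 0 y := by
  have hd : ∀ t : ℝ, HasDerivAt (fun t : ℝ ↦ F (t • y)) (fderiv ℝ F (t • y) y) t := fun t ↦ by
    have h1 : HasDerivAt (fun t : ℝ ↦ t • y) ((1 : ℝ) • y) t := (hasDerivAt_id t).smul_const y
    rw [one_smul] at h1
    exact (hF (t • y)).hasFDerivAt.comp_hasDerivAt t h1
  -- Integrating Euler's relation along the flow `y ↦ exp s • y` of the radial field gives positive
  -- homogeneity.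
  have hconst : ∀ s : ℝ, Real.exp (-s) * F (Real.exp s • y) = F y := by
    have h2 : ∀ s : ℝ, HasDerivAt (fun s ↦ Real.exp (-s) * F (Real.exp s • y)) 0 s := by
      intro s
      have h3 := (hd (Real.exp s)).comp s (Real.hasDerivAt_exp s)
      have h4 := ((Real.hasDerivAt_exp (-s)).comp s (hasDerivAt_neg s)).mul h3
      have h5 := h (Real.exp s • y)
      rw [map_smul, smul_eq_mul] at h5
      have h6 : Real.exp (-s) * -1 * F (Real.exp s • y) +
          Real.exp (-s) * (fderiv ℝ F (Real.exp s • y) y * Real.exp s) = 0 := by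
        rw [← h5]
        ring
      exact h6 ▸ h4
    intro s
    have h3 := is_const_of_deriv_eq_zero (fun s ↦ (h2 s).differentiableAt)
      (fun s ↦ (h2 s).deriv) s 0
    simpa using h3
  have hpos : ∀ t : ℝ, 0 ≤ t → F (t • y) = t * F y := by
    intro t ht
    rcases ht.eq_or_lt with rfl | ht
    · have := h 0
      rw [map_zero] at this
      simp [← this]
    · have := hconst (Real.log t)
      rw [Real.exp_neg, Real.exp_log ht] at this
      rw [← this, mul_inv_cancel_left₀ ht.ne']
  -- The right derivative of `t ↦ F (t y)` at 0 is both `F y`, by positive homogeneity, and the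
  -- differential of `F` at 0 applied to `y`. Differentiability at the origin is what forces
  -- linearity.
  have h1 := (hd 0).hasDerivWithinAt (s := Set.Ici 0)
  have h2 : HasDerivWithinAt (fun t : ℝ ↦ F (t • y)) (F y) (Set.Ici 0) 0 := by
    have h3 : HasDerivAt (fun t : ℝ ↦ t * F y) (1 * F y) 0 := (hasDerivAt_id 0).mul_const _
    rw [one_mul] at h3
    exact h3.hasDerivWithinAt.congr (fun t ht ↦ hpos t ht) (hpos 0 le_rfl)
  have h3 := (uniqueDiffWithinAt_Ici (0 : ℝ)).eq_deriv _ h2 h1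
  rwa [zero_smul] at h3

end Homogeneous

/-! ### Recovering the projective change from the Berwald derivatives. -/

section Converse

open GeneralizedLieAlgebroid

variable {m r : ℕ} {M : Type*} [TopologicalSpace M]
  [ChartedSpace (EuclideanSpace ℝ (Fin m)) M] [IsManifold (𝓡 m) ∞ M]
  {E : M → Type*} [TopologicalSpace (TotalSpace (Fin r → ℝ) E)]
  [∀ x, AddCommGroup (E x)] [∀ x, Module ℝ (E x)] [∀ x, TopologicalSpace (E x)]
  [FiberBundle (Fin r → ℝ) E] [VectorBundle ℝ (Fin r → ℝ) E]
  [ContMDiffVectorBundle ∞ (Fin r → ℝ) E (𝓡 m)]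

variable {A : GeneralizedLieAlgebroid m r E} {c : ChartPair r E}
  {f : TotalSpace (Fin r → ℝ) E → ℝ} {u : TotalSpace (Fin r → ℝ) E}

namespace ChartPair

section Function

variable (hu : u ∈ c.domain A)
include hu

/-- A 1-homogeneous function of class `C^1` is linear on the fibres. -/
theorem exists_linear (hf : ContMDiff (totalModel m r) 𝓘(ℝ, ℝ) 1 f) (hh : A.OneHomogeneous f) :
    ∃ L : E u.proj →ₗ[ℝ] ℝ, ∀ z, f ⟨u.proj, z⟩ = L z := by
  let p : (Fin r → ℝ) → TotalSpace (Fin r → ℝ) E := fun y ↦ ⟨u.proj, c.e.symm u.proj y⟩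
  have hp : ContMDiff 𝓘(ℝ, Fin r → ℝ) (totalModel m r) 1 p := fun y ↦ by
    refine contMDiffAt_mk hu.1 contMDiffAt_const ?_
    simp only [coord_symm hu.1]
    exact contMDiffAt_id
  have hF : Differentiable ℝ (f ∘ p) :=
    (hf.comp hp).contDiff.differentiable (by simp)
  have hE : ∀ y, fderiv ℝ (f ∘ p) y y = (f ∘ p) y := by
    intro y
    have h1 := hh (p y)
    rw [A.deriv_eq] at h1
    have h2 := (mvfderiv_vlift (u := p y) hu.1 ((hf (p y)).mdifferentiableAt (by simp))
      (c.e.symm u.proj y)).symm.trans h1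
    have h3 : (fun t : ℝ ↦ f ⟨u.proj, c.e.symm u.proj y + t • c.e.symm u.proj y⟩) =
        fun t ↦ (f ∘ p) (y + t • y) := by
      funext t
      simp only [Function.comp, p]
      rw [← Bundle.Trivialization.symmₗ_apply (R := ℝ) _ hu.1,
        ← Bundle.Trivialization.symmₗ_apply (R := ℝ) _ hu.1, map_add, map_smul]
    have h4 : HasDerivAt (fun t : ℝ ↦ (f ∘ p) (y + t • y)) (fderiv ℝ (f ∘ p) y y) 0 := by
      have h5 : HasDerivAt (fun t : ℝ ↦ y + t • y) ((1 : ℝ) • y) 0 :=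
        ((hasDerivAt_id 0).smul_const _).const_add _
      rw [one_smul] at h5
      have h6 : HasFDerivAt (f ∘ p) (fderiv ℝ (f ∘ p) y) (y + (0 : ℝ) • y) := by
        rw [zero_smul, add_zero]
        exact (hF y).hasFDerivAt
      exact h6.comp_hasDerivAt 0 h5
    have h7 : fderiv ℝ (fun t : ℝ ↦ (f ∘ p) (y + t • y)) 0 1 = fderiv ℝ (f ∘ p) y y := by
      rw [h4.hasFDerivAt.fderiv]
      simp
    rw [← h7, ← h3]
    exact h2
  refine ⟨(fderiv ℝ (f ∘ p) 0).toLinearMap.comp (c.e.linearMapAt ℝ u.proj), fun z ↦ ?_⟩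
  have h8 := eq_fderiv_zero_of_homogeneous hF hE (coord E c.e ⟨u.proj, z⟩)
  simp only [Function.comp, p, symm_coord hu.1] at h8
  rw [h8, coord_eq hu.1]
  rfl

theorem dot_of_homogeneous (hf : ContMDiff (totalModel m r) 𝓘(ℝ, ℝ) 1 f)
    (hh : A.OneHomogeneous f) (k : Fin r) :
    c.dot A k f u = f ⟨u.proj, c.e.symm u.proj (Pi.single k 1)⟩ := by
  obtain ⟨L, hL⟩ := exists_linear hu hf hh
  rw [hL]
  exact mvfderiv_vlift_of_linear hu.1 ((hf u).mdifferentiableAt (by simp)) L hL _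

/-- A priori `∂̇_k f` is only continuous. Linearity on fibres identifies it with the value of `f` on
the frame vector `s_k`, which is `C^1`. -/
theorem mdifferentiableAt_tensorA (G : A.InvertibleMorphism)
    (hf : ContMDiff (totalModel m r) 𝓘(ℝ, ℝ) 1 f) (hh : A.OneHomogeneous f) (b a : Fin r) :
    MDifferentiableAt (totalModel m r) 𝓘(ℝ, ℝ) (c.tensorA G f b a) u := by
  have hg := fun k l ↦ mdifferentiableAt_pi_apply
    ((contMDiffAt_gVec G hu k).mdifferentiableAt (by simp)) l
  have hU := fun l ↦ mdifferentiableAt_pi_apply (mdifferentiableAt_coord (m := m) hu.1) l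
  have hfd := (hf u).mdifferentiableAt (by simp)
  have hdot : ∀ k, MDifferentiableAt (totalModel m r) 𝓘(ℝ, ℝ) (c.dot A k f) u := by
    intro k
    have h1 : MDifferentiableAt (totalModel m r) 𝓘(ℝ, ℝ)
        (fun v : TotalSpace (Fin r → ℝ) E ↦ f ⟨v.proj, c.e.symm v.proj (Pi.single k 1)⟩) u :=
      (((hf _).comp u.proj (contMDiffAt_symm_const hu.1 (Pi.single k 1))).comp u
        (Bundle.contMDiffAt_proj E)).mdifferentiableAt (by simp)
    refine h1.congr_of_eventuallyEq ?_
    filter_upwards [eventually_mem_domain hu] with v hv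
    exact dot_of_homogeneous hv hf hh k
  exact mdifferentiableAt_const.mul
    ((mdifferentiableAt_finsetSum fun k _ ↦ ((hg a k).mul (hU b)).mul (hdot k)).add
      (hfd.mul (hg a b)))

theorem deriv_liouville_eq_sum {V : Type*} [NormedAddCommGroup V] [NormedSpace ℝ V]
    (φ : TotalSpace (Fin r → ℝ) E → V) :
    A.deriv A.liouville φ u = ∑ k, coord E c.e u k • A.deriv (c.dotTilde A k) φ u := by
  have h : (A.liouville u).2 = ∑ b, coord E c.e u b • (c.dotTilde A b u).2 := vlift_eq_sum hu _
  rw [A.deriv_eq, h, map_sum]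
  exact Finset.sum_congr rfl fun b _ ↦ map_smul _ _ _

end Function

section Berwald

variable [T2Space M] [SigmaCompactSpace M] {G : A.InvertibleMorphism}
  {Ω : Set (TotalSpace (Fin r → ℝ) E)} {S S' : A.Field}

theorem isSectionOn_tilde (a : Fin r) : A.IsSectionOn ∞ (Ω ∩ c.domain A) (c.tilde A a) where
  mem _ hv := memFiber_tilde hv.2 a
  fst _ hv := (contMDiffAt_tilde_fst hv.2 a).contMDiffWithinAt
  snd _ hv := (contMDiffAt_tilde_snd hv.2 a).contMDiffWithinAt

theorem coord_sum_delta_fst (hS : IsSpray G Ω S) (hu : u ∈ c.domain A) (t : Fin r → ℝ)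
    (w : Fin r → ℝ) (k : Fin r) :
    coord E c.e' ⟨A.h u.proj,
      (∑ k, t k • c.delta G S k u + ∑ k, w k • c.dotTilde A k u).1⟩ k = t k := by
  have h0 : (∑ k, w k • c.dotTilde A k u).1 = 0 := by
    rw [Prod.fst_sum]
    exact Finset.sum_eq_zero fun k _ ↦ smul_zero (w k)
  rw [Prod.fst_add, h0, add_zero, Prod.fst_sum, coord_sum hu.2, Finset.sum_apply]
  have h1 : ∀ l, coord E c.e' ⟨A.h u.proj, (t l • c.delta G S l u).1⟩ k =
      t l * (Pi.single l 1 : Fin r → ℝ) k := by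
    intro l
    rw [Prod.smul_fst, coord_smul hu.2, hS.delta_fst hu]
    exact congrArg (t l * ·) (hcomp_tilde hu l k)
  rw [Finset.sum_congr rfl fun l _ ↦ h1 l]
  simp [Pi.single_apply]

theorem coord_neg_sum_delta_fst (hS : IsSpray G Ω S) (hu : u ∈ c.domain A) (t : Fin r → ℝ)
    (w : Fin r → ℝ) (k : Fin r) :
    coord E c.e' ⟨A.h u.proj,
      (-∑ k, t k • c.delta G S k u + ∑ k, w k • c.dotTilde A k u).1⟩ k = -t k := by
  have h := coord_sum_delta_fst hS hu (-t) w k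
  simpa only [Pi.neg_apply, neg_smul, Finset.sum_neg_distrib] using h

/-- The base sections determine the vertical derivatives of the horizontal components. -/
theorem BerwaldRelated.dot_H (hS : IsSpray G Ω S) (hS' : IsSpray G Ω S')
    (h : c.BerwaldRelated G Ω f S S') (hu : u ∈ c.domain A) (huΩ : u ∈ Ω) (k a b : Fin r) :
    c.dot A b (c.H G S' k a) u =
      c.dot A b (c.H G S k a) u + c.dot A b (c.tensorA G f k a) u := by
  have h1 := h (c.tilde A a) (c.tilde A b) (isSectionOn_tilde a) (isSectionOn_tilde b) u
    ⟨huΩ, hu⟩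
  have h2 := congrArg (fun z : E (A.h u.proj) × TangentSpace (totalModel m r) u ↦
    coord E c.e' ⟨A.h u.proj, z.1⟩ k) h1
  have hsum : ∀ t : Fin r → Fin r → ℝ, ∑ i, ∑ j, c.hcomp (c.tilde A a) i u *
      c.hcomp (c.tilde A b) j u * t i j = t a b := by
    intro t
    simp [hcomp_tilde hu, Pi.single_apply]
  have hconst : A.deriv (c.tilde A a) (c.hcomp (c.tilde A b) k) u = 0 := by
    have h3 : c.hcomp (c.tilde A b) k =ᶠ[𝓝 u] fun _ ↦ (Pi.single b 1 : Fin r → ℝ) k := by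
      filter_upwards [eventually_mem_domain hu] with v hv
      exact hcomp_tilde hv b k
    rw [A.deriv_eq, mvfderiv_of_eventually_const h3]
    rfl
  have hB : ∀ {S : A.Field}, IsSpray G Ω S → coord E c.e' ⟨A.h u.proj,
      (c.berwald G S (c.tilde A a) (c.tilde A b) u).1⟩ k = -c.dot A b (c.H G S k a) u := by
    intro S hS
    refine (coord_sum_delta_fst hS hu _ _ k).trans ?_
    rw [hconst, zero_add, hsum fun i j ↦ c.dot A j (fun v ↦ -c.H G S k i v) u, ChartPair.dot,
      A.deriv_eq, mvfderiv_fun_neg]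
    rfl
  have hD : coord E c.e' ⟨A.h u.proj,
      (c.berwaldDifference G f S S' (c.tilde A a) (c.tilde A b) u).1⟩ k =
      -c.dot A b (c.tensorA G f k a) u := by
    refine (coord_neg_sum_delta_fst hS hu _ _ k).trans ?_
    rw [hsum fun i j ↦ c.dot A j (c.tensorA G f k i) u]
  simp only [Prod.fst_add, coord_add hu.2, Pi.add_apply, hB hS, hB hS', hD] at h2
  linarith

/-- The equation `g⁻¹ (g u) = u` in components; contraction with `S` removes `g̃` from all the
formulas. -/
theorem sum_hcomp_mul_gInv (hS : IsSpray G Ω S) (hu : u ∈ c.domain A) (k : Fin r) :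
    ∑ a, c.hcomp S a u * c.gInv G k a u = coord E c.e u k := by
  have h := congrFun (coord_g_symm G hu (S u).1) k
  conv_lhs at h => rw [hS.fst_eq, LinearEquiv.symm_apply_apply]
  rw [Finset.sum_apply] at h
  exact h.symm

/-- Two degrees of homogeneity for one function: the defect `P` has degree two by the spray
equations and degree one by the Berwald relation, so it vanishes. -/
theorem BerwaldRelated.deriv_coord_of_mem (hΩ : IsOpen Ω) (hS : IsSpray G Ω S)
    (hS' : IsSpray G Ω S') (h : c.BerwaldRelated G Ω f S S')
    (hf : ContMDiff (totalModel m r) 𝓘(ℝ, ℝ) 1 f) (hh : A.OneHomogeneous f)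
    (hu : u ∈ c.domain A) (huΩ : u ∈ Ω) (b : Fin r) :
    A.deriv S' (coord E c.e) u b = A.deriv S (coord E c.e) u b + f u * coord E c.e u b := by
  let D : TotalSpace (Fin r → ℝ) E → ℝ := fun v ↦
    A.deriv S' (coord E c.e) v b - A.deriv S (coord E c.e) v b
  let P : TotalSpace (Fin r → ℝ) E → ℝ := fun v ↦ D v - f v * coord E c.e v b
  let W : Fin r → TotalSpace (Fin r → ℝ) E → ℝ := fun a v ↦
    c.H G S' b a v - c.H G S b a v - c.tensorA G f b a v
  have hs : ∀ v ∈ c.domain A, MDifferentiableAt (totalModel m r) 𝓘(ℝ, ℝ)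
      (fun v ↦ A.deriv S (coord E c.e) v b) v := fun v hv ↦
    mdifferentiableAt_pi_apply ((hS.contMDiffAt_deriv_coord_one hv).mdifferentiableAt (by simp)) b
  have hs' : ∀ v ∈ c.domain A, MDifferentiableAt (totalModel m r) 𝓘(ℝ, ℝ)
      (fun v ↦ A.deriv S' (coord E c.e) v b) v := fun v hv ↦
    mdifferentiableAt_pi_apply ((hS'.contMDiffAt_deriv_coord_one hv).mdifferentiableAt (by simp)) b
  have hU := mdifferentiableAt_pi_apply (mdifferentiableAt_coord (m := m) hu.1) b
  have hCD : ∀ v ∈ c.domain A, A.deriv A.liouville D v = 2 * D v := by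
    intro v hv
    rw [A.deriv_eq, mvfderiv_fun_sub (hs' v hv) (hs v hv), sub_apply,
      ← mvfderiv_pi_apply ((hS.contMDiffAt_deriv_coord_one hv).mdifferentiableAt (by simp)),
      ← mvfderiv_pi_apply ((hS'.contMDiffAt_deriv_coord_one hv).mdifferentiableAt (by simp)),
      ← A.deriv_eq, ← A.deriv_eq, hS.deriv_liouville_deriv_coord hv,
      hS'.deriv_liouville_deriv_coord hv]
    simp only [D, Pi.smul_apply, smul_eq_mul]
    ring
  have hfd := (hf u).mdifferentiableAt (by simp)
  have hCP : A.deriv A.liouville P u = 2 * P u := by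
    have h1 := hh u
    have h2 : mvfderiv (totalModel m r) (fun v ↦ coord E c.e v b) u (A.liouville u).2 =
        coord E c.e u b := by
      rw [← mvfderiv_pi_apply (mdifferentiableAt_coord (m := m) hu.1), ← A.deriv_eq,
        deriv_liouville_coord hu]
    have h3 := hCD u hu
    rw [A.deriv_eq] at h1 h3 ⊢
    have hD : MDifferentiableAt (totalModel m r) 𝓘(ℝ, ℝ) D u := (hs' u hu).sub (hs u hu)
    have hfU : MDifferentiableAt (totalModel m r) 𝓘(ℝ, ℝ) (fun v ↦ f v * coord E c.e v b) u :=
      hfd.mul hU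
    change mvfderiv (totalModel m r) (fun v ↦ D v - f v * coord E c.e v b) u _ = _
    rw [mvfderiv_fun_sub hD hfU, sub_apply, h3,
      mvfderiv_fun_mul hfd hU]
    simp only [add_apply, smul_apply, h1, h2, P, smul_eq_mul]
    ring
  -- After contraction, `½ g̃^k_a ∂̇_k D` becomes `½ ℂ D = D`, and `A^b_a` becomes `½ (U^b ℂ f + f
  -- U^b) = f U^b`.
  have hPW : ∀ v ∈ c.domain A, P v = ∑ a, c.hcomp S a v * W a v := by
    intro v hv
    have h1 := hCD v hv
    rw [deriv_liouville_eq_sum hv] at h1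
    have h2 := hh v
    rw [deriv_liouville_eq_sum hv] at h2
    simp only [W, hS.H_sub hS' hv, tensorA, mul_sub, Finset.sum_sub_distrib, mul_add,
      Finset.sum_add_distrib]
    have h3 : ∀ t : Fin r → ℝ, ∑ a, c.hcomp S a v * (1 / 2 * ∑ k, c.gInv G k a v * t k) =
        1 / 2 * ∑ k, coord E c.e v k * t k := by
      intro t
      simp only [← sum_hcomp_mul_gInv hS hv, Finset.sum_mul, Finset.mul_sum]
      rw [Finset.sum_comm]
      exact Finset.sum_congr rfl fun k _ ↦ Finset.sum_congr rfl fun a _ ↦ by ring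
    have h4 : ∀ a, ∑ k, c.gInv G k a v * coord E c.e v b * c.dot A k f v =
        ∑ k, c.gInv G k a v * (coord E c.e v b * c.dot A k f v) := fun a ↦
      Finset.sum_congr rfl fun k _ ↦ by ring
    have h5 : ∑ a, c.hcomp S a v * (1 / 2 * (f v * c.gInv G b a v)) =
        1 / 2 * f v * coord E c.e v b := by
      rw [← sum_hcomp_mul_gInv hS hv, Finset.mul_sum]
      exact Finset.sum_congr rfl fun a _ ↦ by ring
    have h6 : ∑ k, coord E c.e v k * (coord E c.e v b * c.dot A k f v) =
        coord E c.e v b * f v := by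
      rw [← h2, Finset.mul_sum]
      exact Finset.sum_congr rfl fun k _ ↦ by rw [dot, smul_eq_mul]; ring
    simp only [h4, h3, h5, h6]
    change ∑ k, coord E c.e v k * c.dot A k D v = _ at h1
    rw [h1]
    simp only [P]
    ring
  have hσ : ∀ a, MDifferentiableAt (totalModel m r) 𝓘(ℝ, ℝ) (c.hcomp S a) u := fun a ↦
    mdifferentiableAt_pi_apply
    ((contMDiffAt_hcomp hu (hS.contMDiffAt_fst u)).mdifferentiableAt (by simp)) a
  have hH := fun a ↦ (hS.contMDiffAt_H hu hΩ huΩ b a).mdifferentiableAt (by simp)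
  have hH' := fun a ↦ (hS'.contMDiffAt_H hu hΩ huΩ b a).mdifferentiableAt (by simp)
  have hHs : ∀ a, MDifferentiableAt (totalModel m r) 𝓘(ℝ, ℝ)
      (fun v ↦ c.H G S' b a v - c.H G S b a v) u := fun a ↦ (hH' a).sub (hH a)
  have hT := mdifferentiableAt_tensorA hu G hf hh b
  have hW : ∀ a, MDifferentiableAt (totalModel m r) 𝓘(ℝ, ℝ) (W a) u := fun a ↦
    (hHs a).sub (hT a)
  have hCW : ∀ a, A.deriv A.liouville (W a) u = 0 := by
    intro a
    rw [deriv_liouville_eq_sum hu]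
    refine Finset.sum_eq_zero fun k _ ↦ ?_
    have h1 := h.dot_H hS hS' hu huΩ b a k
    simp only [dot, A.deriv_eq] at h1
    rw [A.deriv_eq, mvfderiv_fun_sub (hHs a) (hT a), mvfderiv_fun_sub (hH' a) (hH a),
      sub_apply, sub_apply, h1, add_sub_cancel_left, sub_self, smul_zero]
  -- In `P = S^a W_a` the factors `S^a` are linear on fibres and the `W_a` are annihilated by `ℂ`.
  have hCP' : A.deriv A.liouville P u = P u := by
    have h1 : P =ᶠ[𝓝 u] fun v ↦ ∑ a, c.hcomp S a v * W a v := by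
      filter_upwards [eventually_mem_domain hu] with v hv
      exact hPW v hv
    rw [A.deriv_eq, mvfderiv_congr h1, mvfderiv_finsetSum (φ := fun a v ↦ c.hcomp S a v * W a v)
      fun a _ ↦ (hσ a).mul (hW a), hPW u hu]
    refine Finset.sum_congr rfl fun a _ ↦ ?_
    have h2 := congrFun (hS.deriv_liouville_hcomp hu) a
    rw [A.deriv_eq, mvfderiv_pi_apply
      ((contMDiffAt_hcomp hu (hS.contMDiffAt_fst u)).mdifferentiableAt (by simp))] at h2
    have h3 := hCW a
    rw [A.deriv_eq] at h3
    rw [mvfderiv_fun_mul (hσ a) (hW a), add_apply, smul_apply, smul_apply, h3, smul_zero, zero_add]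
    exact (congrArg (W a u • ·) h2).trans (mul_comm _ _)
  have hP : P u = 0 := by linarith
  simp only [P, D] at hP
  linarith

/-- The Liouville field vanishes at a zero vector, so homogeneity of degree two reads `0 = 2 S^b`.
This covers the zero vectors, which `Ω` may omit. -/
theorem deriv_coord_of_zero (hS : IsSpray G Ω S) (hu : u ∈ c.domain A) (h0 : u.2 = 0) :
    A.deriv S (coord E c.e) u = 0 := by
  have h1 := hS.deriv_liouville_deriv_coord hu
  have h2 : (A.liouville u).2 = 0 := (congrArg (vlift u) h0).trans (vlift_zero hu.1)
  rw [A.deriv_eq, h2, map_zero] at h1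
  exact (smul_eq_zero.1 h1.symm).resolve_left two_ne_zero

/-- The components of the two sprays differ by those of `f ℂ`. -/
theorem BerwaldRelated.deriv_coord (hΩ : IsOpen Ω) (hΩ' : ∀ u, u.2 ≠ 0 → u ∈ Ω)
    (hS : IsSpray G Ω S) (hS' : IsSpray G Ω S') (h : c.BerwaldRelated G Ω f S S')
    (hf : ContMDiff (totalModel m r) 𝓘(ℝ, ℝ) 1 f) (hh : A.OneHomogeneous f)
    (hu : u ∈ c.domain A) (b : Fin r) :
    A.deriv S' (coord E c.e) u b = A.deriv S (coord E c.e) u b + f u * coord E c.e u b := by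
  by_cases h0 : u.2 = 0
  · have h1 : coord E c.e u = 0 := (congrArg (fun z ↦ coord E c.e ⟨u.proj, z⟩) h0).trans
      (coord_zero hu.1)
    rw [deriv_coord_of_zero hS hu h0, deriv_coord_of_zero hS' hu h0, h1]
    simp
  · exact h.deriv_coord_of_mem hΩ hS hS' hf hh hu (hΩ' u h0) b

theorem BerwaldRelated.eq_add_smul_liouville (hΩ : IsOpen Ω) (hΩ' : ∀ u, u.2 ≠ 0 → u ∈ Ω)
    (hS : IsSpray G Ω S) (hS' : IsSpray G Ω S') (h : c.BerwaldRelated G Ω f S S')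
    (hf : ContMDiff (totalModel m r) 𝓘(ℝ, ℝ) 1 f) (hh : A.OneHomogeneous f)
    (hu : u ∈ c.domain A) : S' u = S u + f u • A.liouville u := by
  have hfst : (S u + f u • A.liouville u).1 = (S u).1 :=
    (congrArg ((S u).1 + ·) (smul_zero (f u))).trans (add_zero _)
  have hm : A.MemFiber (fun v ↦ S v + f v • A.liouville v) u := by
    rw [memFiber_iff, hfst, Prod.snd_add, Prod.smul_snd, map_add, map_smul,
      (A.memFiber_iff _ _).1 (hS.memFiber u)]
    have h1 : projDeriv u (A.liouville u).2 = 0 := projDeriv_vlift hu.1 _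
    rw [h1, smul_zero, add_zero]
  refine eq_of_components (c := c) (Y := fun v ↦ S v + f v • A.liouville v) hu (hS'.memFiber u) hm
    (fun a ↦ ?_) fun b ↦ ?_
  · simp only [hcomp, hfst]
    rw [hS.fst_eq, hS'.fst_eq]
  · exact (h.deriv_coord hΩ hΩ' hS hS' hf hh hu b).trans
      (deriv_add_smul_liouville hu f b).symm

end Berwald

end ChartPair

end Converse

end GenLie

end

theorem mainTheorem2 {m r : ℕ} {M : Type*} [TopologicalSpace M]
    [ChartedSpace (EuclideanSpace ℝ (Fin m)) M] [IsManifold (𝓡 m) ∞ M]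
    [T2Space M] [SigmaCompactSpace M]
    {E : M → Type*} [TopologicalSpace (TotalSpace (Fin r → ℝ) E)]
    [∀ x, AddCommGroup (E x)] [∀ x, Module ℝ (E x)] [∀ x, TopologicalSpace (E x)]
    [FiberBundle (Fin r → ℝ) E] [VectorBundle ℝ (Fin r → ℝ) E]
    [ContMDiffVectorBundle ∞ (Fin r → ℝ) E (𝓡 m)]
    (A : GenLie.GeneralizedLieAlgebroid m r E) (G : A.InvertibleMorphism)
    (Ω : Set (TotalSpace (Fin r → ℝ) E)) (hΩ : IsOpen Ω)
    (hΩ_slit : ∀ u : TotalSpace (Fin r → ℝ) E, u.2 ≠ 0 → u ∈ Ω)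
    (S S' : A.Field)
    (hS : GenLie.GeneralizedLieAlgebroid.IsSpray G Ω S)
    (hS' : GenLie.GeneralizedLieAlgebroid.IsSpray G Ω S')
    (𝒜 : Set (GenLie.ChartPair r E)) (h𝒜 : ∀ u, ∃ c ∈ 𝒜, u ∈ c.domain A) :
    A.ProjectivelyRelated S S' ↔
      ∃ f : TotalSpace (Fin r → ℝ) E → ℝ,
        ContMDiff (GenLie.totalModel m r) 𝓘(ℝ, ℝ) 1 f ∧ A.OneHomogeneous f ∧
          ∀ c ∈ 𝒜, c.BerwaldRelated G Ω f S S' := by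
  constructor
  · rintro ⟨f, hf, hh, h⟩
    -- In both directions the same `f` serves; in the converse the equality of sections is local, so
    -- one chart pair around each point suffices.
    exact ⟨f, hf, hh, fun c _ X Y hX hY u hu ↦ hS.berwald_eq hu.2 hS' hΩ hu.1
      (fun v hv ↦ hS.H_sub_eq_tensorA hv hS' hf h) (hX.mem u hu) hY⟩
  · rintro ⟨f, hf, hh, h⟩
    refine ⟨f, hf, hh, funext fun u ↦ ?_⟩
    obtain ⟨c, hc, hu⟩ := h𝒜 u
    exact (h c hc).eq_add_smul_liouville hΩ hΩ_slit hS hS' hf hh hu
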